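/- All spaces are over a fixed scalar field $\mathbb{F}\in\{\mathbb{R},\mathbb{C}\}$, and finite direct sums carry the supremum norm (or any equivalent one). A finite family $(X_i)_{i\in I}$ of Banach spaces is called \emph{splitting for unconditional bases} if, for every unconditional basis $(b_n)_{n\in N}$ of $\bigoplus_{i\in I}X_i$, there is a partition $(N_i)_{i\in I}$ of $N$ such that, for each $i\in I$, the closed linear span of $(b_n)_{n\in N_i}$ is isomorphic (linearly homeomorphic) to $X_i$. For a scalar sequence $a=(a_n)_{n=1}^\infty$ put $\|a\|_0=\sup_n|a_n|$ and $$\|a\|_{m+1}=\max\Big\{\|a\|_m,\ \tfrac12\sup\Big\{\sum_{j=1}^k\|E_ja\|_m:\ k\in\mathbb{N},\ k\le E_1<E_2<\dots<E_k\Big\}\Big\},\qquad m\ge 0,$$ where the $E_j$ are finite subsets of $\mathbb{N}=\{1,2,\dots\}$, $E_ja$ is the restriction of $a$ to $E_j$ (extended by zero), and $k\le E_1<\dots<E_k$ means that $k\le\min E_1$ and $\max E_j<\min E_{j+1}$ for $1\le j<k$. Let $\|a\|_{\mathcal T}=\sup_m\|a\|_m$. For $1\le r<\infty$, the $r$-convexified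 Tsirelson space $\mathcal{T}^{(r)}$ is the completion of the space of finitely supported sequences with the norm $\|x\|=\big\|(|x_n|^r)_{n=1}^\infty\big\|_{\mathcal T}^{1/r}$. For $1<s\le\infty$, $\mathcal{T}_*^{(s)}$ is the dual space of $\mathcal{T}^{(r)}$, where $r=s/(s-1)$ (and $r=1$ if $s=\infty$). \textbf{Theorem.} Let $A\subseteq[1,\infty]$, $B\subseteq[1,\infty)$ and $D\subseteq(1,\infty]$ be finite sets. Then the family $$(\ell_p)_{p\in A}\ \sqcup\ (\mathcal{T}^{(r)})_{r\in B}\ \sqcup\ (\mathcal{T}_*^{(s)})_{s\in D},$$ where $\ell_\infty$ is to be read as $c_0$, is splitting for unconditional bases. -/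

import Mathlib

open scoped ENNReal Topology

universe u v t w

namespace UncBasis

noncomputable section

/-! ### Splitting families -/

/-- A finite family `(X i)` of normed spaces is splitting for unconditional bases if the index set
of every unconditional basis `b` of the direct sum (the finite product, with the sup norm) can be
partitioned into sets `σ ⁻¹' {i}`, such that the closed linear span of `(b n)`, `σ n = i`, is
isomorphic to `X i` for every `i`. -/
def SplittingForUnconditionalBases (𝕜 : Type u) [RCLike 𝕜] {ι : Type v} [Fintype ι]
    (X : ι → Type t) [∀ i, NormedAddCommGroup (X i)] [∀ i, NormedSpace 𝕜 (X i)] : Prop :=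
  ∀ (β : Type w) (b : UnconditionalSchauderBasis β 𝕜 (∀ i, X i)),
    ∃ σ : β → ι, ∀ i,
      Nonempty ((Submodule.span 𝕜 (b '' (σ ⁻¹' {i}))).topologicalClosure ≃L[𝕜] X i)

/-! ### The spaces `ℓ_p`, with `ℓ_∞` meaning `c₀` -/

instance factIci (p : Set.Ici (1 : ℝ≥0∞)) : Fact (1 ≤ (p : ℝ≥0∞)) := ⟨p.2⟩

/-- The null sequences in `ℓ_p`, `1 ≤ p ≤ ∞`. This is all of `ℓ_p` for `p < ∞`, and `c₀` (with the
supremum norm) for `p = ∞`. -/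
def ellSubmodule (𝕜 : Type*) [RCLike 𝕜] (p : Set.Ici (1 : ℝ≥0∞)) :
    Submodule 𝕜 (lp (fun _ : ℕ => 𝕜) (p : ℝ≥0∞)) where
  carrier := {x | Filter.Tendsto (fun n => x n) Filter.atTop (𝓝 0)}
  zero_mem' := by
    simp only [Set.mem_ofPred_eq, lp.coeFn_zero, Pi.zero_apply]
    exact tendsto_const_nhds
  add_mem' := by
    intro x y hx hy
    simp only [Set.mem_ofPred_eq, lp.coeFn_add, Pi.add_apply] at *
    simpa using hx.add hy
  smul_mem' := by
    intro c x hx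
    simp only [Set.mem_ofPred_eq, lp.coeFn_smul, Pi.smul_apply] at *
    simpa using hx.const_smul c

theorem ellSubmodule_eq_top (𝕜 : Type*) [RCLike 𝕜] (p : Set.Ici (1 : ℝ≥0∞))
    (hp : (p : ℝ≥0∞) ≠ ∞) : ellSubmodule 𝕜 p = ⊤ := by
  refine eq_top_iff.2 fun x _ => ?_
  have h0 : 0 < (p : ℝ≥0∞).toReal := ENNReal.toReal_pos (zero_lt_one.trans_le p.2).ne' hp
  have h := ((lp.memℓp x).summable h0).tendsto_atTop_zero
  change Filter.Tendsto (fun n => x n) Filter.atTop (𝓝 0)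
  rw [tendsto_zero_iff_norm_tendsto_zero]
  have h2 := h.rpow_const (p := (p : ℝ≥0∞).toReal⁻¹) (Or.inr (inv_nonneg.2 h0.le))
  rw [Real.zero_rpow (inv_ne_zero h0.ne')] at h2
  refine h2.congr fun n => ?_
  rw [← Real.rpow_mul (norm_nonneg _), mul_inv_cancel₀ h0.ne', Real.rpow_one]

/-- The space `ℓ_p` for `1 ≤ p < ∞`, and `c₀` for `p = ∞`. -/
abbrev Ell (𝕜 : Type*) [RCLike 𝕜] (p : Set.Ici (1 : ℝ≥0∞)) : Type _ := ellSubmodule 𝕜 p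

/-! ### The Tsirelson norm -/

/-- `k ≤ E₁ < E₂ < ⋯ < E_k` for finite sets of positive integers, where `i : ℕ` stands for the
positive integer `i + 1`. (Empty sets are allowed; they contribute nothing to the norm.) -/
def Admissible {k : ℕ} (E : Fin k → Finset ℕ) : Prop :=
  (∀ j, ∀ i ∈ E j, k ≤ i + 1) ∧ ∀ j l, j < l → ∀ i ∈ E j, ∀ i' ∈ E l, i < i'

/-- The Figiel-Johnson iteration, applied to the sequence of absolute values `a` :
`‖a‖₀ = sup_i a_i` and `‖a‖_{m+1} = max (‖a‖_m, (1/2) sup ∑_{j ≤ k} ‖E_j a‖_m)`, the supremum being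
over all `k` and all `k ≤ E₁ < ⋯ < E_k`. -/
def tsirelsonAux : ℕ → (ℕ → ℝ≥0∞) → ℝ≥0∞
  | 0, a => ⨆ i, a i
  | m + 1, a => max (tsirelsonAux m a)
      (⨆ (k : ℕ) (E : Fin k → Finset ℕ) (_ : Admissible E),
        2⁻¹ * ∑ j, tsirelsonAux m ((E j : Set ℕ).indicator a))

/-- The Tsirelson norm `‖a‖_T = sup_m ‖a‖_m` of the sequence of absolute values `a`
(possibly `∞`). -/
def tsirelsonNorm (a : ℕ → ℝ≥0∞) : ℝ≥0∞ := ⨆ m, tsirelsonAux m a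

/-- The norm of the `r`-convexification: `‖ |x|^r ‖_T^{1/r}`. -/
def convexNorm {𝕜 : Type*} [RCLike 𝕜] (r : ℝ) (x : ℕ → 𝕜) : ℝ≥0∞ :=
  (tsirelsonNorm fun i => ‖x i‖ₑ ^ r) ^ r⁻¹

theorem tsirelsonAux_mono (m : ℕ) : Monotone (tsirelsonAux m) := by
  induction m with
  | zero => exact fun a b h => iSup_mono h
  | succ m ih =>
    intro a b h
    refine max_le_max (ih h) ?_
    refine iSup_mono fun k => iSup_mono fun E => iSup_mono fun _ => ?_
    gcongr with j
    exact ih fun i => Set.indicator_le_indicator (h i)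

theorem tsirelsonAux_add (m : ℕ) (a b : ℕ → ℝ≥0∞) :
    tsirelsonAux m (a + b) ≤ tsirelsonAux m a + tsirelsonAux m b := by
  induction m generalizing a b with
  | zero => exact iSup_le fun i => add_le_add (le_iSup a i) (le_iSup b i)
  | succ m ih =>
    refine max_le ((ih a b).trans (add_le_add (le_max_left _ _) (le_max_left _ _))) ?_
    refine iSup_le fun k => iSup_le fun E => iSup_le fun hE => ?_
    have hle : ∀ c : ℕ → ℝ≥0∞, 2⁻¹ * ∑ j, tsirelsonAux m ((E j : Set ℕ).indicator c) ≤
        tsirelsonAux (m + 1) c := fun c => le_max_of_le_right (le_iSup_of_le k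
      (le_iSup₂ (f := fun (E : Fin k → Finset ℕ) (_ : Admissible E) =>
        2⁻¹ * ∑ j, tsirelsonAux m ((E j : Set ℕ).indicator c)) E hE))
    calc 2⁻¹ * ∑ j, tsirelsonAux m ((E j : Set ℕ).indicator (a + b))
        ≤ 2⁻¹ * ∑ j, (tsirelsonAux m ((E j : Set ℕ).indicator a)
            + tsirelsonAux m ((E j : Set ℕ).indicator b)) := by
          gcongr with j
          rw [Set.indicator_add']
          exact ih _ _
      _ = 2⁻¹ * ∑ j, tsirelsonAux m ((E j : Set ℕ).indicator a)
            + 2⁻¹ * ∑ j, tsirelsonAux m ((E j : Set ℕ).indicator b) := by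
          rw [Finset.sum_add_distrib, mul_add]
      _ ≤ _ := add_le_add
          (hle a)
          (hle b)

theorem tsirelsonAux_mul (m : ℕ) (c : ℝ≥0∞) (a : ℕ → ℝ≥0∞) :
    tsirelsonAux m (fun i => c * a i) = c * tsirelsonAux m a := by
  induction m generalizing a with
  | zero => exact (ENNReal.mul_iSup c a).symm
  | succ m ih =>
    have hi : ∀ s : Set ℕ, s.indicator (fun i => c * a i) = fun i => c * s.indicator a i := by
      intro s
      ext i
      by_cases h : i ∈ s <;> simp [h]
    simp only [tsirelsonAux, hi, ih, ← Finset.mul_sum, mul_max, ENNReal.mul_iSup]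
    simp only [mul_left_comm c]

theorem tsirelsonNorm_mono {a b : ℕ → ℝ≥0∞} (h : a ≤ b) : tsirelsonNorm a ≤ tsirelsonNorm b :=
  iSup_mono fun m => tsirelsonAux_mono m h

theorem tsirelsonNorm_add (a b : ℕ → ℝ≥0∞) :
    tsirelsonNorm (a + b) ≤ tsirelsonNorm a + tsirelsonNorm b :=
  iSup_le fun m => (tsirelsonAux_add m a b).trans
    (add_le_add (le_iSup (fun m => tsirelsonAux m a) m) (le_iSup (fun m => tsirelsonAux m b) m))

theorem tsirelsonNorm_mul (c : ℝ≥0∞) (a : ℕ → ℝ≥0∞) :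
    tsirelsonNorm (fun i => c * a i) = c * tsirelsonNorm a := by
  simp only [tsirelsonNorm, tsirelsonAux_mul, ENNReal.mul_iSup]

theorem le_tsirelsonNorm (a : ℕ → ℝ≥0∞) (i : ℕ) : a i ≤ tsirelsonNorm a :=
  (le_iSup a i).trans (le_iSup (fun m => tsirelsonAux m a) 0)

section convexNorm

variable {𝕜 : Type*} [RCLike 𝕜] {r : ℝ}

theorem enorm_le_convexNorm (hr : 1 ≤ r) (x : ℕ → 𝕜) (i : ℕ) : ‖x i‖ₑ ≤ convexNorm r x := by
  have h0 : 0 < r := zero_lt_one.trans_le hr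
  calc ‖x i‖ₑ = (‖x i‖ₑ ^ r) ^ r⁻¹ := (ENNReal.rpow_rpow_inv h0.ne' _).symm
    _ ≤ _ := ENNReal.rpow_le_rpow (le_tsirelsonNorm (fun i => ‖x i‖ₑ ^ r) i)
        (inv_nonneg.2 h0.le)

theorem convexNorm_smul (hr : 1 ≤ r) (c : 𝕜) (x : ℕ → 𝕜) :
    convexNorm r (c • x) = ‖c‖ₑ * convexNorm r x := by
  have h0 : 0 < r := zero_lt_one.trans_le hr
  simp only [convexNorm, Pi.smul_apply, enorm_smul, ENNReal.mul_rpow_of_nonneg _ _ h0.le,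
    tsirelsonNorm_mul, ENNReal.mul_rpow_of_nonneg _ _ (inv_nonneg.2 h0.le),
    ENNReal.rpow_rpow_inv h0.ne']

theorem convexNorm_zero (hr : 1 ≤ r) : convexNorm r (0 : ℕ → 𝕜) = 0 := by
  simpa using convexNorm_smul hr (0 : 𝕜) (0 : ℕ → 𝕜)

theorem eq_zero_of_convexNorm_eq_zero (hr : 1 ≤ r) {x : ℕ → 𝕜} (h : convexNorm r x = 0) :
    x = 0 := by
  ext i
  have := enorm_le_convexNorm hr x i
  rw [h] at this
  simpa using this

theorem convexNorm_add (hr : 1 ≤ r) (x y : ℕ → 𝕜) :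
    convexNorm r (x + y) ≤ convexNorm r x + convexNorm r y := by
  have h0 : 0 < r := zero_lt_one.trans_le hr
  by_cases hx0 : convexNorm r x = 0
  · rw [eq_zero_of_convexNorm_eq_zero hr hx0]; simp
  by_cases hy0 : convexNorm r y = 0
  · rw [eq_zero_of_convexNorm_eq_zero hr hy0]; simp
  by_cases hx : convexNorm r x = ∞
  · simp [hx]
  by_cases hy : convexNorm r y = ∞
  · simp [hy]
  have hX : tsirelsonNorm (fun i => ‖x i‖ₑ ^ r) = convexNorm r x ^ r :=
    (ENNReal.rpow_inv_rpow h0.ne' _).symm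
  have hY : tsirelsonNorm (fun i => ‖y i‖ₑ ^ r) = convexNorm r y ^ r :=
    (ENNReal.rpow_inv_rpow h0.ne' _).symm
  set S := convexNorm r x
  set T := convexNorm r y
  have hST0 : S + T ≠ 0 := by simp [hx0]
  have hST : S + T ≠ ∞ := by simp [hx, hy]
  have hw : S / (S + T) + T / (S + T) = 1 := by
    rw [← ENNReal.add_div, ENNReal.div_self hST0 hST]
  have h5 : ∀ U : ℝ≥0∞, U ≠ 0 → U ≠ ∞ → U / (S + T) * ((S + T) / U) = 1 := by
    intro U hU0 hU
    rw [← mul_div_assoc, ENNReal.div_mul_cancel hST0 hST, ENNReal.div_self hU0 hU]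
  have key : (fun i => ‖(x + y) i‖ₑ ^ r) ≤
      (fun i => (S / (S + T) * ((S + T) / S) ^ r) * ‖x i‖ₑ ^ r) +
      (fun i => (T / (S + T) * ((S + T) / T) ^ r) * ‖y i‖ₑ ^ r) := by
    intro i
    have h1 : S / (S + T) * ((S + T) / S * ‖x i‖ₑ) = ‖x i‖ₑ := by
      rw [← mul_assoc, h5 S hx0 hx, one_mul]
    have h2 : T / (S + T) * ((S + T) / T * ‖y i‖ₑ) = ‖y i‖ₑ := by
      rw [← mul_assoc, h5 T hy0 hy, one_mul]
    calc ‖(x + y) i‖ₑ ^ r ≤ (‖x i‖ₑ + ‖y i‖ₑ) ^ r :=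
          ENNReal.rpow_le_rpow (enorm_add_le _ _) h0.le
      _ = (S / (S + T) * ((S + T) / S * ‖x i‖ₑ) + T / (S + T) * ((S + T) / T * ‖y i‖ₑ)) ^ r := by
          rw [h1, h2]
      _ ≤ _ := ENNReal.rpow_arith_mean_le_arith_mean2_rpow _ _ _ _ hw hr
      _ = _ := by
          simp only [ENNReal.mul_rpow_of_nonneg _ _ h0.le, Pi.add_apply, mul_assoc]
  have h3 : ∀ U : ℝ≥0∞, U ≠ 0 → U ≠ ∞ →
      U / (S + T) * ((S + T) / U) ^ r * U ^ r = U / (S + T) * (S + T) ^ r := by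
    intro U hU0 hU
    rw [mul_assoc, ← ENNReal.mul_rpow_of_nonneg _ _ h0.le, ENNReal.div_mul_cancel hU0 hU]
  have h4 : tsirelsonNorm (fun i => ‖(x + y) i‖ₑ ^ r) ≤ (S + T) ^ r := by
    refine (tsirelsonNorm_mono key).trans ((tsirelsonNorm_add _ _).trans ?_)
    rw [tsirelsonNorm_mul, tsirelsonNorm_mul, hX, hY, h3 S hx0 hx, h3 T hy0 hy, ← add_mul, hw,
      one_mul]
  calc convexNorm r (x + y) ≤ ((S + T) ^ r) ^ r⁻¹ :=
        ENNReal.rpow_le_rpow h4 (inv_nonneg.2 h0.le)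
    _ = S + T := ENNReal.rpow_rpow_inv h0.ne' _

end convexNorm

/-! ### The convexified Tsirelson spaces and their duals -/

/-- All scalar sequences `x` with `‖ |x|^r ‖_T < ∞`. -/
def finiteNormSubmodule (𝕜 : Type*) [RCLike 𝕜] (r : Set.Ici (1 : ℝ)) : Submodule 𝕜 (ℕ → 𝕜) where
  carrier := {x | convexNorm (r : ℝ) x ≠ ∞}
  zero_mem' := by simp [convexNorm_zero r.2]
  add_mem' := fun {x y} hx hy => ne_top_of_le_ne_top
    (ENNReal.add_ne_top.2 ⟨hx, hy⟩) (convexNorm_add r.2 x y)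
  smul_mem' := fun c x hx => by
    simp only [Set.mem_ofPred_eq, convexNorm_smul r.2] at *
    exact ENNReal.mul_ne_top enorm_ne_top hx

/-- The space of all scalar sequences `x` with `‖ |x|^r ‖_T < ∞`, normed by
`‖x‖ = ‖ |x|^r ‖_T^{1/r}`. -/
def FiniteNorm (𝕜 : Type*) [RCLike 𝕜] (r : Set.Ici (1 : ℝ)) : Type _ := finiteNormSubmodule 𝕜 r

section FiniteNorm

variable (𝕜 : Type*) [RCLike 𝕜] (r : Set.Ici (1 : ℝ))

instance : AddCommGroup (FiniteNorm 𝕜 r) := inferInstanceAs (AddCommGroup (finiteNormSubmodule 𝕜 r))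

instance : Module 𝕜 (FiniteNorm 𝕜 r) := inferInstanceAs (Module 𝕜 (finiteNormSubmodule 𝕜 r))

/-- The inclusion of `FiniteNorm 𝕜 r` into the space of all sequences. -/
def FiniteNorm.toSeq : FiniteNorm 𝕜 r →ₗ[𝕜] (ℕ → 𝕜) := (finiteNormSubmodule 𝕜 r).subtype

instance : Norm (FiniteNorm 𝕜 r) := ⟨fun x => (convexNorm (r : ℝ) (FiniteNorm.toSeq 𝕜 r x)).toReal⟩

theorem FiniteNorm.core : NormedSpace.Core 𝕜 (FiniteNorm 𝕜 r) where
  norm_nonneg _ := ENNReal.toReal_nonneg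
  norm_smul c x := by
    change (convexNorm (r : ℝ) (FiniteNorm.toSeq 𝕜 r (c • x))).toReal = _
    rw [map_smul, convexNorm_smul r.2, ENNReal.toReal_mul, toReal_enorm]
    rfl
  norm_triangle x y := by
    change (convexNorm (r : ℝ) (FiniteNorm.toSeq 𝕜 r (x + y))).toReal ≤
      (convexNorm (r : ℝ) (FiniteNorm.toSeq 𝕜 r x)).toReal +
      (convexNorm (r : ℝ) (FiniteNorm.toSeq 𝕜 r y)).toReal
    have hx : convexNorm (r : ℝ) (FiniteNorm.toSeq 𝕜 r x) ≠ ∞ := Subtype.property x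
    have hy : convexNorm (r : ℝ) (FiniteNorm.toSeq 𝕜 r y) ≠ ∞ := Subtype.property y
    rw [map_add, ← ENNReal.toReal_add hx hy]
    exact ENNReal.toReal_mono (ENNReal.add_ne_top.2 ⟨hx, hy⟩) (convexNorm_add r.2 _ _)
  norm_eq_zero_iff x := by
    have hx : convexNorm (r : ℝ) (FiniteNorm.toSeq 𝕜 r x) ≠ ∞ := Subtype.property x
    constructor
    · intro h
      have h' : convexNorm (r : ℝ) (FiniteNorm.toSeq 𝕜 r x) = 0 :=
        ((ENNReal.toReal_eq_zero_iff _).1 h).resolve_right hx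
      exact Subtype.ext (eq_zero_of_convexNorm_eq_zero r.2 h')
    · rintro rfl
      change (convexNorm (r : ℝ) (FiniteNorm.toSeq 𝕜 r 0)).toReal = 0
      rw [map_zero, convexNorm_zero r.2, ENNReal.toReal_zero]

instance : NormedAddCommGroup (FiniteNorm 𝕜 r) := NormedAddCommGroup.ofCore (FiniteNorm.core 𝕜 r)

instance : NormedSpace 𝕜 (FiniteNorm 𝕜 r) := NormedSpace.ofCore (FiniteNorm.core 𝕜 r)

/-- The finitely supported sequences. -/
def finiteSupport : Submodule 𝕜 (FiniteNorm 𝕜 r) where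
  carrier := {x | (Function.support (FiniteNorm.toSeq 𝕜 r x)).Finite}
  zero_mem' := by simp
  add_mem' := fun {x y} hx hy => by
    simp only [Set.mem_ofPred_eq, map_add] at *
    exact (hx.union hy).subset (Function.support_add _ _)
  smul_mem' := fun c x hx => by
    simp only [Set.mem_ofPred_eq, map_smul] at *
    exact hx.subset (Function.support_const_smul_subset c _)

/-- The `r`-convexified Tsirelson space `T^{(r)}`, `1 ≤ r < ∞`: the completion of the finitely
supported sequences in the norm `x ↦ ‖ |x|^r ‖_T^{1/r}`, realized as their closure in the space of
all sequences of finite norm. -/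
abbrev Tsirelson : Type _ := (finiteSupport 𝕜 r).topologicalClosure

end FiniteNorm

/-- The conjugate exponent `r = s / (s - 1)` of `1 < s ≤ ∞`, with `r = 1` for `s = ∞`. -/
def conjExp (s : Set.Ioi (1 : ℝ≥0∞)) : Set.Ici (1 : ℝ) :=
  ⟨(ENNReal.conjExponent (s : ℝ≥0∞)).toReal, by
    have hs : ((s : ℝ≥0∞) - 1)⁻¹ ≠ ∞ := ENNReal.inv_ne_top.2 (tsub_pos_of_lt s.2).ne'
    rw [Set.mem_Ici, ENNReal.conjExponent, ENNReal.toReal_add ENNReal.one_ne_top hs,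
      ENNReal.toReal_one]
    exact le_add_of_nonneg_right ENNReal.toReal_nonneg⟩

/-- `T_*^{(s)}`, `1 < s ≤ ∞`: the dual of `T^{(r)}`, where `r = s / (s - 1)`. -/
abbrev TsirelsonDual (𝕜 : Type*) [RCLike 𝕜] (s : Set.Ioi (1 : ℝ≥0∞)) : Type _ :=
  StrongDual 𝕜 (Tsirelson 𝕜 (conjExp s))

/-! ### The family of the theorem -/

section Family

variable (𝕜 : Type*) [RCLike 𝕜] (A : Finset (Set.Ici (1 : ℝ≥0∞))) (B : Finset (Set.Ici (1 : ℝ)))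
  (D : Finset (Set.Ioi (1 : ℝ≥0∞)))

/-- The disjoint union of the families `(ℓ_p)_{p ∈ A}`, `(T^{(r)})_{r ∈ B}` and
`(T_*^{(s)})_{s ∈ D}`. -/
def Family : A ⊕ B ⊕ D → Type _
  | .inl p => Ell 𝕜 p
  | .inr (.inl r) => Tsirelson 𝕜 r
  | .inr (.inr s) => TsirelsonDual 𝕜 s

instance : ∀ i, NormedAddCommGroup (Family 𝕜 A B D i)
  | .inl p => inferInstanceAs (NormedAddCommGroup (Ell 𝕜 p))
  | .inr (.inl r) => inferInstanceAs (NormedAddCommGroup (Tsirelson 𝕜 r))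
  | .inr (.inr s) => inferInstanceAs (NormedAddCommGroup (TsirelsonDual 𝕜 s))

instance : ∀ i, NormedSpace 𝕜 (Family 𝕜 A B D i)
  | .inl p => inferInstanceAs (NormedSpace 𝕜 (Ell 𝕜 p))
  | .inr (.inl r) => inferInstanceAs (NormedSpace 𝕜 (Tsirelson 𝕜 r))
  | .inr (.inr s) => inferInstanceAs (NormedSpace 𝕜 (TsirelsonDual 𝕜 s))

end Family

end

end UncBasis

/-!
Let `b` be an unconditional basis of `∏ i, X i`. Each `b n` is substantial in some coordinate
`σ n`, because the absolute values of the entries of an operator in an unconditional basis are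
controlled by averaging over signs. Suppose that, for `i ≠ j`, all operators from `X i` to `X j`, or
all operators from `X j` to `X i`, are small on the tails of a fixed basis. Then the basis
projection onto the span of `σ ⁻¹' {j}` and the projection onto the `j`-th coordinate, each
restricted to the range of the other, are inverse to each other modulo compact operators, so that
the ranges are isomorphic up to finite dimensions. As `X j ≃ X j × 𝕜`, this finite-dimensional
defect is absorbed.

Sums of `N` normalized blocks grow like `N ^ α` with `α = 1 / p`, `1 / r`, `1 / s` in `ℓ_p`,
`T^(r)`, `T_*^(s)`, and a gliding hump shows that operators from a smaller to a larger exponent are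
small on tails. For equal exponents, compare one block plus a long normalized sum of later blocks:
its norm is `2 ^ α` in `ℓ_p`, but at most `(7 / 4) ^ α` in `T^(r)`, since an admissible family of
sets either misses the first block or has too few sets to cut many of the later ones. By duality,
the corresponding norm in `T_*^(s)` is at least `2 / (7 / 4) ^ (1 / r) > 2 ^ α`.
-/

open Filter

namespace UncBasis

/-! ### Multipliers of an unconditional basis -/

section Signs

variable {β : Type*}

theorem sum_abs_le_two_mul {t : β → ℝ} {F : Finset β} {B : ℝ}
    (h : ∀ G ⊆ F, |∑ n ∈ G, t n| ≤ B) : ∑ n ∈ F, |t n| ≤ 2 * B := by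
  have hpos := (abs_le.1 (h _ (F.filter_subset (0 ≤ t ·)))).2
  have hneg := (abs_le.1 (h _ (F.filter_subset (¬ 0 ≤ t ·)))).1
  have epos : ∑ n ∈ F with 0 ≤ t n, |t n| = ∑ n ∈ F with 0 ≤ t n, t n :=
    Finset.sum_congr rfl fun n hn => abs_of_nonneg (Finset.mem_filter.1 hn).2
  have eneg : ∑ n ∈ F with ¬ 0 ≤ t n, |t n| = -∑ n ∈ F with ¬ 0 ≤ t n, t n := by
    rw [← Finset.sum_neg_distrib]
    exact Finset.sum_congr rfl fun n hn => abs_of_neg (not_le.1 (Finset.mem_filter.1 hn).2)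
  rw [← Finset.sum_filter_add_sum_filter_not F (0 ≤ t ·), epos, eneg]
  linarith

theorem norm_le_abs_re_add_abs_im {𝕜 : Type*} [RCLike 𝕜] (z : 𝕜) :
    ‖z‖ ≤ |RCLike.re z| + |RCLike.im z| := by
  refine (sq_le_sq₀ (norm_nonneg _) (by positivity)).1 ?_
  rw [RCLike.norm_sq_eq_def, add_sq, sq_abs, sq_abs]
  nlinarith [mul_nonneg (abs_nonneg (RCLike.re z)) (abs_nonneg (RCLike.im z))]

theorem sum_norm_le_four_mul {𝕜 : Type*} [RCLike 𝕜] {t : β → 𝕜} {F : Finset β} {B : ℝ}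
    (h : ∀ G ⊆ F, ‖∑ n ∈ G, t n‖ ≤ B) : ∑ n ∈ F, ‖t n‖ ≤ 4 * B := by
  have hre : ∑ n ∈ F, |RCLike.re (t n)| ≤ 2 * B := sum_abs_le_two_mul fun G hG => by
    rw [← map_sum]
    exact (RCLike.abs_re_le_norm _).trans (h G hG)
  have him : ∑ n ∈ F, |RCLike.im (t n)| ≤ 2 * B := sum_abs_le_two_mul fun G hG => by
    rw [← map_sum]
    exact (RCLike.abs_im_le_norm _).trans (h G hG)
  calc ∑ n ∈ F, ‖t n‖ ≤ ∑ n ∈ F, (|RCLike.re (t n)| + |RCLike.im (t n)|) :=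
        Finset.sum_le_sum fun n _ => norm_le_abs_re_add_abs_im (t n)
    _ ≤ 4 * B := by
        rw [Finset.sum_add_distrib]
        linarith

variable {Y : Type*} [SeminormedAddCommGroup Y] [NormedSpace ℝ Y]

theorem norm_le_of_norm_add_le_of_norm_sub_le {x y : Y} {η : ℝ} (hadd : ‖x + y‖ ≤ η)
    (hsub : ‖x - y‖ ≤ η) : ‖x‖ ≤ η := by
  have htwo : ‖(2 : ℝ) • x‖ ≤ η + η := by
    rw [two_smul, show x + x = (x + y) + (x - y) by abel]
    exact (norm_add_le _ _).trans (add_le_add hadd hsub)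
  rw [norm_smul, Real.norm_two] at htwo
  linarith

theorem sum_insert_update_mul_smul {M : Type*} [AddCommGroup M] [DecidableEq β] {a : β}
    {F : Finset β} (ha : a ∉ F) (g : β → β → M) (ε : β → ℤˣ) (θ : ℤˣ) :
    ∑ n ∈ insert a F, ∑ m ∈ insert a F,
        (Function.update ε a θ n * Function.update ε a θ m) • g n m =
      g a a + ∑ n ∈ F, ∑ m ∈ F, (ε n * ε m) • g n m +
        θ • ∑ m ∈ F, ε m • (g a m + g m a) := by
  have hne : ∀ n ∈ F, Function.update ε a θ n = ε n := fun n hn =>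
    Function.update_of_ne (ne_of_mem_of_not_mem hn ha) ..
  have hrow : ∀ n ∈ F, ∑ m ∈ insert a F,
      (Function.update ε a θ n * Function.update ε a θ m) • g n m =
      θ • ε n • g n a + ∑ m ∈ F, (ε n * ε m) • g n m := fun n hn => by
    rw [Finset.sum_insert ha, hne n hn, Function.update_self, smul_smul, mul_comm θ]
    exact congrArg _ (Finset.sum_congr rfl fun m hm => by rw [hne m hm])
  have hrow_a : ∑ m ∈ insert a F,
      (Function.update ε a θ a * Function.update ε a θ m) • g a m =
      g a a + ∑ m ∈ F, θ • ε m • g a m := by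
    rw [Finset.sum_insert ha, Function.update_self, Int.units_mul_self, one_smul]
    exact congrArg _ (Finset.sum_congr rfl fun m hm => by rw [hne m hm, smul_smul])
  rw [Finset.sum_insert ha, hrow_a, Finset.sum_congr rfl hrow]
  simp only [Finset.smul_sum, smul_add, Finset.sum_add_distrib]
  abel

/- The diagonal of a matrix is the average of its conjugates by diagonal sign matrices; the
induction averages out one sign at a time. -/
theorem norm_add_sum_diag_le (F : Finset β) (g : β → β → Y) (v : Y) {η : ℝ}
    (h : ∀ ε : β → ℤˣ, ‖v + ∑ n ∈ F, ∑ m ∈ F, (ε n * ε m) • g n m‖ ≤ η) :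
    ‖v + ∑ n ∈ F, g n n‖ ≤ η := by
  classical
  induction F using Finset.induction_on generalizing v with
  | empty => simpa using h 1
  | insert a F ha ih =>
    rw [Finset.sum_insert ha, ← add_assoc]
    refine ih (v + g a a) fun ε => ?_
    have hθ : ∀ θ : ℤˣ, ‖v + g a a + ∑ n ∈ F, ∑ m ∈ F, (ε n * ε m) • g n m +
        θ • ∑ m ∈ F, ε m • (g a m + g m a)‖ ≤ η := fun θ => by
      have := h (Function.update ε a θ)
      rwa [sum_insert_update_mul_smul ha, ← add_assoc, ← add_assoc] at this
    have hplus := hθ 1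
    have hminus := hθ (-1)
    rw [one_smul] at hplus
    rw [Units.neg_smul, one_smul, ← sub_eq_add_neg] at hminus
    exact norm_le_of_norm_add_le_of_norm_sub_le hplus hminus

end Signs

section Multiplier

variable {𝕜 : Type*} [RCLike 𝕜] {V : Type*} [NormedAddCommGroup V] [NormedSpace 𝕜 V]
  {β : Type*} (b : UnconditionalSchauderBasis β 𝕜 V)
  {Y : Type*} [NormedAddCommGroup Y] [NormedSpace 𝕜 Y]
  {Z : Type*} [NormedAddCommGroup Z] [NormedSpace 𝕜 Z]

/-- The finite multiplier that multiplies the coordinates in `F` by the scalars `c n` and removes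
all others. -/
noncomputable def multiplier (F : Finset β) (c : β → 𝕜) : V →L[𝕜] V :=
  ∑ n ∈ F, c n • (b.coord n).smulRight (b n)

theorem multiplier_apply (F : Finset β) (c : β → 𝕜) (x : V) :
    multiplier b F c x = ∑ n ∈ F, (c n * b.coord n x) • b n := by
  simp [multiplier, mul_smul]

theorem multiplier_eq_proj {F : Finset β} {c : β → 𝕜} (hc : ∀ n ∈ F, c n = 1) :
    multiplier b F c = b.proj F :=
  Finset.sum_congr rfl fun n hn => by rw [hc n hn, one_smul]

theorem exists_multiplier_sign_eq (F : Finset β) (ε : β → ℤˣ) :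
    ∃ G G' : Finset β, multiplier b F (fun n => ((ε n : ℤ) : 𝕜)) = b.proj G - b.proj G' := by
  refine ⟨{n ∈ F | ε n = 1}, {n ∈ F | ¬ ε n = 1}, ?_⟩
  rw [multiplier, ← Finset.sum_filter_add_sum_filter_not F (ε · = 1), sub_eq_add_neg,
    GeneralSchauderBasis.proj, GeneralSchauderBasis.proj, ← Finset.sum_neg_distrib]
  congr 1 <;> refine Finset.sum_congr rfl fun n hn => ?_
  · simp [(Finset.mem_filter.1 hn).2]
  · simp [(Int.units_eq_one_or (ε n)).resolve_left (Finset.mem_filter.1 hn).2]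

theorem norm_map_multiplier_sign_le (P : V →L[𝕜] Y) {x : V} {η : ℝ}
    (hη : ∀ G : Finset β, ‖P (b.proj G x)‖ ≤ η) (F : Finset β) (ε : β → ℤˣ) :
    ‖P (multiplier b F (fun n => ((ε n : ℤ) : 𝕜)) x)‖ ≤ 2 * η := by
  obtain ⟨G, G', h⟩ := exists_multiplier_sign_eq b F ε
  rw [h, sub_apply, map_sub, two_mul]
  exact (norm_sub_le _ _).trans (add_le_add (hη G) (hη G'))

/- By duality it suffices to bound `∑ ‖f (b n)‖ * ‖b.coord n x‖` for `‖f‖ ≤ 1`, and absolute sums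
are controlled by sums over subsets without signs. -/
theorem exists_norm_multiplier_le [CompleteSpace V] :
    ∃ K : ℝ, 0 ≤ K ∧ ∀ (F : Finset β) (c : β → 𝕜) (r : ℝ), 0 ≤ r → (∀ n ∈ F, ‖c n‖ ≤ r) →
      ‖multiplier b F c‖ ≤ r * K := by
  obtain ⟨C, hC⟩ := b.exists_norm_proj_le
  have hC0 : 0 ≤ C := (norm_nonneg _).trans (hC ∅)
  refine ⟨4 * C, by positivity, fun F c r hr hc => ?_⟩
  refine ContinuousLinearMap.opNorm_le_bound _ (by positivity) fun x => ?_
  obtain ⟨f, hf, hfx⟩ := exists_dual_vector'' 𝕜 (multiplier b F c x)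
  have hsum : ∑ n ∈ F, ‖b.coord n x * f (b n)‖ ≤ 4 * (C * ‖x‖) :=
    sum_norm_le_four_mul fun G _ => by
      calc ‖∑ n ∈ G, b.coord n x * f (b n)‖ = ‖f (b.proj G x)‖ := by simp
        _ ≤ 1 * (C * ‖x‖) :=
          f.le_of_opNorm_le_of_le hf ((b.proj G).le_of_opNorm_le (hC G) x)
        _ = C * ‖x‖ := one_mul _
  calc ‖multiplier b F c x‖ = ‖f (multiplier b F c x)‖ := by rw [hfx]; simp
    _ ≤ ∑ n ∈ F, ‖f ((c n * b.coord n x) • b n)‖ := by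
        rw [multiplier_apply, map_sum]
        exact norm_sum_le _ _
    _ ≤ ∑ n ∈ F, r * ‖b.coord n x * f (b n)‖ := by
        refine Finset.sum_le_sum fun n hn => ?_
        rw [map_smul, smul_eq_mul, mul_assoc, norm_mul]
        gcongr
        exact hc n hn
    _ ≤ r * (4 * (C * ‖x‖)) := by
        rw [← Finset.mul_sum]
        gcongr
    _ = r * (4 * C) * ‖x‖ := by ring

theorem norm_map_multiplier_diag_le (A : V →L[𝕜] Y) (T : V →L[𝕜] V) (F : Finset β) (c d : β → 𝕜)
    (x : V) {η : ℝ}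
    (h : ∀ ε : β → ℤˣ, ‖A (multiplier b F (fun n => (ε n : ℤ) * c n)
      (T (multiplier b F (fun n => (ε n : ℤ) * d n) x)))‖ ≤ η) :
    ‖A (multiplier b F (fun n => c n * b.coord n (T (b n)) * d n) x)‖ ≤ η := by
  let _ : NormedSpace ℝ Y := NormedSpace.restrictScalars ℝ 𝕜 Y
  have hdiag := norm_add_sum_diag_le F
    (fun n m => (c n * b.coord n (T (b m)) * d m * b.coord m x) • A (b n)) 0 (η := η) fun ε => ?_
  · simpa only [zero_add, multiplier_apply, map_sum, map_smul] using hdiag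
  · refine (congrArg norm ?_).trans_le (h ε)
    simp only [zero_add, multiplier_apply, map_sum, map_smul, Finset.smul_sum, Units.smul_def,
      ← Int.cast_smul_eq_zsmul 𝕜, smul_smul]
    rw [Finset.sum_comm]
    refine Finset.sum_congr rfl fun m _ => Finset.sum_congr rfl fun n _ => ?_
    congr 1
    push_cast
    ring

theorem norm_sign_mul_inv_le {d : 𝕜} {δ : ℝ} (hδ : 0 < δ) (hd : δ ≤ ‖d‖) (ε : ℤˣ) :
    ‖((ε : ℤ) : 𝕜) * d⁻¹‖ ≤ δ⁻¹ := by
  have hε : ‖((ε : ℤ) : 𝕜)‖ = 1 := by rcases Int.units_eq_one_or ε with h | h <;> simp [h]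
  rw [norm_mul, hε, one_mul, norm_inv]
  exact inv_anti₀ hδ hd

variable [CompleteSpace V]

theorem exists_norm_proj_apply_le {δ : ℝ} (hδ : 0 < δ) :
    ∃ C : ℝ, 0 ≤ C ∧ ∀ (F : Finset β) (P : V →L[𝕜] V),
      (∀ n ∈ F, δ ≤ ‖b.coord n (P (b n))‖) → ∀ (x : V) (η : ℝ),
      (∀ G : Finset β, ‖P (b.proj G x)‖ ≤ η) → ‖b.proj F x‖ ≤ C * η := by
  obtain ⟨K, hK0, hK⟩ := exists_norm_multiplier_le b
  refine ⟨δ⁻¹ * K * 2, by positivity, fun F P hP x η hη => ?_⟩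
  have hdiag := norm_map_multiplier_diag_le b (ContinuousLinearMap.id 𝕜 V) P F
    (fun n => (b.coord n (P (b n)))⁻¹) 1 x (η := δ⁻¹ * K * 2 * η) fun ε => ?_
  · rwa [multiplier_eq_proj] at hdiag
    intro n hn
    rw [Pi.one_apply, mul_one, inv_mul_cancel₀ (norm_pos_iff.1 (hδ.trans_le (hP n hn)))]
  · simp only [Pi.one_apply, mul_one, mul_assoc _ 2 η]
    exact (multiplier b F _).le_of_opNorm_le_of_le
      (hK F (fun n => ((ε n : ℤ) : 𝕜) * (b.coord n (P (b n)))⁻¹) δ⁻¹ (by positivity)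
        fun n hn => norm_sign_mul_inv_le hδ (hP n hn) (ε n))
      (norm_map_multiplier_sign_le b P hη F ε)

theorem exists_norm_map_proj_apply_le {δ : ℝ} (hδ : 0 < δ) :
    ∃ C : ℝ, 0 ≤ C ∧ ∀ (F : Finset β) (J : Z →L[𝕜] V) (R : V →L[𝕜] Z),
      (∀ n ∈ F, δ ≤ ‖b.coord n (J (R (b n)))‖) → ‖R‖ ≤ 1 → ∀ (A : V →L[𝕜] Y) (η : ℝ), 0 ≤ η →
      (∀ (G : Finset β) z, ‖A (b.proj G (J z))‖ ≤ η * ‖z‖) →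
        ∀ x, ‖A (b.proj F x)‖ ≤ C * η * ‖x‖ := by
  obtain ⟨K, hK0, hK⟩ := exists_norm_multiplier_le b
  refine ⟨2 * (δ⁻¹ * K), by positivity, fun F J R hJR hR A η hη0 hη x => ?_⟩
  have hdiag := norm_map_multiplier_diag_le b A (J ∘L R) F
    1 (fun n => (b.coord n (J (R (b n))))⁻¹) x (η := 2 * (δ⁻¹ * K) * η * ‖x‖) fun ε => ?_
  · rwa [multiplier_eq_proj] at hdiag
    intro n hn
    rw [Pi.one_apply, one_mul]
    exact mul_inv_cancel₀ (norm_pos_iff.1 (hδ.trans_le (hJR n hn)))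
  · simp only [Pi.one_apply, mul_one, ContinuousLinearMap.comp_apply]
    set z := R (multiplier b F (fun n => (ε n : ℤ) * (b.coord n (J (R (b n))))⁻¹) x)
    have hz : ‖z‖ ≤ 1 * (δ⁻¹ * K * ‖x‖) :=
      R.le_of_opNorm_le_of_le hR (ContinuousLinearMap.le_of_opNorm_le _
        (hK F _ _ (by positivity) fun n hn => norm_sign_mul_inv_le hδ (hJR n hn) (ε n)) x)
    calc _ ≤ 2 * (η * ‖z‖) := norm_map_multiplier_sign_le b A (hη · z) F ε
      _ ≤ 2 * (η * (1 * (δ⁻¹ * K * ‖x‖))) := by gcongr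
      _ = 2 * (δ⁻¹ * K) * η * ‖x‖ := by ring

end Multiplier

/-! ### Projections of an unconditional basis -/

section SetProj

variable {𝕜 : Type*} [RCLike 𝕜] {V : Type*} [NormedAddCommGroup V] [NormedSpace 𝕜 V]
  {β : Type*} (b : UnconditionalSchauderBasis β 𝕜 V)
  {Y : Type*} [NormedAddCommGroup Y] [NormedSpace 𝕜 Y]
  {Z : Type*} [NormedAddCommGroup Z] [NormedSpace 𝕜 Z]

theorem norm_comp_multiplier_comp_apply_le (A : V →L[𝕜] Y) (B : Z →L[𝕜] V) (F : Finset β)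
    {c : β → 𝕜} (hc : ∀ n, ‖c n‖ ≤ 1) (z : Z) :
    ‖A (multiplier b F c (B z))‖ ≤
      (∑ k ∈ F, ‖A ∘L ((b.coord k).smulRight (b k)) ∘L B‖) * ‖z‖ := by
  have hexpand : A (multiplier b F c (B z)) =
      ∑ k ∈ F, c k • (A ∘L ((b.coord k).smulRight (b k)) ∘L B) z := by
    simp [multiplier_apply, mul_smul]
  rw [hexpand, Finset.sum_mul]
  refine (norm_sum_le _ _).trans (Finset.sum_le_sum fun k _ => ?_)
  rw [norm_smul]
  exact (mul_le_of_le_one_left (norm_nonneg _) (hc k)).trans (ContinuousLinearMap.le_opNorm _ _)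

open scoped Classical in
theorem sum_indicator_eq_proj (s : Set β) (F : Finset β) (x : V) :
    ∑ n ∈ F, s.indicator (fun n => b.coord n x • b n) n = b.proj {n ∈ F | n ∈ s} x := by
  rw [GeneralSchauderBasis.proj_apply, Finset.sum_filter]
  rfl

variable [CompleteSpace V]

theorem hasSum_indicator (s : Set β) (x : V) :
    HasSum (s.indicator fun n => b.coord n x • b n)
      (∑' n, s.indicator (fun n => b.coord n x • b n) n) :=
  ((b.expansion x).summable.indicator s).hasSum

theorem exists_norm_tsum_indicator_le (s : Set β) :
    ∃ C : ℝ, ∀ x, ‖∑' n, s.indicator (fun n => b.coord n x • b n) n‖ ≤ C * ‖x‖ := by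
  obtain ⟨C, hC⟩ := b.exists_norm_proj_le
  refine ⟨C, fun x => ?_⟩
  refine le_of_tendsto (hasSum_indicator b s x).norm (Eventually.of_forall fun F => ?_)
  rw [sum_indicator_eq_proj]
  exact (b.proj _).le_of_opNorm_le (hC _) x

/-- The projection of `V` onto the closed span of the basis vectors with index in `s`, along the
other basis vectors. -/
noncomputable def setProj (s : Set β) : V →L[𝕜] V :=
  LinearMap.mkContinuousOfExistsBound
    { toFun := fun x => ∑' n, s.indicator (fun n => b.coord n x • b n) n
      map_add' := fun x y => by
        rw [← ((hasSum_indicator b s x).add (hasSum_indicator b s y)).tsum_eq]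
        simp only [← Set.indicator_add, ← add_smul, map_add]
      map_smul' := fun a x => by
        rw [RingHom.id_apply, ← ((hasSum_indicator b s x).const_smul a).tsum_eq]
        simp only [← Set.indicator_const_smul_apply, smul_smul, map_smul, smul_eq_mul] }
    (exists_norm_tsum_indicator_le b s)

theorem hasSum_setProj (s : Set β) (x : V) :
    HasSum (s.indicator fun n => b.coord n x • b n) (setProj b s x) :=
  hasSum_indicator b s x

theorem setProj_coe (F : Finset β) (x : V) : setProj b (F : Set β) x = b.proj F x := by
  refine (hasSum_setProj b F x).unique ?_
  rw [GeneralSchauderBasis.proj_apply, ← Finset.sum_indicator_subset _ subset_rfl]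
  exact hasSum_sum_of_ne_finset_zero fun n hn => Set.indicator_of_notMem (by simpa using hn) _

theorem setProj_basis_mem {s : Set β} {n : β} (hn : n ∈ s) : setProj b s (b n) = b n := by
  classical
  refine (hasSum_setProj b s (b n)).unique ?_
  convert b.expansion (b n) using 2 with m
  by_cases hm : m ∈ s
  · exact Set.indicator_of_mem hm _
  · have hmn : m ≠ n := fun h => hm (h ▸ hn)
    rw [Set.indicator_of_notMem hm, b.ortho, Pi.single_eq_of_ne hmn, zero_smul]

theorem setProj_setProj (s : Set β) (x : V) : setProj b s (setProj b s x) = setProj b s x := by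
  have h := (setProj b s).hasSum (hasSum_setProj b s x)
  refine h.unique ((hasSum_setProj b s x).congr_fun fun n => ?_)
  by_cases hn : n ∈ s
  · simp only [Set.indicator_of_mem hn, map_smul, setProj_basis_mem b hn]
  · simp only [Set.indicator_of_notMem hn, map_zero]

theorem mem_closure_span_iff_setProj_eq (s : Set β) (x : V) :
    x ∈ (Submodule.span 𝕜 (b '' s)).topologicalClosure ↔ setProj b s x = x := by
  constructor
  · intro hx
    have hclosed : IsClosed ((setProj b s).eqLocus (ContinuousLinearMap.id 𝕜 V) : Set V) :=
      isClosed_eq (setProj b s).continuous continuous_id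
    refine Submodule.topologicalClosure_minimal _ (Submodule.span_le.2 ?_) hclosed hx
    rintro _ ⟨n, hn, rfl⟩
    exact setProj_basis_mem b hn
  · intro hx
    rw [← hx]
    refine mem_closure_of_tendsto (hasSum_setProj b s x) (Eventually.of_forall fun F => ?_)
    refine Submodule.sum_mem _ fun n _ => ?_
    by_cases hn : n ∈ s
    · rw [Set.indicator_of_mem hn]
      exact Submodule.smul_mem _ _ (Submodule.subset_span ⟨n, hn, rfl⟩)
    · rw [Set.indicator_of_notMem hn]
      exact Submodule.zero_mem _

theorem sum_setProj_preimage {ι : Type*} [Fintype ι] (σ : β → ι) (x : V) :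
    ∑ i, setProj b (σ ⁻¹' {i}) x = x := by
  refine (hasSum_sum fun i _ => hasSum_setProj b (σ ⁻¹' {i}) x).unique ?_
  convert b.expansion x using 2 with n
  refine (Fintype.sum_eq_single (σ n) fun i hi => ?_).trans
    (Set.indicator_of_mem (s := σ ⁻¹' {σ n}) rfl _)
  exact Set.indicator_of_notMem (s := σ ⁻¹' {i}) (Ne.symm hi) _

theorem setProj_sub_setProj_of_eqOn {s s' : Set β} {F : Finset β}
    (h : ∀ n ∈ F, n ∈ s ↔ n ∈ s') (x : V) :
    setProj b s x - setProj b s' x = setProj b (s \ F) x - setProj b (s' \ F) x := by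
  refine ((hasSum_setProj b s x).sub (hasSum_setProj b s' x)).unique ?_
  refine ((hasSum_setProj b (s \ F) x).sub (hasSum_setProj b (s' \ F) x)).congr_fun fun n => ?_
  by_cases hn : n ∈ F
  · by_cases hs : n ∈ s <;> simp [hn, hs, ← h n hn]
  · by_cases hs : n ∈ s <;> by_cases hs' : n ∈ s' <;> simp [hn, hs, hs']

theorem setProj_eq_add_multiplier {s s' : Set β} {F : Finset β} (h : ∀ n ∉ F, n ∈ s ↔ n ∈ s') :
    ∃ c : β → 𝕜, (∀ n, ‖c n‖ ≤ 1) ∧ setProj b s = setProj b s' + multiplier b F c := by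
  classical
  refine ⟨fun n => (if n ∈ s then 1 else 0) - (if n ∈ s' then 1 else 0), fun n => ?_, ?_⟩
  · by_cases hs : n ∈ s <;> by_cases hs' : n ∈ s' <;> simp [hs, hs']
  · ext x
    rw [add_apply, ← sub_eq_iff_eq_add', multiplier_apply]
    refine ((hasSum_setProj b s x).sub (hasSum_setProj b s' x)).unique ?_
    refine (hasSum_sum_of_ne_finset_zero (s := F) fun n hn => ?_).congr_fun fun n => ?_
    · simp [h n hn]
    · by_cases hs : n ∈ s <;> by_cases hs' : n ∈ s' <;> simp [hs, hs']

theorem norm_map_setProj_apply_le (A : V →L[𝕜] Y) {s : Set β} {x : V} {η : ℝ}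
    (h : ∀ F : Finset β, (F : Set β) ⊆ s → ‖A (b.proj F x)‖ ≤ η) : ‖A (setProj b s x)‖ ≤ η := by
  classical
  refine le_of_tendsto ((A.continuous.tendsto _).comp (hasSum_setProj b s x)).norm
    (Eventually.of_forall fun F => ?_)
  rw [Function.comp_apply, sum_indicator_eq_proj]
  exact h _ fun n hn => (Finset.mem_filter.1 hn).2

theorem continuous_setProj (x : V) :
    Continuous fun a : β → Bool => setProj b {n | a n = true} x := by
  refine continuous_iff_continuousAt.2 fun a => Metric.continuousAt_iff'.2 fun ε hε => ?_
  obtain ⟨F, hF⟩ := summable_iff_vanishing_norm.mp (b.expansion x).summable (ε / 3) (by positivity)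
  have hsmall : ∀ s : Set β, ‖setProj b (s \ F) x‖ ≤ ε / 3 := fun s => by
    refine norm_map_setProj_apply_le b (ContinuousLinearMap.id 𝕜 V) fun G hG => ?_
    have := hF G (Finset.disjoint_left.2 fun n hn => (hG hn).2)
    simpa using this.le
  have hnear : ∀ᶠ a' in 𝓝 a, ∀ n ∈ F, a' n = a n := (eventually_all_finset F).2 fun n _ =>
    ((isOpen_discrete {a n}).preimage (continuous_apply (A := fun _ : β => Bool) n)).mem_nhds rfl
  filter_upwards [hnear] with a' ha'
  rw [dist_eq_norm, setProj_sub_setProj_of_eqOn b (F := F) fun n hn => by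
    simp only [Set.mem_ofPred_eq, ha' n hn]]
  refine (norm_sub_le _ _).trans_lt ?_
  linarith [hsmall {n | a' n = true}, hsmall {n | a n = true}]

/- The Baire category theorem in the compact space `β → Bool` of all subsets of `β`. -/
theorem exists_forall_norm_setProj_le_of_eqOn (A : ℕ → V →L[𝕜] Y) (B : ℕ → Z →L[𝕜] V)
    (h : ∀ T : V →L[𝕜] V, Tendsto (fun n => ‖A n ∘L T ∘L B n‖) atTop (𝓝 0)) {η : ℝ} (hη : 0 < η) :
    ∃ (N : ℕ) (F : Finset β) (a₀ : Set β), ∀ a : Set β, (∀ k ∈ F, k ∈ a ↔ k ∈ a₀) →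
      ∀ n ≥ N, ∀ z, ‖A n (setProj b a (B n z))‖ ≤ η * ‖z‖ := by
  classical
  let C : ℕ → Set (β → Bool) := fun N =>
    {a | ∀ n ≥ N, ∀ z, ‖A n (setProj b {k | a k = true} (B n z))‖ ≤ η * ‖z‖}
  have hclosed : ∀ N, IsClosed (C N) := fun N => by
    simp only [C, Set.ofPred_forall]
    refine isClosed_iInter fun n => isClosed_iInter fun _ => isClosed_iInter fun z => ?_
    exact isClosed_le ((A n).continuous.comp (continuous_setProj b (B n z))).norm continuous_const
  have hcover : ⋃ N, C N = Set.univ := Set.eq_univ_of_forall fun a => Set.mem_iUnion.2 <| by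
    obtain ⟨N, hN⟩ := eventually_atTop.1 ((h (setProj b {k | a k = true})).eventually_le_const hη)
    exact ⟨N, fun n hn => (A n ∘L setProj b _ ∘L B n).le_of_opNorm_le (hN n hn)⟩
  obtain ⟨N, a₀, ha₀⟩ := nonempty_interior_of_iUnion_of_closed hclosed hcover
  rw [mem_interior_iff_mem_nhds, nhds_pi, Filter.mem_pi] at ha₀
  obtain ⟨I, hI, t, ht, htC⟩ := ha₀
  refine ⟨N, hI.toFinset, {k | a₀ k = true}, fun a ha => ?_⟩
  have hmem : (fun k => decide (k ∈ a)) ∈ C N := htC fun k hk => by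
    have hk' : decide (k ∈ a) = a₀ k := by
      rw [Bool.eq_iff_iff, decide_eq_true_iff]
      exact ha k (hI.mem_toFinset.2 hk)
    simp only [hk']
    exact mem_of_mem_nhds (ht k)
  simpa only [C, Set.mem_ofPred_eq, decide_eq_true_eq, Set.ofPred_mem_eq] using hmem

theorem exists_forall_norm_setProj_le (A : ℕ → V →L[𝕜] Y) (B : ℕ → Z →L[𝕜] V)
    (h : ∀ T : V →L[𝕜] V, Tendsto (fun n => ‖A n ∘L T ∘L B n‖) atTop (𝓝 0)) {η : ℝ} (hη : 0 < η) :
    ∃ N, ∀ n ≥ N, ∀ (a : Set β) (z : Z), ‖A n (setProj b a (B n z))‖ ≤ η * ‖z‖ := by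
  obtain ⟨N, F, a₀, hN⟩ := exists_forall_norm_setProj_le_of_eqOn b A B h (half_pos hη)
  have hsum : Tendsto (fun n => ∑ k ∈ F, ‖A n ∘L ((b.coord k).smulRight (b k)) ∘L B n‖) atTop
      (𝓝 0) := by
    rw [← Finset.sum_const_zero (s := F)]
    exact tendsto_finsetSum _ fun k _ => h _
  obtain ⟨M, hM⟩ := eventually_atTop.1 (hsum.eventually_le_const (half_pos hη))
  refine ⟨max N M, fun n hn a z => ?_⟩
  obtain ⟨c, hc, hac⟩ := setProj_eq_add_multiplier b (s := a) (s' := a \ F ∪ a₀ ∩ F) (F := F)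
    fun k hk => by simp [hk]
  have hpatch := hN (a \ F ∪ a₀ ∩ F) (fun k hk => by simp [Finset.mem_coe.2 hk]) n
    ((le_max_left _ _).trans hn) z
  have hfinite := norm_comp_multiplier_comp_apply_le b (A n) (B n) F hc z
  rw [hac, add_apply, map_add]
  refine (norm_add_le _ _).trans ?_
  linarith [mul_le_mul_of_nonneg_right (hM n ((le_max_right _ _).trans hn)) (norm_nonneg z)]

end SetProj

/-! ### Isomorphisms modulo compact operators -/

section FiniteExtension

variable {𝕜 : Type*} [RCLike 𝕜] {X Y Z : Type*} [NormedAddCommGroup X] [NormedSpace 𝕜 X]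
  [NormedAddCommGroup Y] [NormedSpace 𝕜 Y] [NormedAddCommGroup Z] [NormedSpace 𝕜 Z]

/- After an automorphism of `Y × 𝕜`, the isomorphism fixes the line `0 × 𝕜`, so that it passes to
the quotients by this line. -/
theorem nonempty_equiv_of_prod_field_equiv (e : (X × 𝕜) ≃L[𝕜] (Y × 𝕜)) :
    Nonempty (X ≃L[𝕜] Y) := by
  have hne : e (0, 1) ≠ 0 := fun h => by simpa using congrArg Prod.snd (e.map_eq_zero_iff.1 h)
  obtain ⟨A, hA⟩ := SeparatingDual.exists_continuousLinearEquiv_apply_eq (R := 𝕜) hne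
    (y := ((0, 1) : Y × 𝕜)) (by simp)
  set f := e.trans A
  have hf : ∀ c : 𝕜, f (0, c) = (0, c) := fun c => by
    have : ((0, c) : X × 𝕜) = c • (0, 1) := by simp
    rw [this, map_smul, show f (0, 1) = (0, 1) from hA]
    simp
  have hf' : ∀ c : 𝕜, f.symm (0, c) = (0, c) := fun c => by rw [f.symm_apply_eq, hf]
  refine ⟨ContinuousLinearEquiv.equivOfInverse
    (.fst 𝕜 Y 𝕜 ∘L f.toContinuousLinearMap ∘L .inl 𝕜 X 𝕜)
    (.fst 𝕜 X 𝕜 ∘L f.symm.toContinuousLinearMap ∘L .inl 𝕜 Y 𝕜) (fun x => ?_) fun y => ?_⟩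
  · have : ((f (x, 0)).1, (0 : 𝕜)) = f (x, 0) - (0, (f (x, 0)).2) := by simp [Prod.ext_iff]
    simp [this, hf']
  · have : ((f.symm (y, 0)).1, (0 : 𝕜)) = f.symm (y, 0) - (0, (f.symm (y, 0)).2) := by
      simp [Prod.ext_iff]
    simp [this, hf]

variable (𝕜 X) in
theorem nonempty_prod_fin_succ_equiv (n : ℕ) :
    Nonempty ((X × (Fin (n + 1) → 𝕜)) ≃L[𝕜] ((X × (Fin n → 𝕜)) × 𝕜)) :=
  ⟨((ContinuousLinearEquiv.refl 𝕜 X).prodCongr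
    ((Fin.consEquivL 𝕜 (fun _ : Fin (n + 1) => 𝕜)).symm.trans
      (.prodComm 𝕜 𝕜 (Fin n → 𝕜)))).trans (.symm (.prodAssoc 𝕜 X (Fin n → 𝕜) 𝕜))⟩

theorem nonempty_prod_fin_equiv (hX : Nonempty ((X × 𝕜) ≃L[𝕜] X)) (n : ℕ) :
    Nonempty ((X × (Fin n → 𝕜)) ≃L[𝕜] X) := by
  induction n with
  | zero => exact ⟨.prodUnique 𝕜 X (Fin 0 → 𝕜)⟩
  | succ n ih =>
    obtain ⟨e⟩ := hX
    obtain ⟨e'⟩ := ih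
    obtain ⟨f⟩ := nonempty_prod_fin_succ_equiv 𝕜 X n
    exact ⟨(f.trans (e'.prodCongr (.refl 𝕜 𝕜))).trans e⟩

theorem nonempty_equiv_of_prod_fin_equiv (hX : Nonempty ((X × 𝕜) ≃L[𝕜] X)) (n : ℕ)
    (h : Nonempty ((Z × (Fin n → 𝕜)) ≃L[𝕜] X)) : Nonempty (Z ≃L[𝕜] X) := by
  induction n with
  | zero =>
    obtain ⟨e⟩ := h
    exact ⟨(ContinuousLinearEquiv.prodUnique 𝕜 Z (Fin 0 → 𝕜)).symm.trans e⟩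
  | succ n ih =>
    obtain ⟨e⟩ := hX
    obtain ⟨e'⟩ := h
    obtain ⟨f⟩ := nonempty_prod_fin_succ_equiv 𝕜 Z n
    exact ih (nonempty_equiv_of_prod_field_equiv ((f.symm.trans e').trans e.symm))

theorem nonempty_equiv_of_prod_equiv_prod (hX : Nonempty ((X × 𝕜) ≃L[𝕜] X)) {W N : Type*}
    [NormedAddCommGroup W] [NormedSpace 𝕜 W] [FiniteDimensional 𝕜 W]
    [NormedAddCommGroup N] [NormedSpace 𝕜 N] [FiniteDimensional 𝕜 N]
    (e : (Z × W) ≃L[𝕜] (X × N)) : Nonempty (Z ≃L[𝕜] X) := by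
  have eW : W ≃L[𝕜] (Fin (Module.finrank 𝕜 W) → 𝕜) := .ofFinrankEq (by simp)
  have eN : N ≃L[𝕜] (Fin (Module.finrank 𝕜 N) → 𝕜) := .ofFinrankEq (by simp)
  obtain ⟨eX⟩ := nonempty_prod_fin_equiv hX (Module.finrank 𝕜 N)
  exact nonempty_equiv_of_prod_fin_equiv hX _
    ⟨((((ContinuousLinearEquiv.refl 𝕜 Z).prodCongr eW.symm).trans e).trans
      ((ContinuousLinearEquiv.refl 𝕜 X).prodCongr eN)).trans eX⟩

end FiniteExtension

section Compact

variable {𝕜 : Type*} [RCLike 𝕜] {X Y Z : Type*} [NormedAddCommGroup X] [NormedSpace 𝕜 X]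
  [NormedAddCommGroup Y] [NormedSpace 𝕜 Y] [NormedAddCommGroup Z] [NormedSpace 𝕜 Z]

theorem tendsto_norm_comp_of_isCompactOperator {A : ℕ → X →L[𝕜] Y} {C : ℝ} (hC : ∀ n, ‖A n‖ ≤ C)
    (hA : ∀ x, Tendsto (fun n => A n x) atTop (𝓝 0)) {K : Z →L[𝕜] X} (hK : IsCompactOperator K) :
    Tendsto (fun n => ‖A n ∘L K‖) atTop (𝓝 0) := by
  have hC0 : 0 ≤ C := (norm_nonneg _).trans (hC 0)
  obtain ⟨S, hS, hKS⟩ := hK.image_closedBall_subset_compact (f := (K : Z →ₗ[𝕜] X)) 1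
  rw [Metric.tendsto_atTop]
  intro ε hε
  obtain ⟨t, -, ht, hcover⟩ := hS.finite_cover_balls (e := ε / (4 * (C + 1))) (by positivity)
  obtain ⟨N, hN⟩ := eventually_atTop.1 <| (eventually_all_finite ht).2 fun x _ =>
    (hA x).norm.eventually_le_const (u := ε / 4) (by simpa using by positivity)
  refine ⟨N, fun n hn => ?_⟩
  have hball : ∀ z, ‖z‖ ≤ 1 → ‖A n (K z)‖ ≤ ε / 2 := fun z hz => by
    obtain ⟨x, hx, hzx⟩ := Set.mem_iUnion₂.1 (hcover (hKS ⟨z, by simpa using hz, rfl⟩))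
    have hdiff : ‖A n (K z - x)‖ ≤ C * (ε / (4 * (C + 1))) :=
      (A n).le_of_opNorm_le_of_le (hC n) (mem_ball_iff_norm.1 hzx).le
    have hfrac : C * (ε / (4 * (C + 1))) ≤ ε / 4 := by
      rw [mul_div_assoc', div_le_div_iff₀ (by positivity) (by positivity)]
      nlinarith
    rw [← sub_add_cancel (K z) x, map_add]
    linarith [norm_add_le (A n (K z - x)) (A n x), hN n hn x hx]
  rw [dist_zero_right, norm_norm]
  exact (ContinuousLinearMap.opNorm_le_of_unit_norm (half_pos hε).le
    fun z hz => hball z hz.le).trans_lt (half_lt_self hε)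

/-- The complement `x ↦ ∑_{i ≥ n} xᵢ bᵢ` of the `n`-th basis projection. -/
noncomputable def tail (b : SchauderBasis 𝕜 X) (n : ℕ) : X →L[𝕜] X :=
  ContinuousLinearMap.id 𝕜 X - b.proj n

theorem tail_apply (b : SchauderBasis 𝕜 X) (n : ℕ) (x : X) : tail b n x = x - b.proj n x := rfl

theorem tendsto_tail_apply (b : SchauderBasis 𝕜 X) (x : X) :
    Tendsto (fun n => tail b n x) atTop (𝓝 0) := by
  simpa [tail_apply] using (b.tendsto_proj x).const_sub x

theorem exists_norm_tail_le [CompleteSpace X] (b : SchauderBasis 𝕜 X) :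
    ∃ C : ℝ, ∀ n, ‖tail b n‖ ≤ C := by
  obtain ⟨C, hC⟩ := b.exists_norm_proj_le
  exact ⟨1 + C, fun n => (norm_sub_le _ _).trans (add_le_add ContinuousLinearMap.norm_id_le (hC n))⟩

theorem finiteDimensional_range_proj (b : SchauderBasis 𝕜 X) (n : ℕ) :
    FiniteDimensional 𝕜 (b.proj n).range := by
  rw [show (b.proj n).range = _ from b.range_proj_eq_span n]
  exact FiniteDimensional.span_of_finite 𝕜 (Set.toFinite _)

theorem isCompactOperator_of_finiteDimensional_dom [FiniteDimensional 𝕜 X] (T : X →L[𝕜] Y) :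
    IsCompactOperator T :=
  have := FiniteDimensional.proper_rclike 𝕜 X
  isCompactOperator_of_locallyCompactSpace_rng T

theorem isCompactOperator_proj (b : SchauderBasis 𝕜 X) (n : ℕ) : IsCompactOperator (b.proj n) :=
  have := finiteDimensional_range_proj b n
  (isCompactOperator_of_finiteDimensional_dom (b.proj n).range.subtypeL).comp_clm
    (b.proj n).rangeRestrict

theorem tendsto_norm_tail_comp [CompleteSpace X] (b : SchauderBasis 𝕜 X) {K : Z →L[𝕜] X}
    (hK : IsCompactOperator K) : Tendsto (fun n => ‖tail b n ∘L K‖) atTop (𝓝 0) :=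
  tendsto_norm_comp_of_isCompactOperator (exists_norm_tail_le b).choose_spec
    (tendsto_tail_apply b) hK

theorem isCompactOperator_of_tendsto_tail_comp [CompleteSpace X] (b : SchauderBasis 𝕜 X)
    {T : Z →L[𝕜] X} (h : Tendsto (fun n => ‖tail b n ∘L T‖) atTop (𝓝 0)) :
    IsCompactOperator T := by
  refine isCompactOperator_of_tendsto (F := fun n => b.proj n ∘L T) (l := atTop) ?_
    (Eventually.of_forall fun n => (isCompactOperator_proj b n).comp_clm T)
  rw [tendsto_iff_norm_sub_tendsto_zero]
  refine h.congr fun n => ?_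
  rw [norm_sub_rev, tail, ContinuousLinearMap.sub_comp, ContinuousLinearMap.id_comp]

theorem isCompactOperator_of_tendsto_comp_tail [CompleteSpace Y] (b : SchauderBasis 𝕜 X)
    {T : X →L[𝕜] Y} (h : Tendsto (fun n => ‖T ∘L tail b n‖) atTop (𝓝 0)) :
    IsCompactOperator T := by
  refine isCompactOperator_of_tendsto (F := fun n => T ∘L b.proj n) (l := atTop) ?_
    (Eventually.of_forall fun n => (isCompactOperator_proj b n).clm_comp T)
  rw [tendsto_iff_norm_sub_tendsto_zero]
  refine h.congr fun n => ?_
  rw [norm_sub_rev, tail, ContinuousLinearMap.comp_sub, ContinuousLinearMap.comp_id]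

theorem exists_equiv_eq_sub_add_proj [CompleteSpace X] (b : SchauderBasis 𝕜 X) {K : X →L[𝕜] X}
    (hK : IsCompactOperator K) :
    ∃ (n : ℕ) (U : X ≃L[𝕜] X), ∀ x, U x = x - K x + b.proj n (K x) := by
  obtain ⟨n, hn⟩ := ((tendsto_norm_tail_comp b hK).eventually_lt_const one_pos).exists
  obtain ⟨u, hu⟩ := isUnit_one_sub_of_norm_lt_one hn
  refine ⟨n, ContinuousLinearEquiv.unitsEquiv 𝕜 X u, fun x => ?_⟩
  have hux : (u : X →L[𝕜] X) x = x - tail b n (K x) := by rw [hu]; rfl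
  rw [ContinuousLinearEquiv.unitsEquiv_apply, hux, tail_apply]
  abel

theorem finiteDimensional_ker_of_isCompactOperator (f : X →L[𝕜] Y) (g : Y →L[𝕜] X)
    (h : IsCompactOperator (ContinuousLinearMap.id 𝕜 X - g ∘L f)) :
    FiniteDimensional 𝕜 f.ker := by
  have hfix : ∀ w : f.ker, (ContinuousLinearMap.id 𝕜 X - g ∘L f) w = w := fun w => by
    simp [show f w = 0 from w.2]
  have hcod := (h.comp_clm f.ker.subtypeL).codRestrict (V := f.ker)
    (fun w => (congrArg (· ∈ f.ker) (hfix w)).mpr w.2) f.isClosed_ker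
  refine FiniteDimensional.of_isCompactOperator_id (𝕜 := 𝕜) (E := f.ker) ?_
  exact (congrArg IsCompactOperator (funext fun w => Subtype.ext (hfix w).symm)).mpr hcod

/- Write `S T = U - P K` with `U` an isomorphism and `P` a basis projection. Adding the range of `P`
to `Z` turns `T` and `U⁻¹ S` into an operator with an exact left inverse. -/
theorem nonempty_equiv_of_isCompactOperator [CompleteSpace X] (b : SchauderBasis 𝕜 X)
    (hX : Nonempty ((X × 𝕜) ≃L[𝕜] X)) (S : Z →L[𝕜] X) (T : X →L[𝕜] Z)
    (hST : IsCompactOperator (ContinuousLinearMap.id 𝕜 X - S ∘L T))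
    (hTS : IsCompactOperator (ContinuousLinearMap.id 𝕜 Z - T ∘L S)) : Nonempty (Z ≃L[𝕜] X) := by
  set K := ContinuousLinearMap.id 𝕜 X - S ∘L T with hK
  obtain ⟨n, U, hU⟩ := exists_equiv_eq_sub_add_proj b hST
  let W := (b.proj n).range
  have : FiniteDimensional 𝕜 W := finiteDimensional_range_proj b n
  let S' : (Z × W) →L[𝕜] X := U.symm.toContinuousLinearMap ∘L S.coprod W.subtypeL
  let T' : X →L[𝕜] Z × W := T.prod ((b.proj n).rangeRestrict ∘L K)
  have hinv : ∀ x, S' (T' x) = x := fun x => by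
    refine (U.symm_apply_eq).2 ?_
    change S (T x) + b.proj n (K x) = U x
    rw [hU]
    simp [hK]
  have hker : FiniteDimensional 𝕜 S'.ker := by
    refine finiteDimensional_ker_of_isCompactOperator S' (.inl 𝕜 Z W ∘L T ∘L U) ?_
    have hsum := ((hTS.comp_clm (.fst 𝕜 Z W)).clm_comp (.inl 𝕜 Z W)).add
      (isCompactOperator_of_finiteDimensional_dom
        (.inr 𝕜 Z W - .inl 𝕜 Z W ∘L T ∘L W.subtypeL) |>.comp_clm (.snd 𝕜 Z W))
    refine (congrArg IsCompactOperator (funext fun p => Prod.ext ?_ ?_)).mpr hsum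
    · simp [S']
      abel
    · simp
  exact nonempty_equiv_of_prod_equiv_prod hX
    (ContinuousLinearEquiv.equivOfRightInverse S' T' hinv)

end Compact

/-! ### Operators which are small on tails -/

section Splitting

/-- Every operator from `X` to `Y` is small on the tails of the basis `E` of `X`. This is the
incomparability of `X` and `Y` which the splitting theorem needs. -/
def SmallOnTails {𝕜 : Type*} [RCLike 𝕜] {X : Type*} [NormedAddCommGroup X] [NormedSpace 𝕜 X]
    (E : SchauderBasis 𝕜 X) (Y : Type*) [NormedAddCommGroup Y] [NormedSpace 𝕜 Y] : Prop :=
  ∀ T : X →L[𝕜] Y, Tendsto (fun n => ‖T ∘L tail E n‖) atTop (𝓝 0)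

variable {𝕜 : Type*} [RCLike 𝕜]

theorem SmallOnTails.isCompactOperator {X Y : Type*} [NormedAddCommGroup X] [NormedSpace 𝕜 X]
    [NormedAddCommGroup Y] [NormedSpace 𝕜 Y] [CompleteSpace Y] {E : SchauderBasis 𝕜 X}
    (h : SmallOnTails E Y) (T : X →L[𝕜] Y) : IsCompactOperator T :=
  isCompactOperator_of_tendsto_comp_tail E (h T)

theorem tendsto_norm_zero_of_forall_eventually {V Y : Type*} [NormedAddCommGroup V]
    [NormedSpace 𝕜 V] [NormedAddCommGroup Y] [NormedSpace 𝕜 Y] {A : ℕ → V →L[𝕜] Y} {C : ℝ}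
    (hC : 0 ≤ C) (h : ∀ η > 0, ∀ᶠ n in atTop, ∀ z, ‖A n z‖ ≤ C * η * ‖z‖) :
    Tendsto (fun n => ‖A n‖) atTop (𝓝 0) := by
  refine (NormedAddGroup.tendsto_nhds_zero (f := fun n => ‖A n‖)).2 fun ε hε => ?_
  filter_upwards [h (ε / (2 * (C + 1))) (by positivity)] with n hn
  rw [norm_norm]
  refine ((A n).opNorm_le_bound (by positivity) hn).trans_lt ?_
  rw [mul_div_assoc', div_lt_iff₀ (by positivity)]
  nlinarith

variable {ι : Type*} [Fintype ι] {X : ι → Type*}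
  [∀ i, NormedAddCommGroup (X i)] [∀ i, NormedSpace 𝕜 (X i)]

variable (X) in
theorem norm_proj_le_one (i : ι) :
    ‖(ContinuousLinearMap.proj i : (∀ i, X i) →L[𝕜] X i)‖ ≤ 1 :=
  ContinuousLinearMap.opNorm_le_bound _ zero_le_one fun x => by
    simpa using norm_le_pi_norm x i

variable [DecidableEq ι] {β : Type*}

/-- The partition `σ` of a basis `b` of `∏ i, X i` assigns to each `b n` a summand in which it is
substantial: the `n`-th coefficient of the `σ n`-component of `b n` is bounded away from `0`. -/
def IsSubstantial (b : UnconditionalSchauderBasis β 𝕜 (∀ i, X i)) (σ : β → ι) (δ : ℝ) : Prop :=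
  0 < δ ∧ ∀ n, δ ≤ ‖b.coord n (ContinuousLinearMap.single 𝕜 X (σ n) (b n (σ n)))‖

theorem exists_isSubstantial (b : UnconditionalSchauderBasis β 𝕜 (∀ i, X i)) :
    ∃ (σ : β → ι) (δ : ℝ), IsSubstantial b σ δ := by
  suffices h : ∀ n, ∃ i, ((Fintype.card ι : ℝ) + 1)⁻¹ ≤
      ‖b.coord n (ContinuousLinearMap.single 𝕜 X i (b n i))‖ by
    choose σ hσ using h
    exact ⟨σ, _, by positivity, hσ⟩
  intro n
  by_contra! hlt
  have hone : ∑ i, b.coord n (ContinuousLinearMap.single 𝕜 X i (b n i)) = (1 : 𝕜) := by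
    rw [← map_sum]
    simp [Finset.univ_sum_single, b.ortho]
  have hcard : (1 : ℝ) ≤ ∑ _i : ι, ((Fintype.card ι : ℝ) + 1)⁻¹ := by
    calc (1 : ℝ) = ‖∑ i, b.coord n (ContinuousLinearMap.single 𝕜 X i (b n i))‖ := by
          rw [hone, norm_one]
      _ ≤ _ := (norm_sum_le _ _).trans (Finset.sum_le_sum fun i _ => (hlt i).le)
  rw [Finset.sum_const, Finset.card_univ, nsmul_eq_mul, ← div_eq_mul_inv,
    le_div_iff₀ (by positivity)] at hcard
  linarith

variable [∀ i, CompleteSpace (X i)] {b : UnconditionalSchauderBasis β 𝕜 (∀ i, X i)}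
  {σ : β → ι} {δ : ℝ} {E : ∀ i, SchauderBasis 𝕜 (X i)}

theorem isCompactOperator_setProj_comp_single (hσ : IsSubstantial b σ δ) {i j : ι}
    (h : SmallOnTails (E j) (X i)) :
    IsCompactOperator (setProj b (σ ⁻¹' {i}) ∘L ContinuousLinearMap.single 𝕜 X j) := by
  obtain ⟨hδ, hσ⟩ := hσ
  let pr : (∀ i, X i) →L[𝕜] X i := .proj i
  obtain ⟨C, hC0, hC⟩ := exists_norm_proj_apply_le b hδ
  refine isCompactOperator_of_tendsto_comp_tail (E j)
    (tendsto_norm_zero_of_forall_eventually hC0 fun η hη => ?_)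
  obtain ⟨N, hN⟩ := exists_forall_norm_setProj_le b (fun _ => pr)
    (fun n => ContinuousLinearMap.single 𝕜 X j ∘L tail (E j) n)
    (fun T => h (pr ∘L T ∘L ContinuousLinearMap.single 𝕜 X j)) hη
  filter_upwards [eventually_ge_atTop N] with n hn z
  refine norm_map_setProj_apply_le b (.id 𝕜 _) fun F hF => ?_
  rw [mul_assoc]
  refine hC F (ContinuousLinearMap.single 𝕜 X i ∘L pr) (fun k hk => ?_) _ _ fun G => ?_
  · obtain rfl : σ k = i := hF hk
    exact hσ k
  · rw [← setProj_coe]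
    exact (Pi.norm_single _).trans_le (hN n hn G z)

theorem isCompactOperator_proj_comp_setProj (hσ : IsSubstantial b σ δ) {i j : ι}
    (h : SmallOnTails (E j) (X i)) :
    IsCompactOperator
      ((ContinuousLinearMap.proj i : (∀ i, X i) →L[𝕜] X i) ∘L setProj b (σ ⁻¹' {j})) := by
  obtain ⟨hδ, hσ⟩ := hσ
  let pr : ∀ i, (∀ i, X i) →L[𝕜] X i := fun i => .proj i
  obtain ⟨C, hC0, hC⟩ := exists_norm_map_proj_apply_le (Y := X i) (Z := X j) b hδ
  refine isCompactOperator_of_tendsto_tail_comp (E i)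
    (tendsto_norm_zero_of_forall_eventually hC0 fun η hη => ?_)
  obtain ⟨N, hN⟩ := exists_forall_norm_setProj_le b (fun n => tail (E i) n ∘L pr i)
    (fun _ => ContinuousLinearMap.single 𝕜 X j)
    (fun T => by
      simpa only [ContinuousLinearMap.comp_assoc] using tendsto_norm_tail_comp (E i)
        (h.isCompactOperator (pr i ∘L T ∘L ContinuousLinearMap.single 𝕜 X j))) hη
  filter_upwards [eventually_ge_atTop N] with n hn z
  refine norm_map_setProj_apply_le b (tail (E i) n ∘L pr i) fun F hF => ?_
  refine hC F (ContinuousLinearMap.single 𝕜 X j) (pr j) (fun k hk => ?_) (norm_proj_le_one X j)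
    _ η hη.le (fun G z => ?_) z
  · obtain rfl : σ k = j := hF hk
    exact hσ k
  · rw [← setProj_coe]
    exact hN n hn G z

/- Through the `k`-th summand, an operator factors either as (compact) ∘ (bounded) or as
(bounded) ∘ (compact), according to the direction in which operators are small on tails. -/
theorem isCompactOperator_id_sub_proj_setProj_single (hσ : IsSubstantial b σ δ)
    (hE : ∀ i j, i ≠ j → SmallOnTails (E i) (X j) ∨ SmallOnTails (E j) (X i)) (j : ι) :
    IsCompactOperator (ContinuousLinearMap.id 𝕜 (X j) -
      (ContinuousLinearMap.proj j : (∀ i, X i) →L[𝕜] X j) ∘L setProj b (σ ⁻¹' {j}) ∘L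
        ContinuousLinearMap.single 𝕜 X j) := by
  let pr : (∀ i, X i) →L[𝕜] X j := .proj j
  let inc := ContinuousLinearMap.single 𝕜 X j
  have hsum : ContinuousLinearMap.id 𝕜 (X j) - pr ∘L setProj b (σ ⁻¹' {j}) ∘L inc =
      ∑ k ∈ Finset.univ.erase j, pr ∘L setProj b (σ ⁻¹' {k}) ∘L inc := by
    rw [sub_eq_iff_eq_add, Finset.sum_erase_add _ _ (Finset.mem_univ j)]
    ext x
    have := congrArg pr (sum_setProj_preimage b σ (inc x))
    rw [map_sum] at this
    simpa [pr, inc] using this.symm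
  have hmem : ∑ k ∈ Finset.univ.erase j, pr ∘L setProj b (σ ⁻¹' {k}) ∘L inc ∈
      compactOperator (RingHom.id 𝕜) (X j) (X j) := by
    refine Submodule.sum_mem _ fun k hk => ?_
    rcases hE j k (Finset.ne_of_mem_erase hk).symm with h | h
    · exact (isCompactOperator_setProj_comp_single hσ h).clm_comp pr
    · exact (isCompactOperator_proj_comp_setProj hσ h).comp_clm inc
  exact hsum ▸ hmem

theorem isCompactOperator_setProj_sub_setProj_single_proj (hσ : IsSubstantial b σ δ)
    (hE : ∀ i j, i ≠ j → SmallOnTails (E i) (X j) ∨ SmallOnTails (E j) (X i)) (j : ι) :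
    IsCompactOperator (setProj b (σ ⁻¹' {j}) - setProj b (σ ⁻¹' {j}) ∘L
      ContinuousLinearMap.single 𝕜 X j ∘L (ContinuousLinearMap.proj j : (∀ i, X i) →L[𝕜] X j) ∘L
        setProj b (σ ⁻¹' {j})) := by
  let Q := setProj b (σ ⁻¹' {j})
  let pr : ∀ i, (∀ i, X i) →L[𝕜] X i := fun i => .proj i
  have hsum : Q - Q ∘L .single 𝕜 X j ∘L pr j ∘L Q =
      ∑ k ∈ Finset.univ.erase j, Q ∘L .single 𝕜 X k ∘L pr k ∘L Q := by
    rw [sub_eq_iff_eq_add, Finset.sum_erase_add _ _ (Finset.mem_univ j)]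
    refine ContinuousLinearMap.ext fun x => ?_
    conv_lhs => rw [← setProj_setProj, ← Finset.univ_sum_single (setProj b (σ ⁻¹' {j}) x), map_sum]
    simp [Q, pr]
  have hmem : ∑ k ∈ Finset.univ.erase j, Q ∘L .single 𝕜 X k ∘L pr k ∘L Q ∈
      compactOperator (RingHom.id 𝕜) (∀ i, X i) (∀ i, X i) := by
    refine Submodule.sum_mem _ fun k hk => ?_
    rcases hE k j (Finset.ne_of_mem_erase hk) with h | h
    · exact (isCompactOperator_setProj_comp_single hσ h).comp_clm (pr k ∘L Q)
    · exact (isCompactOperator_proj_comp_setProj hσ h).clm_comp (Q ∘L .single 𝕜 X k)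
  exact hsum ▸ hmem

theorem nonempty_closure_span_equiv (hσ : IsSubstantial b σ δ)
    (hX : ∀ i, Nonempty ((X i × 𝕜) ≃L[𝕜] X i))
    (hE : ∀ i j, i ≠ j → SmallOnTails (E i) (X j) ∨ SmallOnTails (E j) (X i)) (j : ι) :
    Nonempty ((Submodule.span 𝕜 (b '' (σ ⁻¹' {j}))).topologicalClosure ≃L[𝕜] X j) := by
  set Z := (Submodule.span 𝕜 (b '' (σ ⁻¹' {j}))).topologicalClosure
  let Q := setProj b (σ ⁻¹' {j})
  have hZ : ∀ x, x ∈ Z ↔ Q x = x := mem_closure_span_iff_setProj_eq b _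
  let S : Z →L[𝕜] X j := .proj j ∘L Z.subtypeL
  let T : X j →L[𝕜] Z := (Q ∘L .single 𝕜 X j).codRestrict Z fun x =>
    (hZ _).2 (setProj_setProj b _ _)
  refine nonempty_equiv_of_isCompactOperator (E j) (hX j) S T
    (isCompactOperator_id_sub_proj_setProj_single hσ hE j) ?_
  have hcomp := (isCompactOperator_setProj_sub_setProj_single_proj hσ hE j).comp_clm Z.subtypeL
  have heq : ∀ z : Z, (Q - Q ∘L .single 𝕜 X j ∘L .proj j ∘L Q) z =
      (ContinuousLinearMap.id 𝕜 Z - T ∘L S) z := fun z => by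
    simp [S, T, (hZ z).1 z.2]
  have hcod := hcomp.codRestrict (V := Z) (fun z => (congrArg (· ∈ Z) (heq z)).mpr (Subtype.prop _))
    (Submodule.isClosed_topologicalClosure _)
  exact (congrArg IsCompactOperator (funext fun z => Subtype.ext (heq z).symm)).mpr hcod

end Splitting

theorem splitting_of_smallOnTails {𝕜 : Type u} [RCLike 𝕜] {ι : Type v} [Fintype ι] {X : ι → Type t}
    [∀ i, NormedAddCommGroup (X i)] [∀ i, NormedSpace 𝕜 (X i)] [∀ i, CompleteSpace (X i)]
    (E : ∀ i, SchauderBasis 𝕜 (X i)) (hX : ∀ i, Nonempty ((X i × 𝕜) ≃L[𝕜] X i))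
    (hE : ∀ i j, i ≠ j → SmallOnTails (E i) (X j) ∨ SmallOnTails (E j) (X i)) :
    SplittingForUnconditionalBases.{u, v, t, w} 𝕜 X := by
  classical
  intro β b
  obtain ⟨σ, δ, hσ⟩ := exists_isSubstantial b
  exact ⟨σ, nonempty_closure_span_equiv hσ hX hE⟩

/-! ### Block sequences and the gliding hump -/

section TailAlgebra

variable {𝕜 : Type*} [RCLike 𝕜] {X Y : Type*} [NormedAddCommGroup X] [NormedSpace 𝕜 X]
  [NormedAddCommGroup Y] [NormedSpace 𝕜 Y] {b : SchauderBasis 𝕜 X}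

theorem proj_proj (b : SchauderBasis 𝕜 X) (m n : ℕ) (x : X) :
    b.proj m (b.proj n x) = b.proj (min m n) x := by
  rw [b.proj_comp]

theorem tail_tail (b : SchauderBasis 𝕜 X) (m n : ℕ) (x : X) :
    tail b m (tail b n x) = tail b (max m n) x := by
  simp only [tail_apply, map_sub, proj_proj]
  rcases le_total m n with h | h
  · rw [min_eq_left h, max_eq_right h, sub_sub_sub_cancel_right]
  · rw [min_eq_right h, max_eq_left h, sub_self, sub_zero]

theorem tail_eq_self_of_le {m n : ℕ} (h : m ≤ n) {x : X} (hx : tail b n x = x) :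
    tail b m x = x := by
  rw [← hx, tail_tail, max_eq_right h]

theorem norm_apply_le_of_tail_eq_self (T : X →L[𝕜] Y) {p : ℕ} {x : X} (hx : tail b p x = x) :
    ‖T x‖ ≤ ‖T ∘L tail b p‖ * ‖x‖ := by
  simpa only [ContinuousLinearMap.comp_apply, hx] using (T ∘L tail b p).le_opNorm x

/-- The projections onto the initial segments of the basis and their complementary projections are
contractions. -/
structure IsBimonotone (b : SchauderBasis 𝕜 X) : Prop where
  norm_proj_apply_le : ∀ n x, ‖b.proj n x‖ ≤ ‖x‖
  norm_tail_apply_le : ∀ n x, ‖tail b n x‖ ≤ ‖x‖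

theorem IsBimonotone.antitone_norm_comp_tail (hb : IsBimonotone b) (T : X →L[𝕜] Y) :
    Antitone fun n => ‖T ∘L tail b n‖ := fun m n h =>
  ContinuousLinearMap.opNorm_le_bound _ (norm_nonneg _) fun x => by
    have htail : tail b m (tail b n x) = tail b n x := by rw [tail_tail, max_eq_right h]
    exact (norm_apply_le_of_tail_eq_self T htail).trans
      (mul_le_mul_of_nonneg_left (hb.norm_tail_apply_le n x) (norm_nonneg _))

theorem IsBimonotone.exists_tendsto_norm_comp_tail (hb : IsBimonotone b) {T : X →L[𝕜] Y}
    (hT : ¬ Tendsto (fun n => ‖T ∘L tail b n‖) atTop (𝓝 0)) :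
    ∃ L : ℝ, 0 < L ∧ (∀ n, L ≤ ‖T ∘L tail b n‖) ∧
      Tendsto (fun n => ‖T ∘L tail b n‖) atTop (𝓝 L) := by
  have hbdd : BddBelow (Set.range fun n => ‖T ∘L tail b n‖) :=
    ⟨0, Set.forall_mem_range.2 fun _ => norm_nonneg _⟩
  have hlim := tendsto_atTop_ciInf (hb.antitone_norm_comp_tail T) hbdd
  refine ⟨_, (le_ciInf fun n => norm_nonneg _).lt_of_ne fun h0 => hT ?_, ciInf_le hbdd, hlim⟩
  rwa [← h0] at hlim

end TailAlgebra

section BlockSeq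

variable {𝕜 : Type*} [RCLike 𝕜] {X Y : Type*} [NormedAddCommGroup X] [NormedSpace 𝕜 X]
  [NormedAddCommGroup Y] [NormedSpace 𝕜 Y]

/-- The vectors `u k` are blocks of the basis `b`: the support of `u k` lies in
`[n k, n (k + 1))`. -/
structure IsBlockSeq (b : SchauderBasis 𝕜 X) (n : ℕ → ℕ) (u : ℕ → X) : Prop where
  strictMono : StrictMono n
  tail_apply : ∀ k, tail b (n k) (u k) = u k
  tail_succ_apply : ∀ k, tail b (n (k + 1)) (u k) = 0

/-- Sums of `N` blocks of norm at most one grow at most like `N ^ α`. As the spaces of Tsirelson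
type only have such estimates asymptotically, the first `N` blocks are left out. -/
def UpperEstimate (b : SchauderBasis 𝕜 X) (α C : ℝ) : Prop :=
  ∀ n u, IsBlockSeq b n u → (∀ k, ‖u k‖ ≤ 1) →
    ∀ N : ℕ, ‖∑ k ∈ Finset.range N, u (N + k)‖ ≤ C * (N : ℝ) ^ α

/-- Sums of `N` blocks of norm at least one grow at least like `N ^ α`, with the first `N` blocks
left out as in `UpperEstimate`. -/
def LowerEstimate (b : SchauderBasis 𝕜 X) (α c : ℝ) : Prop :=
  ∀ n u, IsBlockSeq b n u → (∀ k, 1 ≤ ‖u k‖) →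
    ∀ N : ℕ, c * (N : ℝ) ^ α ≤ ‖∑ k ∈ Finset.range N, u (N + k)‖

/-- The first block plus the `N`-th normalized sum of the following ones. In a space of exponent
`α` both terms have norm about one, and the norm of the sum tells apart spaces with the same
exponent. -/
noncomputable def spread (𝕜 : Type*) [RCLike 𝕜] {X : Type*} [NormedAddCommGroup X]
    [NormedSpace 𝕜 X] (α : ℝ) (N : ℕ) (u : ℕ → X) : X :=
  u 0 + (((N : ℝ) ^ (-α) : ℝ) : 𝕜) • ∑ k ∈ Finset.range N, u (k + 1)

/-- Spreads of blocks of norm at most one eventually have norm at most `κ`. -/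
def UpperSpread (b : SchauderBasis 𝕜 X) (α κ : ℝ) : Prop :=
  ∀ n u, IsBlockSeq b n u → (∀ k, ‖u k‖ ≤ 1) → ∀ᶠ N in atTop, ‖spread 𝕜 α N u‖ ≤ κ

/-- Spreads of blocks of norm at least one eventually have norm at least `κ`. -/
def LowerSpread (b : SchauderBasis 𝕜 X) (α κ : ℝ) : Prop :=
  ∀ n u, IsBlockSeq b n u → (∀ k, 1 ≤ ‖u k‖) → ∀ᶠ N in atTop, κ ≤ ‖spread 𝕜 α N u‖

/-- The coordinate functionals span a norm dense subspace of the dual; equivalently, every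
functional is small on tails. -/
def Shrinking (b : SchauderBasis 𝕜 X) : Prop := SmallOnTails b 𝕜

theorem spread_smul (α : ℝ) (N : ℕ) (u : ℕ → X) (c : 𝕜) :
    spread 𝕜 α N (fun k => c • u k) = c • spread 𝕜 α N u := by
  simp only [spread, smul_add, Finset.smul_sum, smul_smul, mul_comm]

theorem map_spread (α : ℝ) (N : ℕ) (u : ℕ → X) (T : X →L[𝕜] Y) :
    T (spread 𝕜 α N u) = spread 𝕜 α N (fun k => T (u k)) := by
  simp only [spread, map_add, map_smul, map_sum]

theorem spread_sub (α : ℝ) (N : ℕ) (u v : ℕ → X) :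
    spread 𝕜 α N u - spread 𝕜 α N v = spread 𝕜 α N (fun k => u k - v k) := by
  simp only [spread, Finset.sum_sub_distrib, smul_sub]
  abel

theorem norm_spread_le {α : ℝ} (hα : 0 ≤ α) (N : ℕ) (u : ℕ → X) :
    ‖spread 𝕜 α N u‖ ≤ ∑ k ∈ Finset.range (N + 1), ‖u k‖ := by
  have hcoeff : ‖(((N : ℝ) ^ (-α) : ℝ) : 𝕜)‖ ≤ 1 := by
    rw [RCLike.norm_ofReal, abs_of_nonneg (by positivity)]
    rcases N.eq_zero_or_pos with rfl | hN
    · simpa using Real.zero_rpow_le_one (-α)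
    · exact Real.rpow_le_one_of_one_le_of_nonpos (by exact_mod_cast hN) (neg_nonpos.2 hα)
  rw [Finset.sum_range_succ', add_comm]
  refine (norm_add_le _ _).trans (add_le_add_right ?_ _)
  rw [norm_smul]
  exact (mul_le_of_le_one_left (norm_nonneg _) hcoeff).trans (norm_sum_le _ _)

variable {b : SchauderBasis 𝕜 X} {n : ℕ → ℕ} {u : ℕ → X}

theorem IsBlockSeq.smul (h : IsBlockSeq b n u) (c : ℕ → 𝕜) :
    IsBlockSeq b n (fun k => c k • u k) :=
  ⟨h.strictMono, fun k => by rw [map_smul, h.tail_apply],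
    fun k => by rw [map_smul, h.tail_succ_apply, smul_zero]⟩

theorem IsBlockSeq.tail_eq_self (h : IsBlockSeq b n u) {p : ℕ} (hp : p ≤ n 0) (k : ℕ) :
    tail b p (u k) = u k :=
  tail_eq_self_of_le (hp.trans (h.strictMono.monotone k.zero_le)) (h.tail_apply k)

theorem IsBlockSeq.norm_map_spread_le (h : IsBlockSeq b n u) (T : X →L[𝕜] Y) {p : ℕ}
    (hp : p ≤ n 0) (α : ℝ) (N : ℕ) :
    ‖T (spread 𝕜 α N u)‖ ≤ ‖T ∘L tail b p‖ * ‖spread 𝕜 α N u‖ :=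
  norm_apply_le_of_tail_eq_self T (by simp only [map_spread, h.tail_eq_self hp])

theorem IsBlockSeq.inv_smul (h : IsBlockSeq b n u) (τ : ℝ) :
    IsBlockSeq b n (fun k => ((τ⁻¹ : ℝ) : 𝕜) • u k) :=
  h.smul fun _ => ((τ⁻¹ : ℝ) : 𝕜)

theorem norm_ofReal_inv_smul {τ : ℝ} (hτ : 0 < τ) (x : X) :
    ‖((τ⁻¹ : ℝ) : 𝕜) • x‖ = ‖x‖ / τ := by
  rw [norm_smul, RCLike.norm_ofReal, abs_of_pos (inv_pos.2 hτ), inv_mul_eq_div]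

theorem LowerEstimate.mul_le_norm_sum {α c : ℝ} (hb : LowerEstimate b α c) (h : IsBlockSeq b n u)
    {τ : ℝ} (hτ : 0 < τ) (hu : ∀ k, τ ≤ ‖u k‖) (N : ℕ) :
    c * (N : ℝ) ^ α * τ ≤ ‖∑ k ∈ Finset.range N, u (N + k)‖ := by
  have hnorm := hb n _ (h.inv_smul τ)
    (fun k => by rw [norm_ofReal_inv_smul hτ, one_le_div hτ]; exact hu k) N
  rwa [← Finset.smul_sum, norm_ofReal_inv_smul hτ, le_div_iff₀ hτ] at hnorm

theorem LowerSpread.mul_le_norm_spread {α κ : ℝ} (hb : LowerSpread b α κ) (h : IsBlockSeq b n u)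
    {τ : ℝ} (hτ : 0 < τ) (hu : ∀ k, τ ≤ ‖u k‖) :
    ∀ᶠ N in atTop, κ * τ ≤ ‖spread 𝕜 α N u‖ := by
  filter_upwards [hb n _ (h.inv_smul τ)
    (fun k => by rw [norm_ofReal_inv_smul hτ, one_le_div hτ]; exact hu k)] with N hN
  rwa [spread_smul, norm_ofReal_inv_smul hτ, le_div_iff₀ hτ] at hN

end BlockSeq

section GlidingHump

variable {𝕜 : Type*} [RCLike 𝕜] {X Y : Type*} [NormedAddCommGroup X] [NormedSpace 𝕜 X]
  [NormedAddCommGroup Y] [NormedSpace 𝕜 Y] {E : SchauderBasis 𝕜 X} {F : SchauderBasis 𝕜 Y}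

theorem exists_seq_of_step {S A : Type*} (r : ℕ → S → S → A → Prop)
    (h : ∀ k s, ∃ s' a, r k s s' a) (s₀ : S) :
    ∃ (s : ℕ → S) (a : ℕ → A), s 0 = s₀ ∧ ∀ k, r k (s k) (s (k + 1)) (a k) := by
  choose f g hfg using h
  exact ⟨fun k => Nat.rec s₀ f k, fun k => g k (Nat.rec s₀ f k), rfl, fun k => hfg k _⟩

theorem exists_block_norm_apply_gt (hE : IsBimonotone E) (T : X →L[𝕜] Y) {τ : ℝ} (p : ℕ)
    (h : τ < ‖T ∘L tail E p‖) :
    ∃ (x : X) (p' : ℕ), p < p' ∧ ‖x‖ ≤ 1 ∧ τ < ‖T x‖ ∧ tail E p x = x ∧ tail E p' x = 0 := by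
  obtain ⟨x₀, hx₀, hTx₀⟩ := ContinuousLinearMap.exists_lt_apply_of_lt_opNorm _ h
  let x := tail E p x₀
  have hlim : Tendsto (fun n => E.proj n x) atTop (𝓝 x) := E.tendsto_proj x
  obtain ⟨p', hT, hp'⟩ := ((((T.continuous.tendsto _).comp hlim).norm.eventually_const_lt
    hTx₀).and (eventually_gt_atTop p)).exists
  have hproj : E.proj p' x = x - tail E p' x := by rw [tail_apply, sub_sub_cancel]
  refine ⟨E.proj p' x, p', hp', ?_, hT, ?_, ?_⟩
  · exact ((hE.norm_proj_apply_le _ _).trans (hE.norm_tail_apply_le _ _)).trans hx₀.le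
  · simp only [hproj, x, map_sub, tail_tail, max_self, max_eq_left hp'.le, max_eq_right hp'.le]
  · rw [tail_apply, proj_proj, min_self, sub_self]

theorem exists_blockSeq_norm_apply_gt (hE : IsBimonotone E) (T : X →L[𝕜] Y) {τ : ℝ}
    (h : ∀ n, τ < ‖T ∘L tail E n‖) (p : ℕ) :
    ∃ n u, n 0 = p ∧ IsBlockSeq E n u ∧ ∀ k, ‖u k‖ ≤ 1 ∧ τ < ‖T (u k)‖ := by
  obtain ⟨n, u, h0, hu⟩ := exists_seq_of_step
    (fun _ p p' x => p < p' ∧ ‖x‖ ≤ 1 ∧ τ < ‖T x‖ ∧ tail E p x = x ∧ tail E p' x = 0)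
    (fun _ p => exists_comm.1 (exists_block_norm_apply_gt hE T p (h p))) p
  choose hlt hle hT htail htail' using hu
  exact ⟨n, u, h0, ⟨strictMono_nat_of_lt_succ hlt, htail, htail'⟩, fun k => ⟨hle k, hT k⟩⟩

theorem exists_blockSeq_re_apply_gt (hE : IsBimonotone E) (f : StrongDual 𝕜 X) {τ : ℝ}
    (h : ∀ n, τ < ‖f ∘L tail E n‖) (p : ℕ) :
    ∃ n u, n 0 = p ∧ IsBlockSeq E n u ∧ ∀ k, ‖u k‖ ≤ 1 ∧ τ < RCLike.re (f (u k)) := by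
  obtain ⟨n, u, h0, hu, hk⟩ := exists_blockSeq_norm_apply_gt hE f h p
  choose c hc hcu using fun k => RCLike.exists_norm_eq_mul_self (f (u k))
  refine ⟨n, fun k => c k • u k, h0, hu.smul c, fun k => ⟨?_, ?_⟩⟩
  · rw [norm_smul, hc, one_mul]
    exact (hk k).1
  · rw [map_smul, smul_eq_mul, ← hcu, RCLike.ofReal_re]
    exact (hk k).2

theorem Shrinking.tendsto_norm_proj_comp_tail (hE : Shrinking E) (F : SchauderBasis 𝕜 Y) (q : ℕ)
    (T : X →L[𝕜] Y) : Tendsto (fun n => ‖(F.proj q ∘L T) ∘L tail E n‖) atTop (𝓝 0) := by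
  refine squeeze_zero (fun n => norm_nonneg _) (fun n => ?_)
    (by simpa only [zero_mul, Finset.sum_const_zero] using
      tendsto_finsetSum (Finset.range q) fun i _ => (hE (F.coord i ∘L T)).mul_const ‖F i‖)
  refine ContinuousLinearMap.opNorm_le_bound _ (by positivity) fun x => ?_
  simp only [ContinuousLinearMap.comp_apply, F.proj_apply, Finset.sum_mul]
  refine norm_sum_le_of_le _ fun i _ => ?_
  rw [norm_smul, mul_right_comm]
  exact mul_le_mul_of_nonneg_right (((F.coord i ∘L T) ∘L tail E n).le_opNorm x) (norm_nonneg _)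

theorem exists_block_pair (hE : IsBimonotone E) (hE' : Shrinking E) (F : SchauderBasis 𝕜 Y)
    (T : X →L[𝕜] Y) {τ : ℝ} (h : ∀ n, τ < ‖T ∘L tail E n‖) {η : ℝ} (hη : 0 < η) (p q : ℕ) :
    ∃ (x : X) (y : Y) (p' q' : ℕ), p < p' ∧ q < q' ∧ ‖x‖ ≤ 1 ∧ τ < ‖T x‖ ∧ ‖T x - y‖ ≤ η ∧
      tail E p x = x ∧ tail E p' x = 0 ∧ tail F q y = y ∧ tail F q' y = 0 := by
  obtain ⟨p₁, hhead, hp₁⟩ := (((hE'.tendsto_norm_proj_comp_tail F q T).eventually_lt_const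
    (half_pos hη)).and (eventually_ge_atTop p)).exists
  obtain ⟨x, p', hp', hx, hTx, hx₁, hx₂⟩ := exists_block_norm_apply_gt hE T p₁ (h p₁)
  obtain ⟨q', htail, hq'⟩ := (((tendsto_tail_apply F (T x)).norm.eventually_lt_const
    (by rw [norm_zero]; exact half_pos hη : ‖(0 : Y)‖ < η / 2)).and
      (eventually_gt_atTop q)).exists
  have hproj : ‖F.proj q (T x)‖ ≤ η / 2 :=
    (norm_apply_le_of_tail_eq_self (F.proj q ∘L T) hx₁).trans
      ((mul_le_of_le_one_right (norm_nonneg _) hx).trans hhead.le)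
  have hsub : T x - (tail F q (T x) - tail F q' (T x)) =
      F.proj q (T x) + tail F q' (T x) := by
    rw [tail_apply F q]
    abel
  refine ⟨x, tail F q (T x) - tail F q' (T x), p', q', hp₁.trans_lt hp', hq', hx, hTx, ?_,
    tail_eq_self_of_le hp₁ hx₁, hx₂, ?_, ?_⟩
  · rw [hsub]
    exact (norm_add_le _ _).trans ((add_le_add hproj htail.le).trans_eq (add_halves η))
  · simp only [map_sub, tail_tail, max_self, max_eq_right hq'.le]
  · simp only [map_sub, tail_tail, max_self, max_eq_left hq'.le, sub_self]

/- Gliding hump: the supports of the vectors `u k` are moved so far to the right that their images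
nearly vanish on the coordinates already used. -/
theorem exists_blockSeq_pair (hE : IsBimonotone E) (hE' : Shrinking E) (F : SchauderBasis 𝕜 Y)
    (T : X →L[𝕜] Y) {τ ε : ℝ} (hε : 0 < ε) (h : ∀ n, τ + ε < ‖T ∘L tail E n‖) (p : ℕ) :
    ∃ n u m v, n 0 = p ∧ IsBlockSeq E n u ∧ IsBlockSeq F m v ∧ (∀ k, ‖u k‖ ≤ 1) ∧
      (∀ k, τ ≤ ‖v k‖) ∧ ∀ s : Finset ℕ, ∑ k ∈ s, ‖T (u k) - v k‖ ≤ 2 * ε := by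
  obtain ⟨s, a, h0, hs⟩ := exists_seq_of_step
    (fun (k : ℕ) (s s' : ℕ × ℕ) (a : X × Y) => s.1 < s'.1 ∧ s.2 < s'.2 ∧ ‖a.1‖ ≤ 1 ∧
      τ + ε < ‖T a.1‖ ∧ ‖T a.1 - a.2‖ ≤ ε * (1 / 2) ^ k ∧ tail E s.1 a.1 = a.1 ∧
        tail E s'.1 a.1 = 0 ∧ tail F s.2 a.2 = a.2 ∧ tail F s'.2 a.2 = 0)
    (fun k ⟨p, q⟩ => by
      obtain ⟨x, y, p', q', hxy⟩ :=
        exists_block_pair hE hE' F T h (by positivity : 0 < ε * (1 / 2) ^ k) p q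
      exact ⟨(p', q'), (x, y), hxy⟩) (p, 0)
  choose hp hq hu hT hv hu₁ hu₂ hv₁ hv₂ using hs
  refine ⟨fun k => (s k).1, fun k => (a k).1, fun k => (s k).2, fun k => (a k).2,
    congrArg Prod.fst h0, ⟨strictMono_nat_of_lt_succ hp, hu₁, hu₂⟩,
    ⟨strictMono_nat_of_lt_succ hq, hv₁, hv₂⟩, hu, fun k => ?_, fun t => ?_⟩
  · have hk := norm_sub_norm_le (T (a k).1) (a k).2
    have hε' : ε * (1 / 2) ^ k ≤ ε :=
      mul_le_of_le_one_right hε.le (pow_le_one₀ (by norm_num) (by norm_num))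
    linarith [hT k, hv k]
  · calc ∑ k ∈ t, ‖T (a k).1 - (a k).2‖ ≤ ∑ k ∈ t, ε * (1 / 2) ^ k :=
          Finset.sum_le_sum fun k _ => hv k
      _ = ε * ∑ k ∈ t, (1 / 2 : ℝ) ^ k := (Finset.mul_sum ..).symm
      _ ≤ ε * 2 := mul_le_mul_of_nonneg_left
          ((summable_geometric_two.sum_le_tsum t fun _ _ => by positivity).trans_eq
            tsum_geometric_two) hε.le
      _ = 2 * ε := mul_comm _ _

end GlidingHump

section Criteria

variable {𝕜 : Type*} [RCLike 𝕜] {X Y : Type*} [NormedAddCommGroup X] [NormedSpace 𝕜 X]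
  [NormedAddCommGroup Y] [NormedSpace 𝕜 Y] {E : SchauderBasis 𝕜 X} {F : SchauderBasis 𝕜 Y}

theorem exists_mul_rpow_add_lt_mul_rpow {α α' c : ℝ} (hα' : 0 < α') (hα : α < α') (hc : 0 < c)
    (C D : ℝ) : ∃ N : ℕ, C * (N : ℝ) ^ α + D < c * (N : ℝ) ^ α' := by
  have hzero : ∀ β : ℝ, 0 < β → Tendsto (fun N : ℕ => (N : ℝ) ^ (-β)) atTop (𝓝 0) := fun β hβ =>
    (tendsto_rpow_neg_atTop hβ).comp tendsto_natCast_atTop_atTop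
  have hlim : Tendsto (fun N : ℕ => C * (N : ℝ) ^ (-(α' - α)) + D * (N : ℝ) ^ (-α')) atTop
      (𝓝 0) := by
    simpa using ((hzero _ (sub_pos.2 hα)).const_mul C).add ((hzero _ hα').const_mul D)
  obtain ⟨N, hN, hpos⟩ := ((hlim.eventually_lt_const hc).and (eventually_gt_atTop 0)).exists
  have hN₀ : (0 : ℝ) < N := Nat.cast_pos.2 hpos
  refine ⟨N, ?_⟩
  calc C * (N : ℝ) ^ α + D
      = (C * (N : ℝ) ^ (-(α' - α)) + D * (N : ℝ) ^ (-α')) * (N : ℝ) ^ α' := by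
        rw [add_mul, mul_assoc, mul_assoc, ← Real.rpow_add hN₀, ← Real.rpow_add hN₀]
        simp
    _ < c * (N : ℝ) ^ α' := mul_lt_mul_of_pos_right hN (Real.rpow_pos_of_pos hN₀ _)

theorem shrinking_of_upperEstimate (hE : IsBimonotone E) {α C : ℝ} (hα : α < 1)
    (h : UpperEstimate E α C) : Shrinking E := by
  intro f
  by_contra hf
  obtain ⟨L, hL, hLle, -⟩ := hE.exists_tendsto_norm_comp_tail hf
  obtain ⟨n, u, -, hu, hk⟩ := exists_blockSeq_re_apply_gt hE f
    (fun n => (half_lt_self hL).trans_le (hLle n)) 0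
  obtain ⟨N, hN⟩ := exists_mul_rpow_add_lt_mul_rpow one_pos hα (half_pos hL) (‖f‖ * C) 0
  refine hN.not_ge ?_
  calc L / 2 * (N : ℝ) ^ (1 : ℝ) = ∑ k ∈ Finset.range N, L / 2 := by simp [mul_comm]
    _ ≤ ∑ k ∈ Finset.range N, RCLike.re (f (u (N + k))) :=
        Finset.sum_le_sum fun k _ => (hk _).2.le
    _ = RCLike.re (f (∑ k ∈ Finset.range N, u (N + k))) := by rw [map_sum, map_sum]
    _ ≤ ‖f (∑ k ∈ Finset.range N, u (N + k))‖ := RCLike.re_le_norm _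
    _ ≤ ‖f‖ * (C * (N : ℝ) ^ α) := f.le_opNorm_of_le (h n u hu (fun k => (hk k).1) N)
    _ = ‖f‖ * C * (N : ℝ) ^ α + 0 := by ring

theorem exists_pos_add_mul_lt {L κ κ' : ℝ} (hL : 0 < L) (hκ : κ < κ') :
    ∃ ε > 0, 2 * ε < L ∧ (L + ε) * κ + 2 * ε < (L - 2 * ε) * κ' := by
  have hsmall : ∀ᶠ ε : ℝ in 𝓝 0, 2 * ε < L :=
    ContinuousAt.eventually_lt (by fun_prop) (by fun_prop) (by simpa using hL)
  have hlt : ∀ᶠ ε : ℝ in 𝓝 0, (L + ε) * κ + 2 * ε < (L - 2 * ε) * κ' :=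
    ContinuousAt.eventually_lt (by fun_prop) (by fun_prop)
      (by simpa using mul_lt_mul_of_pos_left hκ hL)
  obtain ⟨ε, hε, hε'⟩ :=
    (((hsmall.and hlt).filter_mono nhdsWithin_le_nhds).and
      (self_mem_nhdsWithin (s := Set.Ioi 0))).exists
  exact ⟨ε, hε', hε⟩

theorem two_mul_le_re_spread {t : ℕ → 𝕜} {τ : ℝ} (ht : ∀ k, τ ≤ RCLike.re (t k)) {N : ℕ}
    (hN : 0 < N) : 2 * τ ≤ RCLike.re (spread 𝕜 1 N t) := by
  have hsum : N * τ ≤ ∑ k ∈ Finset.range N, RCLike.re (t (k + 1)) := by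
    simpa using Finset.card_nsmul_le_sum (Finset.range N) _ τ fun k _ => ht (k + 1)
  rw [spread, map_add, smul_eq_mul, RCLike.re_ofReal_mul, map_sum, Real.rpow_neg_one,
    inv_mul_eq_div, two_mul]
  exact add_le_add (ht 0) ((le_div_iff₀' (Nat.cast_pos.2 hN)).2 hsum)

theorem shrinking_of_upperSpread (hE : IsBimonotone E) {κ : ℝ} (hκ : κ < 2)
    (h : UpperSpread E 1 κ) : Shrinking E := by
  intro f
  by_contra hf
  obtain ⟨L, hL, hLle, hlim⟩ := hE.exists_tendsto_norm_comp_tail hf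
  obtain ⟨ε, hε, -, hεκ⟩ := exists_pos_add_mul_lt hL hκ
  obtain ⟨p, hp⟩ := (hlim.eventually_lt_const (lt_add_of_pos_right L hε)).exists
  obtain ⟨n, u, hn, hu, hk⟩ := exists_blockSeq_re_apply_gt hE f
    (τ := L - 2 * ε) (fun n => (sub_lt_self L (by positivity)).trans_le (hLle n)) p
  obtain ⟨N, hN, hpos⟩ := ((h n u hu fun k => (hk k).1).and (eventually_gt_atTop 0)).exists
  have hupper : ‖f (spread 𝕜 1 N u)‖ ≤ (L + ε) * κ :=
    (hu.norm_map_spread_le f hn.ge 1 N).trans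
      (mul_le_mul hp.le hN (norm_nonneg _) (by positivity))
  have hlower : 2 * (L - 2 * ε) ≤ ‖f (spread 𝕜 1 N u)‖ := by
    rw [map_spread]
    exact (two_mul_le_re_spread (fun k => (hk k).2.le) hpos).trans (RCLike.re_le_norm _)
  linarith

theorem smallOnTails_of_estimates (hE : IsBimonotone E) (hE' : Shrinking E) {α α' C c : ℝ}
    (hα' : 0 < α') (hα : α < α') (hc : 0 < c) (h : UpperEstimate E α C)
    (h' : LowerEstimate F α' c) : SmallOnTails E Y := by
  intro T
  by_contra hT
  obtain ⟨L, hL, hLle, -⟩ := hE.exists_tendsto_norm_comp_tail hT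
  obtain ⟨n, u, m, v, -, hu, hv, hu₁, hvL, hTu⟩ := exists_blockSeq_pair hE hE' F T
    (τ := L / 4) (ε := L / 4) (by positivity) (fun n => by linarith [hLle n]) 0
  obtain ⟨N, hN⟩ := exists_mul_rpow_add_lt_mul_rpow hα' hα (by positivity : 0 < c * (L / 4))
    (‖T‖ * C) (2 * (L / 4))
  refine hN.not_ge ?_
  have herror : ‖∑ k ∈ Finset.range N, (T (u (N + k)) - v (N + k))‖ ≤ 2 * (L / 4) := by
    refine (norm_sum_le _ _).trans ?_
    simpa only [Finset.sum_map, addLeftEmbedding_apply] using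
      hTu ((Finset.range N).map (addLeftEmbedding N))
  calc c * (L / 4) * (N : ℝ) ^ α' = c * (N : ℝ) ^ α' * (L / 4) := mul_right_comm _ _ _
    _ ≤ ‖∑ k ∈ Finset.range N, v (N + k)‖ := h'.mul_le_norm_sum hv (by positivity) hvL N
    _ = ‖T (∑ k ∈ Finset.range N, u (N + k)) -
          ∑ k ∈ Finset.range N, (T (u (N + k)) - v (N + k))‖ := by
        rw [map_sum, Finset.sum_sub_distrib, sub_sub_cancel]
    _ ≤ ‖T‖ * (C * (N : ℝ) ^ α) + 2 * (L / 4) :=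
        (norm_sub_le _ _).trans (add_le_add (T.le_opNorm_of_le (h n u hu hu₁ N)) herror)
    _ = ‖T‖ * C * (N : ℝ) ^ α + 2 * (L / 4) := by rw [mul_assoc]

theorem smallOnTails_of_spread (hE : IsBimonotone E) (hE' : Shrinking E) {α κ κ' : ℝ}
    (hα : 0 ≤ α) (hκ : κ < κ') (h : UpperSpread E α κ) (h' : LowerSpread F α κ') :
    SmallOnTails E Y := by
  intro T
  by_contra hT
  obtain ⟨L, hL, hLle, hlim⟩ := hE.exists_tendsto_norm_comp_tail hT
  obtain ⟨ε, hε, hεL, hεκ⟩ := exists_pos_add_mul_lt hL hκ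
  obtain ⟨p, hp⟩ := (hlim.eventually_lt_const (lt_add_of_pos_right L hε)).exists
  obtain ⟨n, u, m, v, hn, hu, hv, hu₁, hvL, hTu⟩ := exists_blockSeq_pair hE hE' F T
    (τ := L - 2 * ε) hε (fun n => by linarith [hLle n]) p
  obtain ⟨N, hN, hN'⟩ :=
    ((h n u hu hu₁).and (h'.mul_le_norm_spread hv (sub_pos.2 hεL) hvL)).exists
  have hupper : ‖T (spread 𝕜 α N u)‖ ≤ (L + ε) * κ :=
    (hu.norm_map_spread_le T hn.ge α N).trans
      (mul_le_mul hp.le hN (norm_nonneg _) (by positivity))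
  have herror : ‖T (spread 𝕜 α N u) - spread 𝕜 α N v‖ ≤ 2 * ε := by
    rw [map_spread, spread_sub]
    exact (norm_spread_le hα N _).trans (hTu _)
  linarith [norm_sub_norm_le (spread 𝕜 α N v) (T (spread 𝕜 α N u)),
    norm_sub_rev (T (spread 𝕜 α N u)) (spread 𝕜 α N v)]

end Criteria

/-! ### Tsirelson norms of averages of blocks -/

section TsirelsonNorm

theorem tsirelsonAux_le_tsirelsonNorm (m : ℕ) (a : ℕ → ℝ≥0∞) :
    tsirelsonAux m a ≤ tsirelsonNorm a :=
  le_iSup (fun m => tsirelsonAux m a) m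

theorem half_sum_tsirelsonAux_le {k : ℕ} {E : Fin k → Finset ℕ} (hE : Admissible E) (m : ℕ)
    (a : ℕ → ℝ≥0∞) :
    2⁻¹ * ∑ j, tsirelsonAux m ((E j : Set ℕ).indicator a) ≤ tsirelsonAux (m + 1) a :=
  le_max_of_le_right (le_iSup_of_le k (le_iSup₂ (f := fun (E : Fin k → Finset ℕ)
    (_ : Admissible E) => 2⁻¹ * ∑ j, tsirelsonAux m ((E j : Set ℕ).indicator a)) E hE))

theorem half_sum_tsirelsonNorm_le {k : ℕ} {E : Fin k → Finset ℕ} (hE : Admissible E)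
    (a : ℕ → ℝ≥0∞) :
    2⁻¹ * ∑ j, tsirelsonNorm ((E j : Set ℕ).indicator a) ≤ tsirelsonNorm a := by
  have hmono : ∀ a : ℕ → ℝ≥0∞, Monotone fun m => tsirelsonAux m a := fun a =>
    monotone_nat_of_le_succ fun _ => le_max_left _ _
  simp only [tsirelsonNorm]
  rw [ENNReal.finsetSum_iSup_of_monotone fun j => hmono _, ENNReal.mul_iSup]
  exact iSup_le fun m =>
    (half_sum_tsirelsonAux_le hE m a).trans (tsirelsonAux_le_tsirelsonNorm _ a)

theorem tsirelsonNorm_le {a : ℕ → ℝ≥0∞} {C : ℝ≥0∞} (hsup : ∀ i, a i ≤ C)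
    (hsum : ∀ (k : ℕ) (E : Fin k → Finset ℕ), Admissible E →
      2⁻¹ * ∑ j, tsirelsonNorm ((E j : Set ℕ).indicator a) ≤ C) : tsirelsonNorm a ≤ C := by
  refine iSup_le fun m => ?_
  induction m with
  | zero => exact iSup_le hsup
  | succ m ih =>
    refine max_le ih (iSup_le fun k => iSup₂_le fun E hE => le_trans ?_ (hsum k E hE))
    gcongr
    exact tsirelsonAux_le_tsirelsonNorm m _

theorem tsirelsonNorm_zero : tsirelsonNorm 0 = 0 := by
  have h := tsirelsonNorm_mul 0 0
  simp only [Pi.zero_apply, zero_mul] at h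
  exact h

theorem tsirelsonNorm_sum {κ : Type*} (s : Finset κ) (a : κ → ℕ → ℝ≥0∞) :
    tsirelsonNorm (∑ l ∈ s, a l) ≤ ∑ l ∈ s, tsirelsonNorm (a l) :=
  Finset.le_sum_of_subadditive _ tsirelsonNorm_zero.le tsirelsonNorm_add s a

theorem tsirelsonNorm_indicator_le (s : Set ℕ) (a : ℕ → ℝ≥0∞) :
    tsirelsonNorm (s.indicator a) ≤ tsirelsonNorm a :=
  tsirelsonNorm_mono (Set.indicator_le_self s a)

theorem Admissible.eq_of_mem {k : ℕ} {E : Fin k → Finset ℕ} (hE : Admissible E) {i : ℕ}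
    {j l : Fin k} (hj : i ∈ E j) (hl : i ∈ E l) : j = l := by
  by_contra hne
  rcases lt_or_gt_of_ne hne with h | h
  · exact lt_irrefl _ (hE.2 j l h i hj i hl)
  · exact lt_irrefl _ (hE.2 l j h i hl i hj)

theorem Admissible.sum_indicator_le {k : ℕ} {E : Fin k → Finset ℕ} (hE : Admissible E)
    (a : ℕ → ℝ≥0∞) (i : ℕ) : ∑ j, (E j : Set ℕ).indicator a i ≤ a i := by
  by_cases h : ∃ j, i ∈ E j
  · obtain ⟨j, hj⟩ := h
    rw [Finset.sum_eq_single_of_mem j (Finset.mem_univ j) fun l _ hl =>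
      Set.indicator_of_notMem (fun hil => hl (hE.eq_of_mem hil hj)) _]
    exact Set.indicator_le_self _ _ _
  · rw [Finset.sum_eq_zero fun j _ => Set.indicator_of_notMem (fun hj => h ⟨j, hj⟩) _]
    exact zero_le

theorem tsirelsonAux_le_max (m : ℕ) (a : ℕ → ℝ≥0∞) :
    tsirelsonAux m a ≤ max (⨆ i, a i) (2⁻¹ * ∑' i, a i) := by
  induction m generalizing a with
  | zero => exact le_max_left _ _
  | succ m ih =>
    refine max_le (ih a) (le_max_of_le_right (iSup_le fun k => iSup₂_le fun E hE => ?_))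
    gcongr
    calc ∑ j, tsirelsonAux m ((E j : Set ℕ).indicator a)
        ≤ ∑ j, ∑' i, (E j : Set ℕ).indicator a i :=
          Finset.sum_le_sum fun j _ => (ih _).trans
            (max_le (iSup_le fun i => ENNReal.le_tsum i) (mul_le_of_le_one_left zero_le (by simp)))
      _ = ∑' i, ∑ j, (E j : Set ℕ).indicator a i :=
          (Summable.tsum_finsetSum fun _ _ => ENNReal.summable).symm
      _ ≤ ∑' i, a i := ENNReal.tsum_le_tsum (hE.sum_indicator_le a)

theorem tsirelsonNorm_le_max (a : ℕ → ℝ≥0∞) :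
    tsirelsonNorm a ≤ max (⨆ i, a i) (2⁻¹ * ∑' i, a i) :=
  iSup_le fun m => tsirelsonAux_le_max m a

theorem half_sum_le_tsirelsonNorm (E : Finset ℕ) {l : ℕ} (hc : E.card ≤ l)
    (hl : ∀ i ∈ E, l ≤ i + 1) (a : ℕ → ℝ≥0∞) : 2⁻¹ * ∑ i ∈ E, a i ≤ tsirelsonNorm a := by
  let e := E.orderEmbOfFin rfl
  have hadm : Admissible fun j : Fin E.card => ({e j} : Finset ℕ) := by
    refine ⟨fun j i hi => ?_, fun j l hjl i hi i' hi' => ?_⟩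
    · rw [Finset.mem_singleton.1 hi]
      exact hc.trans (hl _ (E.orderEmbOfFin_mem rfl j))
    · rw [Finset.mem_singleton.1 hi, Finset.mem_singleton.1 hi']
      exact e.strictMono hjl
  have hsum : ∑ i ∈ E, a i = ∑ j, a (e j) := by
    conv_lhs => rw [← E.image_orderEmbOfFin_univ rfl]
    rw [Finset.sum_image fun x _ y _ h => e.injective h]
  refine le_trans ?_ (half_sum_tsirelsonNorm_le hadm a)
  rw [hsum]
  gcongr with j
  simpa using le_tsirelsonNorm ((({e j} : Finset ℕ) : Set ℕ).indicator a) (e j)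

theorem lowerSemicontinuous_tsirelsonAux (m : ℕ) : LowerSemicontinuous (tsirelsonAux m) := by
  induction m with
  | zero => exact lowerSemicontinuous_iSup fun i => (continuous_apply i).lowerSemicontinuous
  | succ m ih =>
    refine LowerSemicontinuous.sup ih (lowerSemicontinuous_iSup fun k =>
      lowerSemicontinuous_iSup fun E => lowerSemicontinuous_iSup fun _ => ?_)
    have hmono : Monotone fun x : ℝ≥0∞ => 2⁻¹ * x := fun x y h => mul_le_mul_right h _
    refine (ENNReal.continuous_const_mul (by simp)).comp_lowerSemicontinuous
      (lowerSemicontinuous_sum fun j _ => ih.comp (continuous_pi fun i => ?_)) hmono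
    by_cases h : i ∈ (E j : Set ℕ)
    · simpa only [Set.indicator_of_mem h] using continuous_apply i
    · simpa only [Set.indicator_of_notMem h] using continuous_const

theorem tsirelsonNorm_le_of_tendsto {a : ℕ → ℕ → ℝ≥0∞} {b : ℕ → ℝ≥0∞}
    (h : ∀ i, Tendsto (fun n => a n i) atTop (𝓝 (b i))) {C : ℝ≥0∞}
    (hC : ∀ᶠ n in atTop, tsirelsonNorm (a n) ≤ C) : tsirelsonNorm b ≤ C :=
  ((lowerSemicontinuous_iSup lowerSemicontinuous_tsirelsonAux).isClosed_preimage C).mem_of_tendsto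
    (tendsto_pi_nhds.2 h) hC

end TsirelsonNorm

section TsirelsonSpread

variable {n : ℕ → ℕ} {w : ℕ → ℕ → ℝ≥0∞}

/-- The vector `a` does not vanish on at least two of the sets `E j`. -/
def MeetsTwo {k : ℕ} (E : Fin k → Finset ℕ) (a : ℕ → ℝ≥0∞) : Prop :=
  ∃ j j', j < j' ∧ (∃ i ∈ E j, a i ≠ 0) ∧ ∃ i ∈ E j', a i ≠ 0

/- Each block that meets two of the sets is charged to the first set it meets, and no set is charged
twice. -/
theorem card_le_of_forall_meetsTwo (hn : StrictMono n)
    (hw : ∀ k i, w k i ≠ 0 → n k ≤ i ∧ i < n (k + 1)) {k : ℕ} {E : Fin k → Finset ℕ}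
    (hE : Admissible E) {s : Finset ℕ} (hs : ∀ l ∈ s, MeetsTwo E (w l)) : s.card ≤ k := by
  rcases s.eq_empty_or_nonempty with rfl | ⟨l₀, hl₀⟩
  · simp
  have : Nonempty (Fin k) := ⟨(hs l₀ hl₀).choose⟩
  choose! f g hfg hf hg using hs
  have hne : ∀ l ∈ s, ∀ l' ∈ s, l < l' → f l ≠ f l' := by
    intro l hl l' hl' hll hff
    obtain ⟨i, hi, hwi⟩ := hg l hl
    obtain ⟨i', hi', hwi'⟩ := hf l' hl'
    have hlt : i' < i := hE.2 (f l) (g l) (hfg l hl) i' (hff ▸ hi') i hi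
    exact hlt.not_ge (((hw _ _ hwi).2.le.trans (hn.monotone (Nat.succ_le_of_lt hll))).trans
      (hw _ _ hwi').1)
  have hinj : Set.InjOn f s := fun l hl l' hl' h => by
    by_contra hll
    rcases lt_or_gt_of_ne hll with h' | h'
    · exact hne l hl l' hl' h' h
    · exact hne l' hl' l hl h' h.symm
  simpa using Finset.card_le_card_of_injOn f (fun _ _ => Finset.mem_coe.2 (Finset.mem_univ _)) hinj

theorem sum_tsirelsonNorm_indicator_le_of_not_meetsTwo {k : ℕ} {E : Fin k → Finset ℕ}
    {a : ℕ → ℝ≥0∞} (ha : ¬ MeetsTwo E a) :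
    ∑ j, tsirelsonNorm ((E j : Set ℕ).indicator a) ≤ tsirelsonNorm a := by
  have hzero : ∀ j, (¬ ∃ i ∈ E j, a i ≠ 0) → tsirelsonNorm ((E j : Set ℕ).indicator a) = 0 := by
    intro j hj
    push Not at hj
    rw [Set.indicator_eq_zero'.2 (Set.disjoint_left.2 fun i hi hiE => hi (hj i hiE)),
      tsirelsonNorm_zero]
  by_cases hex : ∃ j, ∃ i ∈ E j, a i ≠ 0
  · obtain ⟨j, hj⟩ := hex
    rw [Finset.sum_eq_single_of_mem j (Finset.mem_univ j) fun j' _ hne => hzero j' fun hj' => ha ?_]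
    · exact tsirelsonNorm_indicator_le _ _
    · rcases lt_or_gt_of_ne hne with h | h
      · exact ⟨j', j, h, hj', hj⟩
      · exact ⟨j, j', h, hj, hj'⟩
  · rw [Finset.sum_eq_zero fun j _ => hzero j fun h => hex ⟨j, h⟩]
    exact zero_le

theorem sum_half_sum_tsirelsonNorm_indicator_le (hn : StrictMono n)
    (hw : ∀ k i, w k i ≠ 0 → n k ≤ i ∧ i < n (k + 1)) (hw₁ : ∀ k, tsirelsonNorm (w k) ≤ 1)
    {k : ℕ} {E : Fin k → Finset ℕ} (hE : Admissible E) (s : Finset ℕ) (hk : 2 * k ≤ s.card) :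
    ∑ l ∈ s, 2⁻¹ * ∑ j, tsirelsonNorm ((E j : Set ℕ).indicator (w l)) ≤ 3 / 4 * s.card := by
  classical
  let bad := s.filter fun l => MeetsTwo E (w l)
  have hbad : bad.card ≤ k :=
    card_le_of_forall_meetsTwo hn hw hE fun l hl => (Finset.mem_filter.1 hl).2
  have hterm : ∀ l ∈ s, 2⁻¹ * ∑ j, tsirelsonNorm ((E j : Set ℕ).indicator (w l)) ≤
      2⁻¹ + if MeetsTwo E (w l) then 2⁻¹ else 0 := fun l _ => by
    split_ifs with hl
    · rw [ENNReal.inv_two_add_inv_two]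
      exact (half_sum_tsirelsonNorm_le hE _).trans (hw₁ l)
    · rw [add_zero]
      exact mul_le_of_le_one_right zero_le
        ((sum_tsirelsonNorm_indicator_le_of_not_meetsTwo hl).trans (hw₁ l))
  have hhalf : (bad.card : ℝ≥0∞) ≤ 2⁻¹ * s.card := by
    rw [← ENNReal.div_eq_inv_mul, ENNReal.le_div_iff_mul_le (by simp) (by simp)]
    exact_mod_cast (by omega : bad.card * 2 ≤ s.card)
  have hconst : (2⁻¹ + 2⁻¹ * 2⁻¹ : ℝ≥0∞) = 3 / 4 := by
    rw [← ENNReal.toReal_eq_toReal_iff' (by finiteness) (by finiteness),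
      ENNReal.toReal_add (by finiteness) (by finiteness)]
    norm_num
  calc ∑ l ∈ s, 2⁻¹ * ∑ j, tsirelsonNorm ((E j : Set ℕ).indicator (w l))
      ≤ ∑ l ∈ s, (2⁻¹ + if MeetsTwo E (w l) then 2⁻¹ else 0) := Finset.sum_le_sum hterm
    _ = 2⁻¹ * s.card + 2⁻¹ * bad.card := by
        rw [Finset.sum_add_distrib, ← Finset.sum_filter, Finset.sum_const, Finset.sum_const,
          nsmul_eq_mul, nsmul_eq_mul, mul_comm, mul_comm (bad.card : ℝ≥0∞)]
    _ ≤ 2⁻¹ * s.card + 2⁻¹ * (2⁻¹ * s.card) := by gcongr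
    _ = 3 / 4 * s.card := by rw [← mul_assoc, ← add_mul, hconst]

theorem tsirelsonNorm_average_le (hw₁ : ∀ k, tsirelsonNorm (w k) ≤ 1) (s : Finset ℕ) :
    tsirelsonNorm (fun i => (s.card : ℝ≥0∞)⁻¹ * (∑ k ∈ s, w k) i) ≤ 1 := by
  rw [tsirelsonNorm_mul]
  have hsum : tsirelsonNorm (∑ k ∈ s, w k) ≤ s.card :=
    (tsirelsonNorm_sum s w).trans (by simpa using Finset.sum_le_sum fun k (_ : k ∈ s) => hw₁ k)
  exact (mul_le_mul_right hsum _).trans (ENNReal.inv_mul_le_one _)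

theorem half_sum_tsirelsonNorm_add_average_le (hn : StrictMono n)
    (hw : ∀ k i, w k i ≠ 0 → n k ≤ i ∧ i < n (k + 1)) (hw₁ : ∀ k, tsirelsonNorm (w k) ≤ 1)
    {k : ℕ} {E : Fin k → Finset ℕ} (hE : Admissible E) {s : Finset ℕ} (hs : s.Nonempty)
    (hk : 2 * k ≤ s.card) {a : ℕ → ℝ≥0∞} (ha : tsirelsonNorm a ≤ 1) :
    2⁻¹ * ∑ j, tsirelsonNorm
      ((E j : Set ℕ).indicator (a + fun i => (s.card : ℝ≥0∞)⁻¹ * (∑ k ∈ s, w k) i)) ≤ 7 / 4 := by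
  have hsub : ∀ j, tsirelsonNorm
      ((E j : Set ℕ).indicator (a + fun i => (s.card : ℝ≥0∞)⁻¹ * (∑ k ∈ s, w k) i)) ≤
        tsirelsonNorm ((E j : Set ℕ).indicator a) +
          (s.card : ℝ≥0∞)⁻¹ * ∑ l ∈ s, tsirelsonNorm ((E j : Set ℕ).indicator (w l)) := fun j => by
    have hmul : (E j : Set ℕ).indicator (fun i => (s.card : ℝ≥0∞)⁻¹ * (∑ k ∈ s, w k) i) =
        fun i => (s.card : ℝ≥0∞)⁻¹ * (∑ k ∈ s, (E j : Set ℕ).indicator (w k)) i := by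
      ext i
      rw [← Finset.indicator_sum, Set.indicator_const_mul]
    rw [Set.indicator_add', hmul]
    refine (tsirelsonNorm_add _ _).trans (add_le_add_right ?_ _)
    rw [tsirelsonNorm_mul]
    gcongr
    exact tsirelsonNorm_sum _ _
  have hconst : (1 + 3 / 4 : ℝ≥0∞) = 7 / 4 := by
    rw [← ENNReal.toReal_eq_toReal_iff' (by finiteness) (by finiteness),
      ENNReal.toReal_add (by finiteness) (by finiteness)]
    norm_num
  have hcard : (s.card : ℝ≥0∞) ≠ 0 := by simpa using hs.ne_empty
  calc _ ≤ 2⁻¹ * ∑ j, (tsirelsonNorm ((E j : Set ℕ).indicator a) + (s.card : ℝ≥0∞)⁻¹ *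
          ∑ l ∈ s, tsirelsonNorm ((E j : Set ℕ).indicator (w l))) := by
        gcongr with j
        exact hsub j
    _ = 2⁻¹ * ∑ j, tsirelsonNorm ((E j : Set ℕ).indicator a) + (s.card : ℝ≥0∞)⁻¹ *
          ∑ l ∈ s, 2⁻¹ * ∑ j, tsirelsonNorm ((E j : Set ℕ).indicator (w l)) := by
        rw [Finset.sum_add_distrib, mul_add, ← Finset.mul_sum, ← Finset.mul_sum,
          Finset.sum_comm, mul_left_comm]
    _ ≤ 1 + (s.card : ℝ≥0∞)⁻¹ * (3 / 4 * s.card) := by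
        gcongr
        · exact (half_sum_tsirelsonNorm_le hE a).trans ha
        · exact sum_half_sum_tsirelsonNorm_indicator_le hn hw hw₁ hE s hk
    _ = 7 / 4 := by
        rw [mul_left_comm, ENNReal.inv_mul_cancel hcard (ENNReal.natCast_ne_top _), mul_one, hconst]

/- An admissible family of more than `n 1` sets misses the first block, and a smaller family
splits at most half of the remaining blocks. -/
theorem tsirelsonNorm_add_average_le (hn : StrictMono n)
    (hw : ∀ k i, w k i ≠ 0 → n k ≤ i ∧ i < n (k + 1)) (hw₁ : ∀ k, tsirelsonNorm (w k) ≤ 1)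
    {s : Finset ℕ} (hs : s.Nonempty) (hs₀ : 0 ∉ s) (hcard : 2 * n 1 ≤ s.card) :
    tsirelsonNorm (w 0 + fun i => (s.card : ℝ≥0∞)⁻¹ * (∑ k ∈ s, w k) i) ≤ 7 / 4 := by
  set y : ℕ → ℝ≥0∞ := fun i => (s.card : ℝ≥0∞)⁻¹ * (∑ k ∈ s, w k) i with hy
  have hy₁ : tsirelsonNorm y ≤ 7 / 4 := by
    refine (tsirelsonNorm_average_le hw₁ s).trans ?_
    rw [ENNReal.le_div_iff_mul_le (by simp) (by simp)]
    norm_num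
  have hw₀ : ∀ i, n 1 ≤ i → (w 0 + y) i = y i := fun i hi => by
    have : w 0 i = 0 := by_contra fun h => (hw 0 i h).2.not_ge hi
    rw [Pi.add_apply, this, zero_add]
  have hyz : ∀ i < n 1, (w 0 + y) i = w 0 i := fun i hi => by
    have hzero : ∑ k ∈ s, w k i = 0 := Finset.sum_eq_zero fun k hk => by_contra fun h =>
      hi.not_ge ((hn.monotone (Nat.one_le_iff_ne_zero.2 fun h0 => hs₀ (h0 ▸ hk))).trans
        (hw k i h).1)
    simp only [Pi.add_apply, hy, Finset.sum_apply, hzero, mul_zero, add_zero]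
  refine tsirelsonNorm_le (fun i => ?_) fun k E hE => ?_
  · rcases lt_or_ge i (n 1) with hi | hi
    · rw [hyz i hi]
      refine ((le_tsirelsonNorm _ i).trans (hw₁ 0)).trans ?_
      rw [ENNReal.le_div_iff_mul_le (by simp) (by simp)]
      norm_num
    · rw [hw₀ i hi]
      exact (le_tsirelsonNorm _ i).trans hy₁
  · rcases lt_or_ge (n 1) k with hk | hk
    · have heq : ∀ j, (E j : Set ℕ).indicator (w 0 + y) = (E j : Set ℕ).indicator y := fun j =>
        Set.indicator_congr fun i hi =>
          hw₀ i (Nat.le_of_lt_succ (hk.trans_le (hE.1 j i hi)))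
      simp only [heq]
      exact (half_sum_tsirelsonNorm_le hE y).trans hy₁
    · exact half_sum_tsirelsonNorm_add_average_le hn hw hw₁ hE hs (by omega) (hw₁ 0)

end TsirelsonSpread

/-! ### Shifts of the Tsirelson norm -/

section TsirelsonShift

theorem tsirelsonAux_leftShift_le (m : ℕ) (a : ℕ → ℝ≥0∞) :
    tsirelsonAux m (fun i => a (i + 1)) ≤ tsirelsonAux m a := by
  induction m generalizing a with
  | zero => exact iSup_le fun i => le_iSup a (i + 1)
  | succ m ih =>
    refine max_le ((ih a).trans (le_max_left _ _)) (iSup_le fun k => iSup₂_le fun E hE => ?_)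
    have hE' : Admissible fun j => (E j).map (addRightEmbedding 1) := by
      refine ⟨fun j i hi => ?_, fun j l hjl i hi i' hi' => ?_⟩
      · obtain ⟨x, hx, rfl⟩ := Finset.mem_map.1 hi
        exact (hE.1 j x hx).trans (Nat.le_succ _)
      · obtain ⟨x, hx, rfl⟩ := Finset.mem_map.1 hi
        obtain ⟨x', hx', rfl⟩ := Finset.mem_map.1 hi'
        exact Nat.succ_lt_succ (hE.2 j l hjl x hx x' hx')
    refine le_trans ?_ (half_sum_tsirelsonAux_le hE' m a)
    gcongr with j
    refine le_trans (le_of_eq ?_) (ih _)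
    congr 1
    ext i
    by_cases hi : i ∈ E j <;> simp [hi]

theorem tsirelsonNorm_leftShift_le (a : ℕ → ℝ≥0∞) :
    tsirelsonNorm (fun i => a (i + 1)) ≤ tsirelsonNorm a :=
  iSup_mono fun m => tsirelsonAux_leftShift_le m a

/-- The sequence `0, a 0, a 1, …`. -/
def rightShift {M : Type*} [Zero M] (a : ℕ → M) : ℕ → M
  | 0 => 0
  | i + 1 => a i

theorem tsum_rightShift (a : ℕ → ℝ≥0∞) : ∑' i, rightShift a i = ∑' i, a i := by
  rw [tsum_eq_zero_add' ENNReal.summable]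
  exact zero_add _

theorem iSup_rightShift_le (a : ℕ → ℝ≥0∞) : ⨆ i, rightShift a i ≤ ⨆ i, a i := by
  refine iSup_le fun i => ?_
  cases i with
  | zero => exact zero_le
  | succ i => exact le_iSup a i

theorem rightShift_add (a b : ℕ → ℝ≥0∞) : rightShift (a + b) = rightShift a + rightShift b := by
  ext i
  cases i <;> simp [rightShift]

/-- The translate `E - 1`, without the point that would become negative: restricting a right shift
to `E` means restricting the sequence to `shiftSet E`. -/
noncomputable def shiftSet (E : Finset ℕ) : Finset ℕ :=
  E.preimage (· + 1) (add_left_injective 1).injOn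

theorem mem_shiftSet {E : Finset ℕ} {i : ℕ} : i ∈ shiftSet E ↔ i + 1 ∈ E :=
  Finset.mem_preimage

theorem indicator_rightShift (E : Finset ℕ) (a : ℕ → ℝ≥0∞) :
    (E : Set ℕ).indicator (rightShift a) = rightShift ((shiftSet E : Set ℕ).indicator a) := by
  ext i
  cases i <;> simp [rightShift, Set.indicator_apply, mem_shiftSet]

theorem tsirelsonNorm_rightShift_indicator_le (E : Finset ℕ) {l : ℕ} (hc : E.card ≤ l)
    (hl : ∀ i ∈ E, l ≤ i + 1) (a : ℕ → ℝ≥0∞) :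
    tsirelsonNorm (rightShift ((E : Set ℕ).indicator a)) ≤
      tsirelsonNorm ((E : Set ℕ).indicator a) := by
  refine (tsirelsonNorm_le_max _).trans (max_le ?_ ?_)
  · exact (iSup_rightShift_le _).trans (iSup_le fun i => le_tsirelsonNorm _ i)
  · rw [tsum_rightShift, tsum_eq_sum fun i hi => Set.indicator_of_notMem (s := (E : Set ℕ)) hi a]
    exact half_sum_le_tsirelsonNorm E hc hl _

theorem half_sum_tsirelsonNorm_le_of_support {k : ℕ} {F : Fin k → Finset ℕ}
    (hF : ∀ j j', j < j' → ∀ i ∈ F j, ∀ i' ∈ F j', i < i') {a : ℕ → ℝ≥0∞}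
    (ha : ∀ j, ∀ i ∈ F j, a i ≠ 0 → k ≤ i + 1) :
    2⁻¹ * ∑ j, tsirelsonNorm ((F j : Set ℕ).indicator a) ≤ tsirelsonNorm a := by
  have hadm : Admissible fun j => (F j).filter fun i => k ≤ i + 1 :=
    ⟨fun _ _ hi => (Finset.mem_filter.1 hi).2, fun j j' hjj i hi i' hi' =>
      hF j j' hjj i (Finset.mem_filter.1 hi).1 i' (Finset.mem_filter.1 hi').1⟩
  have hindicator : ∀ j, (F j : Set ℕ).indicator a =
      ((((F j).filter fun i => k ≤ i + 1 : Finset ℕ) : Set ℕ)).indicator a := fun j => by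
    ext i
    by_cases hi : i ∈ F j ∧ a i ≠ 0
    · simp [hi.1, ha j i hi.1 hi.2]
    · by_cases hij : i ∈ F j
      · simp [Set.indicator_apply, hij, not_not.1 fun h => hi ⟨hij, h⟩]
      · simp [hij]
  simp only [hindicator]
  exact half_sum_tsirelsonNorm_le hadm a

theorem exists_forall_ne_card_le_or_two_mul_le {l : ℕ} {F : Fin (l + 1) → Finset ℕ}
    (hF : ∀ j j', j < j' → ∀ i ∈ F j, ∀ i' ∈ F j', i < i') (hl : ∀ j, ∀ i ∈ F j, l ≤ i + 1) :
    ∃ j₀, ∀ j, j ≠ j₀ → (F j).card ≤ l ∨ ∀ i ∈ F j, 2 * l ≤ i + 1 := by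
  by_cases hex : ∃ j, l < (F j).card
  · obtain ⟨j₀, hj₀, hfirst⟩ := WellFounded.has_min (wellFounded_lt (α := Fin (l + 1)))
      {j | l < (F j).card} hex
    refine ⟨j₀, fun j hj => or_iff_not_imp_left.2 fun hc i hi => ?_⟩
    have hlt : j₀ < j := lt_of_le_of_ne (not_lt.1 (hfirst j (not_le.1 hc))) hj.symm
    obtain ⟨i₀, hi₀, hi₀l⟩ : ∃ i ∈ F j₀, 2 * l ≤ i + 1 := by
      by_contra! hcon
      have hsub : F j₀ ⊆ Finset.Ico (l - 1) (2 * l - 1) := fun i hi => by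
        have h₁ := hl j₀ i hi
        have h₂ := hcon i hi
        rw [Finset.mem_Ico]
        omega
      have hcard := Finset.card_le_card hsub
      rw [Nat.card_Ico] at hcard
      have hj₀' : l < (F j₀).card := hj₀
      omega
    have := hF j₀ j hlt i₀ hi₀ i hi
    omega
  · push Not at hex
    exact ⟨0, fun j _ => Or.inl (hex j)⟩

theorem sum_le_of_forall_half_sum_succAbove_le {l : ℕ} (hl : l ≠ 0) {t : Fin (l + 1) → ℝ≥0∞}
    {τ : ℝ≥0∞} (hτ : τ ≠ ∞) (ht : ∀ j, t j ≤ τ)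
    (hdrop : ∀ j : Fin (l + 1), 2⁻¹ * ∑ i, t (j.succAbove i) ≤ τ) :
    ∑ j, t j ≤ (2 + 2 * (l : ℝ≥0∞)⁻¹) * τ := by
  set M := ∑ j, t j with hM
  have hMtop : M ≠ ∞ := ENNReal.sum_ne_top.2 fun j _ => ne_top_of_le_ne_top hτ (ht j)
  have hMj : ∀ j, M ≤ t j + 2 * τ := fun j => by
    rw [hM, Fin.sum_univ_succAbove _ j]
    gcongr
    exact (ENNReal.inv_mul_le_iff two_ne_zero ENNReal.ofNat_ne_top).1 (hdrop j)
  have hsum : l * M + M ≤ (l + 1) * (2 * τ) + M := by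
    calc l * M + M = ∑ _j : Fin (l + 1), M := by
          simp [add_mul]
      _ ≤ ∑ j, (t j + 2 * τ) := Finset.sum_le_sum fun j _ => hMj j
      _ = (l + 1) * (2 * τ) + M := by
          rw [Finset.sum_add_distrib, ← hM, add_comm]
          simp
  have hl₀ : (l : ℝ≥0∞) ≠ 0 := Nat.cast_ne_zero.2 hl
  have hltop : (l : ℝ≥0∞) ≠ ∞ := ENNReal.natCast_ne_top l
  calc M = (l : ℝ≥0∞)⁻¹ * (l * M) := (ENNReal.inv_mul_cancel_left hl₀ hltop).symm
    _ ≤ (l : ℝ≥0∞)⁻¹ * ((l + 1) * (2 * τ)) :=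
        mul_le_mul_right ((ENNReal.add_le_add_iff_right hMtop).1 hsum) _
    _ = ((l : ℝ≥0∞)⁻¹ * l + (l : ℝ≥0∞)⁻¹) * (2 * τ) := by ring
    _ = (2 + 2 * (l : ℝ≥0∞)⁻¹) * τ := by
        rw [ENNReal.inv_mul_cancel hl₀ hltop]
        ring

theorem half_sum_le_of_forall_half_sum_succAbove_le {l : ℕ} (hl : 4 ≤ l)
    {s t : Fin (l + 1) → ℝ≥0∞} {τ : ℝ≥0∞} (hτ : τ ≠ ∞) (ht : ∀ j, t j ≤ τ)
    (hdrop : ∀ j : Fin (l + 1), 2⁻¹ * ∑ i, t (j.succAbove i) ≤ τ) {j₀ : Fin (l + 1)}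
    (hs : ∀ j, j ≠ j₀ → s j ≤ (1 + 4 * (l : ℝ≥0∞)⁻¹) * t j)
    (hs₀ : s j₀ ≤ (1 + 8 * (l : ℝ≥0∞)⁻¹) * t j₀) :
    2⁻¹ * ∑ j, s j ≤ (1 + 8 * (l : ℝ≥0∞)⁻¹) * τ := by
  have hx : 8 * (l : ℝ≥0∞)⁻¹ ≤ 2 := by
    rw [← div_eq_mul_inv, ENNReal.div_le_iff (by simp; omega) (by simp)]
    exact_mod_cast (by omega : 8 ≤ 2 * l)
  set x : ℝ≥0∞ := (l : ℝ≥0∞)⁻¹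
  have hterm : ∀ j, s j ≤ (1 + 4 * x) * t j + if j = j₀ then 4 * x * τ else 0 := fun j => by
    split_ifs with hj
    · subst hj
      calc s j ≤ (1 + 8 * x) * t j := hs₀
        _ = (1 + 4 * x) * t j + 4 * x * t j := by ring
        _ ≤ (1 + 4 * x) * t j + 4 * x * τ := by gcongr; exact ht j
    · rw [add_zero]
      exact hs j hj
  rw [ENNReal.inv_mul_le_iff two_ne_zero ENNReal.ofNat_ne_top]
  calc ∑ j, s j ≤ ∑ j, ((1 + 4 * x) * t j + if j = j₀ then 4 * x * τ else 0) :=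
        Finset.sum_le_sum fun j _ => hterm j
    _ = (1 + 4 * x) * ∑ j, t j + 4 * x * τ := by
        rw [Finset.sum_add_distrib, ← Finset.mul_sum, Finset.sum_ite_eq' Finset.univ j₀,
          if_pos (Finset.mem_univ _)]
    _ ≤ (1 + 4 * x) * ((2 + 2 * x) * τ) + 4 * x * τ := by
        gcongr
        exact sum_le_of_forall_half_sum_succAbove_le (by omega) hτ ht hdrop
    _ = (2 + 14 * x + 8 * x * x) * τ := by ring
    _ ≤ (2 + 14 * x + 2 * x) * τ := by gcongr
    _ = 2 * ((1 + 8 * x) * τ) := by ring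

/- At most one of the sets is neither small enough for the shift to be harmless nor so far to the
right that the constant of the previous level improves to `1 + 4 / l`. Dropping any one set leaves
an admissible family, which controls the sum of the norms. -/
theorem half_sum_tsirelsonAux_rightShift_le {m l : ℕ} (hl : 4 ≤ l)
    (ih : ∀ n : ℕ, 4 ≤ n → ∀ a : ℕ → ℝ≥0∞, (∀ i, a i ≠ 0 → n ≤ i + 1) →
      tsirelsonAux m (rightShift a) ≤ (1 + 8 * (n : ℝ≥0∞)⁻¹) * tsirelsonNorm a)
    {F : Fin (l + 1) → Finset ℕ} (hF : ∀ j j', j < j' → ∀ i ∈ F j, ∀ i' ∈ F j', i < i')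
    (hFl : ∀ j, ∀ i ∈ F j, l ≤ i + 1) (a : ℕ → ℝ≥0∞) :
    2⁻¹ * ∑ j, tsirelsonAux m (rightShift ((F j : Set ℕ).indicator a)) ≤
      (1 + 8 * (l : ℝ≥0∞)⁻¹) * tsirelsonNorm a := by
  by_cases hτ : tsirelsonNorm a = ∞
  · rw [hτ, ENNReal.mul_top (by simp)]
    exact le_top
  have hsupport : ∀ {n : ℕ} {j}, (∀ i ∈ F j, n ≤ i + 1) →
      ∀ i, (F j : Set ℕ).indicator a i ≠ 0 → n ≤ i + 1 := fun h i hi =>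
    h i (Set.mem_of_indicator_ne_zero hi)
  obtain ⟨j₀, hj₀⟩ := exists_forall_ne_card_le_or_two_mul_le hF hFl
  refine half_sum_le_of_forall_half_sum_succAbove_le hl hτ
    (fun j => tsirelsonNorm_indicator_le (F j) a) (fun j => ?_) (j₀ := j₀) (fun j hj => ?_)
    (ih l hl _ (hsupport (hFl j₀)))
  · exact half_sum_tsirelsonNorm_le_of_support (F := fun i => F (j.succAbove i))
      (fun i i' hii => hF _ _ (Fin.succAbove_lt_succAbove_iff.2 hii)) fun i x hx _ => hFl _ x hx
  · rcases hj₀ j hj with hsmall | hfar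
    · exact ((tsirelsonAux_le_tsirelsonNorm _ _).trans
        (tsirelsonNorm_rightShift_indicator_le _ hsmall (hFl j) a)).trans
          (le_mul_of_one_le_left zero_le le_self_add)
    · refine (ih (2 * l) (by omega) _ (hsupport hfar)).trans_eq ?_
      have hinv : 8 * ((2 * l : ℕ) : ℝ≥0∞)⁻¹ = 4 * (l : ℝ≥0∞)⁻¹ := by
        rw [Nat.cast_mul, ENNReal.mul_inv (by simp) (by simp), ← mul_assoc, Nat.cast_ofNat,
          show (8 : ℝ≥0∞) = 4 * 2 by norm_num, mul_assoc 4,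
          ENNReal.mul_inv_cancel two_ne_zero ENNReal.ofNat_ne_top, mul_one]
      rw [hinv]

theorem tsirelsonAux_rightShift_le (m : ℕ) {n : ℕ} (hn : 4 ≤ n) {a : ℕ → ℝ≥0∞}
    (ha : ∀ i, a i ≠ 0 → n ≤ i + 1) :
    tsirelsonAux m (rightShift a) ≤ (1 + 8 * (n : ℝ≥0∞)⁻¹) * tsirelsonNorm a := by
  induction m generalizing n a with
  | zero =>
    exact ((iSup_rightShift_le a).trans (iSup_le fun i => le_tsirelsonNorm a i)).trans
      (le_mul_of_one_le_left zero_le le_self_add)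
  | succ m ih =>
    refine max_le (ih hn ha) (iSup_le fun k => iSup₂_le fun E hE => ?_)
    have hord : ∀ j j', j < j' → ∀ i ∈ shiftSet (E j), ∀ i' ∈ shiftSet (E j'), i < i' :=
      fun j j' hjj i hi i' hi' => Nat.lt_of_succ_lt_succ
        (hE.2 j j' hjj _ (mem_shiftSet.1 hi) _ (mem_shiftSet.1 hi'))
    simp only [indicator_rightShift]
    rcases le_or_gt k n with hk | hk
    · calc _ ≤ 2⁻¹ * ∑ j, (1 + 8 * (n : ℝ≥0∞)⁻¹) *
            tsirelsonNorm ((shiftSet (E j) : Set ℕ).indicator a) := by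
            gcongr with j
            exact ih hn fun i hi => ha i fun h => hi (Set.indicator_apply_eq_zero.2 fun _ => h)
        _ = (1 + 8 * (n : ℝ≥0∞)⁻¹) * (2⁻¹ * ∑ j,
            tsirelsonNorm ((shiftSet (E j) : Set ℕ).indicator a)) := by
            rw [← Finset.mul_sum, mul_left_comm]
        _ ≤ _ := by
            gcongr
            exact half_sum_tsirelsonNorm_le_of_support hord fun _ i _ hi => hk.trans (ha i hi)
    · obtain ⟨l, rfl⟩ : ∃ l, k = l + 1 := ⟨k - 1, by omega⟩
      have hnl : n ≤ l := by omega
      refine (half_sum_tsirelsonAux_rightShift_le (hn.trans hnl) (fun n hn a ha => ih hn ha) hord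
        (fun j i hi => ?_) a).trans (by gcongr)
      have := hE.1 j _ (mem_shiftSet.1 hi)
      omega

theorem tsirelsonNorm_rightShift_le (a : ℕ → ℝ≥0∞) :
    tsirelsonNorm (rightShift a) ≤ 6 * tsirelsonNorm a := by
  set H : Set ℕ := ↑(Finset.range 3) with hH
  have hhead : tsirelsonNorm (rightShift (H.indicator a)) ≤ 3 * tsirelsonNorm a := by
    calc tsirelsonNorm (rightShift (H.indicator a))
        ≤ ∑' i, rightShift (H.indicator a) i := (tsirelsonNorm_le_max _).trans
          (max_le (iSup_le ENNReal.le_tsum) (mul_le_of_le_one_left zero_le (by simp)))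
      _ = ∑ i ∈ Finset.range 3, H.indicator a i := by
          rw [tsum_rightShift, tsum_eq_sum fun _ hi => Set.indicator_of_notMem (s := H) hi a]
      _ ≤ ∑ _i ∈ Finset.range 3, tsirelsonNorm a := Finset.sum_le_sum fun i _ =>
          (Set.indicator_le_self _ _ _).trans (le_tsirelsonNorm a i)
      _ = 3 * tsirelsonNorm a := by simp
  have htail : tsirelsonNorm (rightShift (Hᶜ.indicator a)) ≤ 3 * tsirelsonNorm a := by
    refine iSup_le fun m => (tsirelsonAux_rightShift_le m le_rfl fun i hi => ?_).trans ?_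
    · have := Set.mem_of_indicator_ne_zero hi
      simp only [hH, Finset.coe_range, Set.mem_compl_iff, Set.mem_Iio] at this
      omega
    · have hconst : (1 + 8 * ((4 : ℕ) : ℝ≥0∞)⁻¹) = 3 := by
        rw [Nat.cast_ofNat, show (8 : ℝ≥0∞) = 2 * 4 by norm_num, mul_assoc,
          ENNReal.mul_inv_cancel (by simp) (by simp)]
        norm_num
      rw [hconst]
      gcongr
      exact tsirelsonNorm_indicator_le _ _
  calc tsirelsonNorm (rightShift a)
      = tsirelsonNorm (rightShift (H.indicator a) + rightShift (Hᶜ.indicator a)) := by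
        rw [← rightShift_add, Set.indicator_self_add_compl]
    _ ≤ 3 * tsirelsonNorm a + 3 * tsirelsonNorm a :=
        (tsirelsonNorm_add _ _).trans (add_le_add hhead htail)
    _ = 6 * tsirelsonNorm a := by ring

end TsirelsonShift

/-! ### Exponents of growth and duality -/

section BlockSums

variable {𝕜 : Type*} [RCLike 𝕜] {X : Type*} [NormedAddCommGroup X] [NormedSpace 𝕜 X]
  {b : SchauderBasis 𝕜 X} {n : ℕ → ℕ} {u : ℕ → X}

theorem tail_eq_zero_of_le {m p : ℕ} (h : m ≤ p) {x : X} (hx : tail b m x = 0) :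
    tail b p x = 0 := by
  rw [← max_eq_left h, ← tail_tail, hx, map_zero]

theorem IsBlockSeq.shift (h : IsBlockSeq b n u) (N : ℕ) :
    IsBlockSeq b (fun k => n (N + k)) (fun k => u (N + k)) :=
  ⟨fun _ _ hkl => h.strictMono (Nat.add_lt_add_left hkl N), fun k => h.tail_apply (N + k),
    fun k => h.tail_succ_apply (N + k)⟩

theorem IsBlockSeq.tail_sum (h : IsBlockSeq b n u) (N : ℕ) :
    tail b (n N) (∑ k ∈ Finset.range N, u k) = 0 := by
  rw [map_sum]
  exact Finset.sum_eq_zero fun k hk => tail_eq_zero_of_le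
    (h.strictMono.monotone (Nat.succ_le_of_lt (Finset.mem_range.1 hk))) (h.tail_succ_apply k)

theorem IsBlockSeq.tail_sub_tail_of_ne (h : IsBlockSeq b n u) {k l : ℕ} (hkl : k ≠ l) :
    tail b (n k) (u l) - tail b (n (k + 1)) (u l) = 0 := by
  rcases hkl.lt_or_gt with hlt | hlt
  · rw [tail_eq_self_of_le (h.strictMono.monotone hlt.le) (h.tail_apply l),
      tail_eq_self_of_le (h.strictMono.monotone (Nat.succ_le_of_lt hlt)) (h.tail_apply l),
      sub_self]
  · have hle := h.strictMono.monotone (Nat.succ_le_of_lt hlt)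
    rw [tail_eq_zero_of_le hle (h.tail_succ_apply l),
      tail_eq_zero_of_le (hle.trans (h.strictMono.monotone k.le_succ)) (h.tail_succ_apply l),
      sub_zero]

theorem IsBlockSeq.tail_sub_tail_sum (h : IsBlockSeq b n u) {s : Finset ℕ} {k : ℕ} (hk : k ∈ s) :
    tail b (n k) (∑ l ∈ s, u l) - tail b (n (k + 1)) (∑ l ∈ s, u l) = u k := by
  rw [map_sum, map_sum, ← Finset.sum_sub_distrib, Finset.sum_eq_single_of_mem k hk
    fun l _ hl => h.tail_sub_tail_of_ne hl.symm, h.tail_apply, h.tail_succ_apply, sub_zero]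

/-- The coefficients of the vectors `u k` in `spread 𝕜 α N u`. -/
noncomputable def spreadWeight (𝕜 : Type*) [RCLike 𝕜] (α : ℝ) (N k : ℕ) : 𝕜 :=
  if k = 0 then 1 else (((N : ℝ) ^ (-α) : ℝ) : 𝕜)

theorem spread_eq_sum (α : ℝ) (N : ℕ) (u : ℕ → X) :
    spread 𝕜 α N u = ∑ k ∈ Finset.range (N + 1), spreadWeight 𝕜 α N k • u k := by
  simp [Finset.sum_range_succ', spread, spreadWeight, Finset.smul_sum, add_comm]

theorem spreadWeight_mul {N : ℕ} (hN : 0 < N) (α β : ℝ) (k : ℕ) :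
    spreadWeight 𝕜 α N k * spreadWeight 𝕜 β N k = spreadWeight 𝕜 (α + β) N k := by
  rcases eq_or_ne k 0 with rfl | hk
  · simp only [spreadWeight, if_true, mul_one]
  · simp only [spreadWeight, hk, if_false]
    rw [← RCLike.ofReal_mul, ← Real.rpow_add (Nat.cast_pos.2 hN), neg_add]

theorem sum_norm_spreadWeight_rpow {r : ℝ} (hr : r ≠ 0) {N : ℕ} (hN : 0 < N) :
    ∑ k ∈ Finset.range (N + 1), ‖spreadWeight 𝕜 r⁻¹ N k‖ ^ r = 2 := by
  have hweight : ∀ k, ‖spreadWeight 𝕜 r⁻¹ N (k + 1)‖ ^ r = (N : ℝ)⁻¹ := fun k => by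
    rw [spreadWeight, if_neg k.succ_ne_zero, RCLike.norm_ofReal, abs_of_nonneg (by positivity),
      ← Real.rpow_mul (by positivity), neg_mul, inv_mul_cancel₀ hr, Real.rpow_neg_one]
  have hN₀ : (N : ℝ) ≠ 0 := Nat.cast_ne_zero.2 hN.ne'
  have hzero : ‖spreadWeight 𝕜 r⁻¹ N 0‖ ^ r = 1 := by simp [spreadWeight]
  rw [Finset.sum_range_succ', hzero]
  simp only [hweight, Finset.sum_const, Finset.card_range, nsmul_eq_mul, mul_inv_cancel₀ hN₀,
    one_add_one_eq_two]

end BlockSums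

section PowerEstimates

variable {𝕜 : Type*} [RCLike 𝕜] {X : Type*} [NormedAddCommGroup X] [NormedSpace 𝕜 X]

/-- The upper `r`-estimate with constant one for two successive blocks of the basis. -/
def IsRpowSubadditive (b : SchauderBasis 𝕜 X) (r : ℝ) : Prop :=
  ∀ n x y, tail b n x = 0 → tail b n y = y → ‖x + y‖ ^ r ≤ ‖x‖ ^ r + ‖y‖ ^ r

/-- The lower `r`-estimate with constant one for two successive blocks of the basis. -/
def IsRpowSuperadditive (b : SchauderBasis 𝕜 X) (r : ℝ) : Prop :=
  ∀ n x y, tail b n x = 0 → tail b n y = y → ‖x‖ ^ r + ‖y‖ ^ r ≤ ‖x + y‖ ^ r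

/-- The limit case `r = ∞` of `IsRpowSubadditive`. -/
def IsMaxSubadditive (b : SchauderBasis 𝕜 X) : Prop :=
  ∀ n x y, tail b n x = 0 → tail b n y = y → ‖x + y‖ ≤ max ‖x‖ ‖y‖

/-- The asymptotic lower `r`-estimate of the `r`-convexified Tsirelson space, with constant two:
it concerns only `N` successive blocks which are supported beyond `N`. -/
def AsymptoticLower (b : SchauderBasis 𝕜 X) (r : ℝ) : Prop :=
  ∀ n : ℕ → ℕ, StrictMono n → ∀ (N : ℕ) (x : X),
    ∑ k ∈ Finset.range N, ‖tail b (n (N + k)) x - tail b (n (N + k + 1)) x‖ ^ r ≤ 2 * ‖x‖ ^ r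

variable {b : SchauderBasis 𝕜 X} {n : ℕ → ℕ} {u : ℕ → X} {r : ℝ}

theorem IsRpowSubadditive.norm_sum_rpow_le (h : IsRpowSubadditive b r) (hr : r ≠ 0)
    (hu : IsBlockSeq b n u) (N : ℕ) :
    ‖∑ k ∈ Finset.range N, u k‖ ^ r ≤ ∑ k ∈ Finset.range N, ‖u k‖ ^ r := by
  induction N with
  | zero => simp [Real.zero_rpow hr]
  | succ N ih =>
    rw [Finset.sum_range_succ, Finset.sum_range_succ]
    exact (h (n N) _ _ (hu.tail_sum N) (hu.tail_apply N)).trans (add_le_add ih le_rfl)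

theorem IsRpowSuperadditive.le_norm_sum_rpow (h : IsRpowSuperadditive b r) (hr : r ≠ 0)
    (hu : IsBlockSeq b n u) (N : ℕ) :
    ∑ k ∈ Finset.range N, ‖u k‖ ^ r ≤ ‖∑ k ∈ Finset.range N, u k‖ ^ r := by
  induction N with
  | zero => simp [Real.zero_rpow hr]
  | succ N ih =>
    rw [Finset.sum_range_succ, Finset.sum_range_succ]
    exact (add_le_add ih le_rfl).trans (h (n N) _ _ (hu.tail_sum N) (hu.tail_apply N))

theorem IsRpowSubadditive.upperEstimate (h : IsRpowSubadditive b r) (hr : 0 < r) :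
    UpperEstimate b r⁻¹ 1 := by
  intro n u hu hu₁ N
  rw [one_mul, Real.le_rpow_inv_iff_of_pos (norm_nonneg _) N.cast_nonneg hr]
  calc ‖∑ k ∈ Finset.range N, u (N + k)‖ ^ r ≤ ∑ k ∈ Finset.range N, ‖u (N + k)‖ ^ r :=
        h.norm_sum_rpow_le hr.ne' (hu.shift N) N
    _ ≤ ∑ k ∈ Finset.range N, 1 := Finset.sum_le_sum fun k _ =>
        Real.rpow_le_one (norm_nonneg _) (hu₁ _) hr.le
    _ = N := by simp

theorem IsRpowSuperadditive.lowerEstimate (h : IsRpowSuperadditive b r) (hr : 0 < r) :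
    LowerEstimate b r⁻¹ 1 := by
  intro n u hu hu₁ N
  rw [one_mul, Real.rpow_inv_le_iff_of_pos N.cast_nonneg (norm_nonneg _) hr]
  calc (N : ℝ) = ∑ k ∈ Finset.range N, 1 := by simp
    _ ≤ ∑ k ∈ Finset.range N, ‖u (N + k)‖ ^ r := Finset.sum_le_sum fun k _ =>
        Real.one_le_rpow (hu₁ _) hr.le
    _ ≤ ‖∑ k ∈ Finset.range N, u (N + k)‖ ^ r := h.le_norm_sum_rpow hr.ne' (hu.shift N) N

theorem IsRpowSubadditive.upperSpread (h : IsRpowSubadditive b r) (hr : 0 < r) :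
    UpperSpread b r⁻¹ (2 ^ r⁻¹) := by
  intro n u hu hu₁
  filter_upwards [eventually_gt_atTop 0] with N hN
  rw [Real.le_rpow_inv_iff_of_pos (norm_nonneg _) zero_le_two hr, spread_eq_sum]
  refine (h.norm_sum_rpow_le hr.ne' (hu.smul _) _).trans
    ((Finset.sum_le_sum fun k _ => ?_).trans_eq (sum_norm_spreadWeight_rpow (𝕜 := 𝕜) hr.ne' hN))
  rw [norm_smul]
  gcongr
  exact mul_le_of_le_one_right (norm_nonneg _) (hu₁ k)

theorem IsRpowSuperadditive.lowerSpread (h : IsRpowSuperadditive b r) (hr : 0 < r) :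
    LowerSpread b r⁻¹ (2 ^ r⁻¹) := by
  intro n u hu hu₁
  filter_upwards [eventually_gt_atTop 0] with N hN
  rw [Real.rpow_inv_le_iff_of_pos zero_le_two (norm_nonneg _) hr, spread_eq_sum]
  refine (sum_norm_spreadWeight_rpow (𝕜 := 𝕜) hr.ne' hN).ge.trans
    ((Finset.sum_le_sum fun k _ => ?_).trans (h.le_norm_sum_rpow hr.ne' (hu.smul _) _))
  rw [norm_smul]
  gcongr
  exact le_mul_of_one_le_right (norm_nonneg _) (hu₁ k)

theorem IsMaxSubadditive.norm_sum_le_one (h : IsMaxSubadditive b) (hu : IsBlockSeq b n u)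
    (hu₁ : ∀ k, ‖u k‖ ≤ 1) (N : ℕ) : ‖∑ k ∈ Finset.range N, u k‖ ≤ 1 := by
  induction N with
  | zero => simp
  | succ N ih =>
    rw [Finset.sum_range_succ]
    exact (h (n N) _ _ (hu.tail_sum N) (hu.tail_apply N)).trans (max_le ih (hu₁ N))

theorem IsMaxSubadditive.upperEstimate (h : IsMaxSubadditive b) : UpperEstimate b 0 1 := by
  intro n u hu hu₁ N
  rw [Real.rpow_zero, mul_one]
  exact h.norm_sum_le_one (hu.shift N) (fun k => hu₁ _) N

theorem IsMaxSubadditive.upperSpread (h : IsMaxSubadditive b) : UpperSpread b 0 1 := by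
  intro n u hu hu₁
  refine .of_forall fun N => ?_
  have hweight : ∀ k, spreadWeight 𝕜 0 N k = 1 := fun k => by simp [spreadWeight]
  simpa only [spread_eq_sum, hweight, one_smul] using h.norm_sum_le_one hu hu₁ (N + 1)

theorem AsymptoticLower.lowerEstimate (h : AsymptoticLower b r) (hr : 0 < r) :
    LowerEstimate b r⁻¹ (2⁻¹ ^ r⁻¹) := by
  intro n u hu hu₁ N
  let x := ∑ k ∈ Finset.range N, u (N + k)
  have hsum : (N : ℝ) ≤ 2 * ‖x‖ ^ r :=
    calc (N : ℝ) = ∑ k ∈ Finset.range N, 1 := by simp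
      _ ≤ ∑ k ∈ Finset.range N, ‖u (N + k)‖ ^ r := Finset.sum_le_sum fun k _ =>
          Real.one_le_rpow (hu₁ _) hr.le
      _ = ∑ k ∈ Finset.range N, ‖tail b (n (N + k)) x - tail b (n (N + k + 1)) x‖ ^ r :=
          Finset.sum_congr rfl fun k hk => by
            rw [← (hu.shift N).tail_sub_tail_sum hk, ← add_assoc]
      _ ≤ 2 * ‖x‖ ^ r := h n hu.strictMono N x
  rw [← Real.mul_rpow (by norm_num) N.cast_nonneg,
    Real.rpow_inv_le_iff_of_pos (by positivity) (norm_nonneg _) hr]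
  exact (inv_mul_le_iff₀ zero_lt_two).2 hsum

end PowerEstimates

section Dual

variable {𝕜 : Type*} [RCLike 𝕜] {X : Type*} [NormedAddCommGroup X] [NormedSpace 𝕜 X]
  {b : SchauderBasis 𝕜 X}

theorem sum_range_coord_smul (b : SchauderBasis 𝕜 X) (f : StrongDual 𝕜 X) (n : ℕ) :
    ∑ k ∈ Finset.range n, f (b k) • b.coord k = f ∘L b.proj n := by
  ext x
  simp [b.proj_apply, mul_comm]

/-- The coordinate functionals of a shrinking basis as a basis of the dual space. -/
noncomputable def dualBasis (b : SchauderBasis 𝕜 X) (hb : Shrinking b) :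
    SchauderBasis 𝕜 (StrongDual 𝕜 X) where
  basis := b.coord
  coord k := NormedSpace.inclusionInDoubleDual 𝕜 X (b k)
  ortho i j := by
    simp [NormedSpace.dual_def, b.ortho, Pi.single_apply, eq_comm]
  expansion f := by
    rw [HasSum, SummationFilter.conditional_filter_eq_map_range, tendsto_map'_iff,
      tendsto_iff_norm_sub_tendsto_zero]
    refine (hb f).congr fun n => ?_
    have hsub : f ∘L tail b n = f - f ∘L b.proj n := by
      ext x
      simp [tail_apply]
    rw [hsub, ← sum_range_coord_smul, norm_sub_rev]
    rfl

theorem proj_dualBasis (hb : Shrinking b) (n : ℕ) (f : StrongDual 𝕜 X) :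
    (dualBasis b hb).proj n f = f ∘L b.proj n :=
  ((dualBasis b hb).proj_apply n f).trans (sum_range_coord_smul b f n)

theorem tail_dualBasis (hb : Shrinking b) (n : ℕ) (f : StrongDual 𝕜 X) :
    tail (dualBasis b hb) n f = f ∘L tail b n := by
  rw [tail_apply, proj_dualBasis]
  ext x
  simp only [sub_apply, ContinuousLinearMap.comp_apply, tail_apply, map_sub]

theorem IsBimonotone.dualBasis (h : IsBimonotone b) (hb : Shrinking b) :
    IsBimonotone (dualBasis b hb) where
  norm_proj_apply_le n f := by
    rw [proj_dualBasis]
    exact ContinuousLinearMap.opNorm_le_bound _ (norm_nonneg f) fun x =>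
      f.le_opNorm_of_le (h.norm_proj_apply_le n x)
  norm_tail_apply_le n f := by
    rw [tail_dualBasis]
    exact ContinuousLinearMap.opNorm_le_bound _ (norm_nonneg f) fun x =>
      f.le_opNorm_of_le (h.norm_tail_apply_le n x)

theorem apply_tail_sub_tail_of_dualBasis (hb : Shrinking b) {f : StrongDual 𝕜 X} {m n : ℕ}
    (hm : tail (dualBasis b hb) m f = f) (hn : tail (dualBasis b hb) n f = 0) (x : X) :
    f (tail b m x - tail b n x) = f x := by
  rw [tail_dualBasis] at hm hn
  have hmx : f (tail b m x) = f x := DFunLike.congr_fun hm x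
  have hnx : f (tail b n x) = 0 := DFunLike.congr_fun hn x
  rw [map_sub, hmx, hnx, sub_zero]

theorem exists_norming_block (h : IsBimonotone b) (hb : Shrinking b) {f : StrongDual 𝕜 X}
    {m n : ℕ} (hmn : m ≤ n) (hm : tail (dualBasis b hb) m f = f)
    (hn : tail (dualBasis b hb) n f = 0) {θ : ℝ} (hθ : θ < ‖f‖) :
    ∃ x, ‖x‖ ≤ 1 ∧ tail b m x = x ∧ tail b n x = 0 ∧ θ ≤ RCLike.re (f x) := by
  obtain ⟨x, hx, hfx⟩ := ContinuousLinearMap.exists_lt_apply_of_lt_opNorm _ hθ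
  obtain ⟨c, hc, hcx⟩ := RCLike.exists_norm_eq_mul_self (f x)
  have hproj : tail b m x - tail b n x = b.proj n (tail b m x) := by
    rw [← sub_sub_cancel (tail b m x) (b.proj n (tail b m x)), ← tail_apply, tail_tail,
      max_eq_left hmn]
  refine ⟨c • (tail b m x - tail b n x), ?_, ?_, ?_, ?_⟩
  · rw [norm_smul, hc, one_mul, hproj]
    exact ((h.norm_proj_apply_le _ _).trans (h.norm_tail_apply_le _ _)).trans hx.le
  · simp only [map_smul, map_sub, tail_tail, max_self, max_eq_right hmn]
  · simp only [map_smul, map_sub, tail_tail, max_self, max_eq_left hmn, sub_self, smul_zero]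
  · rw [map_smul, apply_tail_sub_tail_of_dualBasis hb hm hn, smul_eq_mul, ← hcx, RCLike.ofReal_re]
    exact hfx.le

theorem exists_norming_blockSeq (h : IsBimonotone b) (hb : Shrinking b)
    {f : ℕ → StrongDual 𝕜 X} {n : ℕ → ℕ} (hf : IsBlockSeq (dualBasis b hb) n f)
    (hf₁ : ∀ k, 1 ≤ ‖f k‖) {θ : ℝ} (hθ : θ < 1) :
    ∃ u : ℕ → X, IsBlockSeq b n u ∧ (∀ k, ‖u k‖ ≤ 1) ∧ (∀ k, θ ≤ RCLike.re (f k (u k))) ∧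
      ∀ k l, k ≠ l → f k (u l) = 0 := by
  choose u hu hum hun hre using fun k => exists_norming_block h hb
    (hf.strictMono.monotone k.le_succ) (hf.tail_apply k) (hf.tail_succ_apply k)
    (hθ.trans_le (hf₁ k))
  have hblock : IsBlockSeq b n u := ⟨hf.strictMono, hum, hun⟩
  refine ⟨u, hblock, hu, hre, fun k l hkl => ?_⟩
  rw [← apply_tail_sub_tail_of_dualBasis hb (hf.tail_apply k) (hf.tail_succ_apply k),
    hblock.tail_sub_tail_of_ne hkl, map_zero]

theorem sum_apply_sum_of_biorthogonal {f : ℕ → StrongDual 𝕜 X} {u : ℕ → X}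
    (h : ∀ k l, k ≠ l → f k (u l) = 0) (s : Finset ℕ) :
    (∑ k ∈ s, f k) (∑ k ∈ s, u k) = ∑ k ∈ s, f k (u k) := by
  rw [sum_apply]
  refine Finset.sum_congr rfl fun k hk => ?_
  rw [map_sum, Finset.sum_eq_single_of_mem k hk fun l _ hl => h k l hl.symm]

theorem spread_apply_spread_of_biorthogonal {f : ℕ → StrongDual 𝕜 X} {u : ℕ → X}
    (h : ∀ k l, k ≠ l → f k (u l) = 0) (α β : ℝ) {N : ℕ} (hN : 0 < N) :
    (spread 𝕜 α N f) (spread 𝕜 β N u) = spread 𝕜 (α + β) N fun k => f k (u k) := by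
  rw [spread_eq_sum, spread_eq_sum, spread_eq_sum, sum_apply_sum_of_biorthogonal fun k l hkl => by
    rw [map_smul, smul_apply, h k l hkl, smul_zero, smul_zero]]
  refine Finset.sum_congr rfl fun k _ => ?_
  rw [map_smul, smul_apply, smul_smul, mul_comm, spreadWeight_mul hN]

theorem UpperEstimate.dual_lowerEstimate {α C : ℝ} (h : UpperEstimate b α C)
    (hb₁ : IsBimonotone b) (hb : Shrinking b) (hα : α < 1) (hC : 0 < C) :
    LowerEstimate (dualBasis b hb) (1 - α) (2 * C)⁻¹ := by
  intro n f hf hf₁ N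
  rcases N.eq_zero_or_pos with rfl | hN
  · simp [Real.zero_rpow (sub_pos.2 hα).ne']
  obtain ⟨u, hu, hu₁, hre, hort⟩ := exists_norming_blockSeq hb₁ hb hf hf₁ one_half_lt_one
  have hsum : (N : ℝ) / 2 ≤ ‖∑ k ∈ Finset.range N, f (N + k)‖ * (C * (N : ℝ) ^ α) :=
    calc (N : ℝ) / 2 = ∑ _k ∈ Finset.range N, 1 / 2 := by simp [div_eq_mul_inv]
      _ ≤ ∑ k ∈ Finset.range N, RCLike.re (f (N + k) (u (N + k))) :=
          Finset.sum_le_sum fun k _ => hre _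
      _ = RCLike.re ((∑ k ∈ Finset.range N, f (N + k)) (∑ k ∈ Finset.range N, u (N + k))) := by
          rw [sum_apply_sum_of_biorthogonal fun k l hkl => hort _ _ (by simpa using hkl), map_sum]
      _ ≤ ‖(∑ k ∈ Finset.range N, f (N + k)) (∑ k ∈ Finset.range N, u (N + k))‖ :=
          RCLike.re_le_norm _
      _ ≤ ‖∑ k ∈ Finset.range N, f (N + k)‖ * (C * (N : ℝ) ^ α) :=
          ContinuousLinearMap.le_opNorm_of_le _ (h n u hu hu₁ N)
  rw [Real.rpow_sub (Nat.cast_pos.2 hN), Real.rpow_one, inv_mul_eq_div, div_div,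
    div_le_iff₀ (by positivity)]
  linarith

theorem UpperSpread.dual_lowerSpread {α κ κ' : ℝ} (h : UpperSpread b α κ) (hb₁ : IsBimonotone b)
    (hb : Shrinking b) (hκ : 0 < κ) (hκκ' : κ' * κ < 2) :
    LowerSpread (dualBasis b hb) (1 - α) κ' := by
  intro n f hf hf₁
  obtain ⟨u, hu, hu₁, hre, hort⟩ :=
    exists_norming_blockSeq hb₁ hb hf hf₁ ((div_lt_one zero_lt_two).2 hκκ')
  filter_upwards [h n u hu hu₁, eventually_gt_atTop 0] with N hle hN
  refine le_of_mul_le_mul_right ?_ hκ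
  calc κ' * κ = 2 * (κ' * κ / 2) := by ring
    _ ≤ RCLike.re (spread 𝕜 1 N fun k => f k (u k)) := two_mul_le_re_spread hre hN
    _ = RCLike.re (spread 𝕜 (1 - α) N f (spread 𝕜 α N u)) := by
        rw [spread_apply_spread_of_biorthogonal hort _ _ hN, sub_add_cancel]
    _ ≤ ‖spread 𝕜 (1 - α) N f (spread 𝕜 α N u)‖ := RCLike.re_le_norm _
    _ ≤ ‖spread 𝕜 (1 - α) N f‖ * κ := ContinuousLinearMap.le_opNorm_of_le _ hle

/- The functionals see only the differences of tails of `x`, and Hölder's inequality turns the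
`ℓ_r`-bound of the norms of these into an `ℓ_1`-bound. -/
theorem AsymptoticLower.dual_upperEstimate {r : ℝ} (h : AsymptoticLower b r) (hb : Shrinking b)
    (hr : 1 ≤ r) : UpperEstimate (dualBasis b hb) (1 - r⁻¹) (2 ^ r⁻¹) := by
  intro n f hf hf₁ N
  have hr₀ : 0 < r := zero_lt_one.trans_le hr
  refine ContinuousLinearMap.opNorm_le_bound _ (by positivity) fun x => ?_
  let y : ℕ → X := fun k => tail b (n (N + k)) x - tail b (n (N + k + 1)) x
  have happly : ∀ k, ‖f (N + k) x‖ ≤ ‖y k‖ := fun k => by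
    rw [← apply_tail_sub_tail_of_dualBasis hb (hf.tail_apply _) (hf.tail_succ_apply _)]
    exact ((f (N + k)).le_of_opNorm_le (hf₁ _) _).trans_eq (one_mul _)
  have hpow : (∑ k ∈ Finset.range N, ‖y k‖) ^ r ≤ (N : ℝ) ^ (r - 1) * (2 * ‖x‖ ^ r) := by
    have hölder := Real.rpow_sum_le_const_mul_sum_rpow (Finset.range N) (fun k => ‖y k‖) hr
    simp only [abs_norm, Finset.card_range] at hölder
    exact hölder.trans (mul_le_mul_of_nonneg_left (h n hf.strictMono N x) (by positivity))
  have hexp : (r - 1) * r⁻¹ = 1 - r⁻¹ := by rw [sub_mul, mul_inv_cancel₀ hr₀.ne', one_mul]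
  calc ‖(∑ k ∈ Finset.range N, f (N + k)) x‖ ≤ ∑ k ∈ Finset.range N, ‖f (N + k) x‖ := by
        rw [sum_apply]
        exact norm_sum_le _ _
    _ ≤ ∑ k ∈ Finset.range N, ‖y k‖ := Finset.sum_le_sum fun k _ => happly k
    _ ≤ ((N : ℝ) ^ (r - 1) * (2 * ‖x‖ ^ r)) ^ r⁻¹ :=
        (Real.le_rpow_inv_iff_of_pos (by positivity) (by positivity) hr₀).2 hpow
    _ = 2 ^ r⁻¹ * (N : ℝ) ^ (1 - r⁻¹) * ‖x‖ := by
        rw [Real.mul_rpow (by positivity) (by positivity), Real.mul_rpow zero_le_two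
          (by positivity), Real.rpow_rpow_inv (norm_nonneg _) hr₀.ne',
          ← Real.rpow_mul N.cast_nonneg, hexp]
        ring

theorem nonempty_dual_prod_equiv (h : Nonempty ((X × 𝕜) ≃L[𝕜] X)) :
    Nonempty ((StrongDual 𝕜 X × 𝕜) ≃L[𝕜] StrongDual 𝕜 X) := by
  obtain ⟨T⟩ := h
  exact ⟨((ContinuousLinearEquiv.refl 𝕜 _).prodCongr
    (ContinuousLinearMap.toSpanSingletonCLE (𝕜 := 𝕜))).trans
      ((ContinuousLinearMap.coprodEquivL 𝕜).trans
        (T.arrowCongr (ContinuousLinearEquiv.refl 𝕜 𝕜)))⟩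

end Dual

/-! ### Sequence spaces -/

section SolidSequenceSpace

variable {𝕜 : Type*} [RCLike 𝕜] {X : Type*} [NormedAddCommGroup X] [NormedSpace 𝕜 X]

/-- The space `X` is a solid sequence space, `seq x` being the sequence of coordinates of `x`: its
norm is monotone in the absolute values of the coordinates and dominates each of them, and the
finitely supported sequences belong to `X` and are dense. -/
structure IsSolidSequenceSpace (seq : X →ₗ[𝕜] (ℕ → 𝕜)) : Prop where
  norm_mono : ∀ x y, (∀ i, ‖seq x i‖ ≤ ‖seq y i‖) → ‖x‖ ≤ ‖y‖
  norm_seq_le : ∀ x i, ‖seq x i‖ ≤ ‖x‖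
  exists_seq_eq_single : ∀ k, ∃ x, seq x = Pi.single k 1
  exists_norm_sub_lt : ∀ x, ∀ ε > 0, ∃ y n, (∀ i ≥ n, seq y i = 0) ∧ ‖x - y‖ < ε

namespace IsSolidSequenceSpace

variable {seq : X →ₗ[𝕜] (ℕ → 𝕜)} (h : IsSolidSequenceSpace seq)

include h in
theorem seq_injective : Function.Injective seq :=
  (injective_iff_map_eq_zero seq).2 fun x hx =>
    norm_le_zero_iff.1 ((h.norm_mono x 0 fun i => by simp [hx]).trans norm_zero.le)

/-- The unit vectors of a solid sequence space. -/
noncomputable def vec (k : ℕ) : X := (h.exists_seq_eq_single k).choose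

theorem seq_vec (k : ℕ) : seq (h.vec k) = Pi.single k 1 := (h.exists_seq_eq_single k).choose_spec

theorem seq_sum_vec (n : ℕ) (x : X) (i : ℕ) :
    seq (∑ k ∈ Finset.range n, seq x k • h.vec k) i = if i < n then seq x i else 0 := by
  simp [h.seq_vec, Pi.single_apply]

theorem tendsto_sum_vec (x : X) :
    Tendsto (fun n => ∑ k ∈ Finset.range n, seq x k • h.vec k) atTop (𝓝 x) := by
  refine Metric.tendsto_atTop.2 fun ε hε => ?_
  obtain ⟨y, n, hy, hxy⟩ := h.exists_norm_sub_lt x ε hε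
  refine ⟨n, fun m hm => ?_⟩
  rw [dist_comm, dist_eq_norm]
  refine (h.norm_mono _ _ fun i => ?_).trans_lt hxy
  rw [map_sub, map_sub, Pi.sub_apply, Pi.sub_apply, h.seq_sum_vec]
  split_ifs with hi
  · simp
  · simp [hy i (hm.trans (not_lt.1 hi))]

/-- The unit vector basis of a solid sequence space. -/
noncomputable def basis : SchauderBasis 𝕜 X where
  basis := h.vec
  coord i := LinearMap.mkContinuous (LinearMap.proj i ∘ₗ seq) 1 fun x => by
    simpa using h.norm_seq_le x i
  ortho i j := by simp [h.seq_vec, Pi.single_apply]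
  expansion x := by
    rw [HasSum, SummationFilter.conditional_filter_eq_map_range, tendsto_map'_iff]
    exact h.tendsto_sum_vec x

theorem seq_proj (n : ℕ) (x : X) (i : ℕ) :
    seq (h.basis.proj n x) i = if i < n then seq x i else 0 := by
  rw [SchauderBasis.proj_apply]
  exact h.seq_sum_vec n x i

theorem seq_tail (n : ℕ) (x : X) (i : ℕ) :
    seq (tail h.basis n x) i = if i < n then 0 else seq x i := by
  rw [tail_apply, map_sub, Pi.sub_apply, h.seq_proj]
  split_ifs <;> simp

theorem isBimonotone_basis : IsBimonotone h.basis where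
  norm_proj_apply_le n x := h.norm_mono _ _ fun i => by
    rw [h.seq_proj]
    split_ifs <;> simp
  norm_tail_apply_le n x := h.norm_mono _ _ fun i => by
    rw [h.seq_tail]
    split_ifs <;> simp

theorem lt_of_tail_eq_zero {n : ℕ} {x : X} (hx : tail h.basis n x = 0) {i : ℕ}
    (hi : seq x i ≠ 0) : i < n := by
  by_contra hn
  have := h.seq_tail n x i
  rw [hx, map_zero, if_neg hn] at this
  exact hi this.symm

theorem le_of_tail_eq_self {n : ℕ} {x : X} (hx : tail h.basis n x = x) {i : ℕ}
    (hi : seq x i ≠ 0) : n ≤ i := by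
  by_contra! hn
  rw [← hx, h.seq_tail, if_pos hn] at hi
  exact hi rfl

theorem seq_eq_zero_or_seq_eq_zero {n : ℕ} {x y : X} (hx : tail h.basis n x = 0)
    (hy : tail h.basis n y = y) (i : ℕ) : seq x i = 0 ∨ seq y i = 0 := by
  by_contra! hxy
  exact (h.lt_of_tail_eq_zero hx hxy.1).not_ge (h.le_of_tail_eq_self hy hxy.2)

theorem mem_Ico_of_isBlockSeq {n : ℕ → ℕ} {u : ℕ → X} (hu : IsBlockSeq h.basis n u) {k i : ℕ}
    (hi : seq (u k) i ≠ 0) : i ∈ Set.Ico (n k) (n (k + 1)) :=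
  ⟨h.le_of_tail_eq_self (hu.tail_apply k) hi, h.lt_of_tail_eq_zero (hu.tail_succ_apply k) hi⟩

end IsSolidSequenceSpace

/-- The bounded operator of `X` that acts on sequences of coordinates as the linear map `S`. -/
noncomputable def liftOfSeq {seq : X →ₗ[𝕜] (ℕ → 𝕜)} (hinj : Function.Injective seq)
    (S : (ℕ → 𝕜) →ₗ[𝕜] (ℕ → 𝕜)) (C : ℝ) (hS : ∀ x, ∃ z, seq z = S (seq x) ∧ ‖z‖ ≤ C * ‖x‖) :
    X →L[𝕜] X :=
  have hchoose : ∀ x, seq (hS x).choose = S (seq x) := fun x => (hS x).choose_spec.1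
  LinearMap.mkContinuous
    { toFun x := (hS x).choose
      map_add' x y := hinj <| by rw [hchoose, map_add, map_add, map_add, hchoose, hchoose]
      map_smul' c x := hinj <| by
        rw [RingHom.id_apply, hchoose, map_smul, map_smul, map_smul, hchoose] } C
    fun x => (hS x).choose_spec.2

theorem seq_liftOfSeq {seq : X →ₗ[𝕜] (ℕ → 𝕜)} (hinj : Function.Injective seq)
    (S : (ℕ → 𝕜) →ₗ[𝕜] (ℕ → 𝕜)) (C : ℝ) (hS : ∀ x, ∃ z, seq z = S (seq x) ∧ ‖z‖ ≤ C * ‖x‖) (x : X) :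
    seq (liftOfSeq hinj S C hS x) = S (seq x) :=
  (hS x).choose_spec.1

/-- `rightShift` on scalar sequences as a linear map. -/
def rightShiftLinear (𝕜 : Type*) [RCLike 𝕜] : (ℕ → 𝕜) →ₗ[𝕜] (ℕ → 𝕜) where
  toFun := rightShift
  map_add' x y := by ext i; cases i <;> simp [rightShift]
  map_smul' c x := by ext i; cases i <;> simp [rightShift]

theorem IsSolidSequenceSpace.nonempty_prod_equiv {seq : X →ₗ[𝕜] (ℕ → 𝕜)}
    (h : IsSolidSequenceSpace seq) {C C' : ℝ}
    (hright : ∀ x, ∃ z, seq z = rightShift (seq x) ∧ ‖z‖ ≤ C * ‖x‖)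
    (hleft : ∀ x, ∃ z, (seq z = fun i => seq x (i + 1)) ∧ ‖z‖ ≤ C' * ‖x‖) :
    Nonempty ((X × 𝕜) ≃L[𝕜] X) := by
  have hinj := h.seq_injective
  let R := liftOfSeq hinj (rightShiftLinear 𝕜) C hright
  let L := liftOfSeq hinj (LinearMap.funLeft 𝕜 𝕜 (· + 1)) C' hleft
  have hR : ∀ x, seq (R x) = rightShift (seq x) := seq_liftOfSeq hinj _ C hright
  have hL : ∀ x i, seq (L x) i = seq x (i + 1) := fun x i =>
    congrFun (seq_liftOfSeq hinj _ C' hleft x) i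
  refine ⟨.equivOfInverse
    (R ∘L .fst 𝕜 X 𝕜 + (ContinuousLinearMap.toSpanSingleton 𝕜 (h.vec 0)) ∘L .snd 𝕜 X 𝕜)
    (L.prod (h.basis.coord 0)) (fun x => Prod.ext (hinj ?_) ?_) fun x => hinj ?_⟩
  · ext i
    simp [hL, hR, h.seq_vec, rightShift]
  · change seq _ 0 = _
    simp [hR, h.seq_vec, rightShift]
  · ext i
    change seq (R (L x) + seq x 0 • h.vec 0) i = _
    cases i <;> simp [hL, hR, h.seq_vec, rightShift]

end SolidSequenceSpace

section LpSequences

theorem exists_lp_norm_le_of_injOn {α β F : Type*} [NormedAddCommGroup F] {p : ℝ≥0∞} (hp : p ≠ 0)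
    (x : lp (fun _ : α => F) p) {y : β → F} {g : β → α} (hg : Set.InjOn g {i | y i ≠ 0})
    (h : ∀ i, ‖y i‖ ≤ ‖x (g i)‖) : ∃ z : lp (fun _ : β => F) p, ⇑z = y ∧ ‖z‖ ≤ ‖x‖ := by
  classical
  rcases p.trichotomy with rfl | rfl | hp₀
  · exact absurd rfl hp
  · have hle : ∀ i, ‖y i‖ ≤ ‖x‖ := fun i => (h i).trans (lp.norm_apply_le_norm hp x _)
    exact ⟨⟨y, memℓp_infty ⟨‖x‖, Set.forall_mem_range.2 hle⟩⟩, rfl,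
      lp.norm_le_of_forall_le (lp.norm_nonneg' _) hle⟩
  · have hle : ∀ s : Finset β, ∑ i ∈ s, ‖y i‖ ^ p.toReal ≤ ‖x‖ ^ p.toReal := fun s =>
      calc ∑ i ∈ s, ‖y i‖ ^ p.toReal = ∑ i ∈ s with y i ≠ 0, ‖y i‖ ^ p.toReal :=
            (Finset.sum_filter_of_ne fun i _ => mt fun hy => by simp [hy, hp₀.ne']).symm
        _ ≤ ∑ i ∈ s with y i ≠ 0, ‖x (g i)‖ ^ p.toReal :=
            Finset.sum_le_sum fun i _ => Real.rpow_le_rpow (norm_nonneg _) (h i) hp₀.le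
        _ = ∑ j ∈ Finset.image g {i ∈ s | y i ≠ 0}, ‖x j‖ ^ p.toReal :=
            (Finset.sum_image (f := fun j => ‖x j‖ ^ p.toReal)
              (hg.mono fun i hi => (Finset.mem_filter.1 hi).2)).symm
        _ ≤ ‖x‖ ^ p.toReal := lp.sum_rpow_le_norm_rpow hp₀ x _
    exact ⟨⟨y, memℓp_gen' hle⟩, rfl, lp.norm_le_of_forall_sum_le hp₀ (lp.norm_nonneg' _) hle⟩

variable {F : Type*} [NormedAddCommGroup F] {p : ℝ≥0∞}

theorem lp_sum_single_apply (x : lp (fun _ : ℕ => F) p) (n i : ℕ) :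
    (∑ k ∈ Finset.range n, lp.single p k (x k)) i = if i < n then x i else 0 := by
  rw [lp.coeFn_sum, Finset.sum_apply]
  simp [Pi.single_apply]

theorem lp_norm_add_rpow (hp : 0 < p.toReal) {x y : lp (fun _ : ℕ => F) p}
    (hxy : ∀ i, x i = 0 ∨ y i = 0) :
    ‖x + y‖ ^ p.toReal = ‖x‖ ^ p.toReal + ‖y‖ ^ p.toReal := by
  refine (lp.hasSum_norm hp (x + y)).unique ?_
  convert (lp.hasSum_norm hp x).add (lp.hasSum_norm hp y) using 1
  ext i
  rcases hxy i with h | h <;> simp [h, hp.ne']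

theorem lp_norm_add_le_max {x y : lp (fun _ : ℕ => F) ∞} (hxy : ∀ i, x i = 0 ∨ y i = 0) :
    ‖x + y‖ ≤ max ‖x‖ ‖y‖ := by
  refine lp.norm_le_of_forall_le (le_max_of_le_left (lp.norm_nonneg' _)) fun i => ?_
  rw [lp.coeFn_add, Pi.add_apply]
  rcases hxy i with h | h
  · rw [h, zero_add]
    exact le_max_of_le_right (lp.norm_apply_le_norm ENNReal.top_ne_zero y i)
  · rw [h, add_zero]
    exact le_max_of_le_left (lp.norm_apply_le_norm ENNReal.top_ne_zero x i)

variable [Fact (1 ≤ p)]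

theorem tendsto_lp_sum_single {x : lp (fun _ : ℕ => F) p} (hx : Tendsto (⇑x) atTop (𝓝 0)) :
    Tendsto (fun n => ∑ k ∈ Finset.range n, lp.single p k (x k)) atTop (𝓝 x) := by
  rcases eq_or_ne p ∞ with rfl | hp
  · refine Metric.tendsto_atTop.2 fun ε hε => ?_
    obtain ⟨n, hn⟩ := Metric.tendsto_atTop.1 hx (ε / 2) (half_pos hε)
    refine ⟨n, fun m hm => ?_⟩
    rw [dist_comm, dist_eq_norm]
    refine (lp.norm_le_of_forall_le (half_pos hε).le fun i => ?_).trans_lt (half_lt_self hε)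
    rw [lp.coeFn_sub, Pi.sub_apply, lp_sum_single_apply]
    split_ifs with hi
    · simpa using (half_pos hε).le
    · simpa using (hn i (hm.trans (not_lt.1 hi))).le
  · exact (lp.hasSum_single hp x).tendsto_sum_nat

theorem isClosed_setOf_lp_tendsto_zero :
    IsClosed {x : lp (fun _ : ℕ => F) p | Tendsto (⇑x) atTop (𝓝 0)} := by
  refine isClosed_of_closure_subset fun x hx => Metric.tendsto_atTop.2 fun ε hε => ?_
  obtain ⟨y, hy, hxy⟩ := Metric.mem_closure_iff.1 hx (ε / 2) (half_pos hε)
  obtain ⟨n, hn⟩ := Metric.tendsto_atTop.1 hy (ε / 2) (half_pos hε)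
  refine ⟨n, fun i hi => ?_⟩
  have hdist : dist (x i) (y i) ≤ dist x y := by
    simpa using (lp.lipschitzWith_one_eval (E := fun _ : ℕ => F) p i).dist_le_mul x y
  calc dist (x i) 0 ≤ dist (x i) (y i) + dist (y i) 0 := dist_triangle _ _ _
    _ < ε / 2 + ε / 2 := add_lt_add (hdist.trans_lt hxy) (hn i hi)
    _ = ε := add_halves ε

end LpSequences

namespace Ell

variable {𝕜 : Type*} [RCLike 𝕜] {p : Set.Ici (1 : ℝ≥0∞)}

variable (𝕜 p) in
/-- The sequence of coordinates of an element of `ℓ_p`. -/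
def seq : Ell 𝕜 p →ₗ[𝕜] (ℕ → 𝕜) where
  toFun x := ⇑(x : lp (fun _ : ℕ => 𝕜) (p : ℝ≥0∞))
  map_add' _ _ := rfl
  map_smul' _ _ := rfl

instance : CompleteSpace (Ell 𝕜 p) :=
  (isClosed_setOf_lp_tendsto_zero (F := 𝕜) (p := p)).completeSpace_coe

theorem tendsto_seq (x : Ell 𝕜 p) : Tendsto (seq 𝕜 p x) atTop (𝓝 0) := x.2

theorem coe_ne_zero : (p : ℝ≥0∞) ≠ 0 := (zero_lt_one.trans_le p.2).ne'

theorem exists_norm_le_of_injOn (x : Ell 𝕜 p) {y : ℕ → 𝕜} {g : ℕ → ℕ}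
    (hg : Set.InjOn g {i | y i ≠ 0}) (hg' : Tendsto g atTop atTop)
    (h : ∀ i, ‖y i‖ ≤ ‖seq 𝕜 p x (g i)‖) : ∃ z : Ell 𝕜 p, seq 𝕜 p z = y ∧ ‖z‖ ≤ ‖x‖ := by
  obtain ⟨z, rfl, hzx⟩ := exists_lp_norm_le_of_injOn coe_ne_zero
    (x : lp (fun _ : ℕ => 𝕜) (p : ℝ≥0∞)) hg h
  have hlim : Tendsto (fun i => ‖seq 𝕜 p x (g i)‖) atTop (𝓝 0) := by
    simpa using ((tendsto_seq x).comp hg').norm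
  exact ⟨⟨z, squeeze_zero_norm h hlim⟩, rfl, hzx⟩

theorem exists_rightShift (x : Ell 𝕜 p) :
    ∃ z : Ell 𝕜 p, seq 𝕜 p z = rightShift (seq 𝕜 p x) ∧ ‖z‖ ≤ ‖x‖ := by
  refine exists_norm_le_of_injOn x (g := fun i => i - 1) ?_ (tendsto_sub_atTop_nat 1) fun i => ?_
  · have hpos : ∀ i, rightShift (seq 𝕜 p x) i ≠ 0 → 0 < i := by
      rintro (_ | i) hi
      exacts [absurd rfl hi, i.succ_pos]
    exact fun i hi j hj hij => Nat.sub_one_cancel (hpos i hi) (hpos j hj) hij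
  · cases i <;> simp [rightShift]

theorem exists_leftShift (x : Ell 𝕜 p) :
    ∃ z : Ell 𝕜 p, (seq 𝕜 p z = fun i => seq 𝕜 p x (i + 1)) ∧ ‖z‖ ≤ ‖x‖ :=
  exists_norm_le_of_injOn x (add_left_injective 1).injOn (tendsto_add_atTop_nat 1) fun _ => le_rfl

theorem single_mem (k : ℕ) (c : 𝕜) : lp.single (p : ℝ≥0∞) k c ∈ ellSubmodule 𝕜 p := by
  refine tendsto_const_nhds.congr' ((eventually_gt_atTop k).mono fun i hi => ?_)
  exact (lp.single_apply_ne (E := fun _ : ℕ => 𝕜) (p : ℝ≥0∞) k c hi.ne').symm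

theorem isSolidSequenceSpace_seq : IsSolidSequenceSpace (seq 𝕜 p) where
  norm_mono _ _ h := lp.norm_mono coe_ne_zero h
  norm_seq_le x i := lp.norm_apply_le_norm coe_ne_zero (x : lp (fun _ : ℕ => 𝕜) (p : ℝ≥0∞)) i
  exists_seq_eq_single k := ⟨⟨_, single_mem k 1⟩, lp.coeFn_single (p : ℝ≥0∞) k 1⟩
  exists_norm_sub_lt x ε hε := by
    obtain ⟨n, hn⟩ := Metric.tendsto_atTop.1 (tendsto_lp_sum_single (tendsto_seq x)) ε hε
    let y : Ell 𝕜 p := ∑ k ∈ Finset.range n, ⟨_, single_mem (p := p) k (seq 𝕜 p x k)⟩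
    have hy : (y : lp (fun _ : ℕ => 𝕜) (p : ℝ≥0∞)) =
        ∑ k ∈ Finset.range n, lp.single p k (seq 𝕜 p x k) := by
      simp [y]
    refine ⟨y, n, fun i hi => ?_, ?_⟩
    · change (y : lp (fun _ : ℕ => 𝕜) (p : ℝ≥0∞)) i = 0
      rw [hy]
      exact (lp_sum_single_apply _ n i).trans (if_neg hi.not_gt)
    · rw [← dist_eq_norm, dist_comm, Subtype.dist_eq, hy]
      exact hn n le_rfl

variable (𝕜 p) in
/-- The unit vector basis of `ℓ_p`. -/
noncomputable def basis : SchauderBasis 𝕜 (Ell 𝕜 p) := isSolidSequenceSpace_seq.basis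

theorem isBimonotone_basis : IsBimonotone (basis 𝕜 p) :=
  isSolidSequenceSpace_seq.isBimonotone_basis

theorem nonempty_prod_equiv : Nonempty ((Ell 𝕜 p × 𝕜) ≃L[𝕜] Ell 𝕜 p) :=
  isSolidSequenceSpace_seq.nonempty_prod_equiv (C := 1) (C' := 1)
    (by simpa only [one_mul] using exists_rightShift)
    (by simpa only [one_mul] using exists_leftShift)

theorem toReal_pos (hp : (p : ℝ≥0∞) ≠ ∞) : 0 < (p : ℝ≥0∞).toReal :=
  ENNReal.toReal_pos coe_ne_zero hp

theorem norm_add_rpow (hp : (p : ℝ≥0∞) ≠ ∞) {n : ℕ} {x y : Ell 𝕜 p}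
    (hx : tail (basis 𝕜 p) n x = 0) (hy : tail (basis 𝕜 p) n y = y) :
    ‖x + y‖ ^ (p : ℝ≥0∞).toReal = ‖x‖ ^ (p : ℝ≥0∞).toReal + ‖y‖ ^ (p : ℝ≥0∞).toReal :=
  lp_norm_add_rpow (toReal_pos hp) (isSolidSequenceSpace_seq.seq_eq_zero_or_seq_eq_zero hx hy)

theorem isRpowSubadditive (hp : (p : ℝ≥0∞) ≠ ∞) :
    IsRpowSubadditive (basis 𝕜 p) (p : ℝ≥0∞).toReal :=
  fun _ _ _ hx hy => (norm_add_rpow hp hx hy).le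

theorem isRpowSuperadditive (hp : (p : ℝ≥0∞) ≠ ∞) :
    IsRpowSuperadditive (basis 𝕜 p) (p : ℝ≥0∞).toReal :=
  fun _ _ _ hx hy => (norm_add_rpow hp hx hy).ge

theorem isMaxSubadditive (hp : (p : ℝ≥0∞) = ∞) : IsMaxSubadditive (basis 𝕜 p) := by
  obtain ⟨p, hp₁⟩ := p
  subst hp
  exact fun n x y hx hy =>
    lp_norm_add_le_max (isSolidSequenceSpace_seq.seq_eq_zero_or_seq_eq_zero hx hy)

end Ell

section ConvexNorm

variable {𝕜 : Type*} [RCLike 𝕜] {r : ℝ}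

theorem convexNorm_rpow (hr : r ≠ 0) (a : ℕ → 𝕜) :
    convexNorm r a ^ r = tsirelsonNorm fun i => ‖a i‖ₑ ^ r :=
  ENNReal.rpow_inv_rpow hr _

theorem convexNorm_le_iff (hr : 0 < r) {a : ℕ → 𝕜} {C : ℝ≥0∞} :
    convexNorm r a ≤ C ↔ (tsirelsonNorm fun i => ‖a i‖ₑ ^ r) ≤ C ^ r :=
  ENNReal.rpow_inv_le_iff hr

theorem convexNorm_mono (hr : 0 < r) {a b : ℕ → 𝕜} (h : ∀ i, ‖a i‖ ≤ ‖b i‖) :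
    convexNorm r a ≤ convexNorm r b := by
  rw [convexNorm_le_iff hr, convexNorm_rpow hr.ne']
  exact tsirelsonNorm_mono fun i => ENNReal.rpow_le_rpow (enorm_le_iff_norm_le.2 (h i)) hr.le

theorem convexNorm_le_of_tendsto (hr : 0 < r) {a : ℕ → ℕ → 𝕜} {b : ℕ → 𝕜} {C : ℝ≥0∞}
    (h : ∀ i, Tendsto (fun n => a n i) atTop (𝓝 (b i)))
    (hC : ∀ᶠ n in atTop, convexNorm r (a n) ≤ C) : convexNorm r b ≤ C := by
  simp only [convexNorm_le_iff hr] at hC ⊢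
  exact tsirelsonNorm_le_of_tendsto (fun i => (h i).enorm.ennrpow_const r) hC

theorem convexNorm_leftShift_le (hr : 0 < r) (a : ℕ → 𝕜) :
    convexNorm r (fun i => a (i + 1)) ≤ convexNorm r a := by
  rw [convexNorm_le_iff hr, convexNorm_rpow hr.ne']
  exact tsirelsonNorm_leftShift_le fun i => ‖a i‖ₑ ^ r

theorem convexNorm_rightShift_le (hr : 0 < r) (a : ℕ → 𝕜) :
    convexNorm r (rightShift a) ≤ 6 ^ r⁻¹ * convexNorm r a := by
  have hshift : (fun i => ‖rightShift a i‖ₑ ^ r) = rightShift fun i => ‖a i‖ₑ ^ r := by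
    ext i
    cases i <;> simp [rightShift, hr]
  rw [convexNorm_le_iff hr, ENNReal.mul_rpow_of_nonneg _ _ hr.le, convexNorm_rpow hr.ne',
    ENNReal.rpow_inv_rpow hr.ne', hshift]
  exact tsirelsonNorm_rightShift_le _

theorem convexNorm_single_le (hr : 0 < r) (k : ℕ) : convexNorm r (Pi.single k 1 : ℕ → 𝕜) ≤ 1 := by
  have hterm : ∀ i ≠ k, ‖(Pi.single k 1 : ℕ → 𝕜) i‖ₑ ^ r = 0 := fun i hi => by simp [hi, hr]
  rw [convexNorm_le_iff hr, ENNReal.one_rpow]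
  refine (tsirelsonNorm_le_max _).trans
    (max_le (iSup_le ENNReal.le_tsum) (mul_le_of_le_one_left zero_le (by simp)) |>.trans ?_)
  rw [tsum_eq_single k hterm]
  simp

end ConvexNorm

theorem exponent_pos (r : Set.Ici (1 : ℝ)) : 0 < (r : ℝ) := zero_lt_one.trans_le r.2

namespace FiniteNorm

variable {𝕜 : Type*} [RCLike 𝕜] {r : Set.Ici (1 : ℝ)}

theorem toSeq_injective : Function.Injective (toSeq 𝕜 r) := Subtype.val_injective

theorem convexNorm_ne_top (x : FiniteNorm 𝕜 r) : convexNorm (r : ℝ) (toSeq 𝕜 r x) ≠ ∞ :=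
  Subtype.property x

theorem exists_toSeq_eq {a : ℕ → 𝕜} (h : convexNorm (r : ℝ) a ≠ ∞) :
    ∃ x : FiniteNorm 𝕜 r, toSeq 𝕜 r x = a := ⟨⟨a, h⟩, rfl⟩

theorem enorm_eq (x : FiniteNorm 𝕜 r) : ‖x‖ₑ = convexNorm (r : ℝ) (toSeq 𝕜 r x) := by
  rw [← ofReal_norm]
  exact ENNReal.ofReal_toReal (convexNorm_ne_top x)

theorem norm_toSeq_le (x : FiniteNorm 𝕜 r) (i : ℕ) : ‖toSeq 𝕜 r x i‖ ≤ ‖x‖ := by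
  rw [← enorm_le_iff_norm_le, enorm_eq]
  exact enorm_le_convexNorm r.2 _ _

theorem exists_tendsto_toSeq {x : ℕ → FiniteNorm 𝕜 r} (hx : CauchySeq x) (i : ℕ) :
    ∃ c, Tendsto (fun n => toSeq 𝕜 r (x n) i) atTop (𝓝 c) := by
  refine cauchySeq_tendsto_of_complete (Metric.cauchySeq_iff.2 fun ε hε => ?_)
  obtain ⟨N, hN⟩ := Metric.cauchySeq_iff.1 hx ε hε
  refine ⟨N, fun m hm n hn => lt_of_le_of_lt ?_ (hN m hm n hn)⟩
  simpa [dist_eq_norm] using norm_toSeq_le (x m - x n) i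

theorem exists_convexNorm_sub_le {x : ℕ → FiniteNorm 𝕜 r} (hx : CauchySeq x) {a : ℕ → 𝕜}
    (ha : ∀ i, Tendsto (fun n => toSeq 𝕜 r (x n) i) atTop (𝓝 (a i))) {ε : ℝ} (hε : 0 < ε) :
    ∃ N, ∀ n ≥ N, convexNorm (r : ℝ) (a - toSeq 𝕜 r (x n)) ≤ ENNReal.ofReal ε := by
  obtain ⟨N, hN⟩ := Metric.cauchySeq_iff.1 hx ε hε
  refine ⟨N, fun n hn => convexNorm_le_of_tendsto (exponent_pos r)
    (a := fun m => toSeq 𝕜 r (x m - x n)) (fun i => ?_) ?_⟩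
  · simpa using (ha i).sub_const _
  · filter_upwards [eventually_ge_atTop N] with m hm
    rw [← enorm_eq, ← ofReal_norm, ← dist_eq_norm]
    exact ENNReal.ofReal_le_ofReal (hN m hm n hn).le

instance : CompleteSpace (FiniteNorm 𝕜 r) := by
  refine Metric.complete_of_cauchySeq_tendsto fun x hx => ?_
  choose a ha using exists_tendsto_toSeq hx
  obtain ⟨N, hN⟩ := exists_convexNorm_sub_le hx ha one_pos
  have hfinite : convexNorm (r : ℝ) (a - toSeq 𝕜 r (x N) + toSeq 𝕜 r (x N)) ≠ ∞ :=
    ne_top_of_le_ne_top (ENNReal.add_ne_top.2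
      ⟨ne_top_of_le_ne_top ENNReal.ofReal_ne_top (hN N le_rfl), convexNorm_ne_top _⟩)
      (convexNorm_add r.2 _ _)
  rw [sub_add_cancel] at hfinite
  obtain ⟨y, rfl⟩ := exists_toSeq_eq hfinite
  refine ⟨y, Metric.tendsto_atTop.2 fun ε hε => ?_⟩
  obtain ⟨N, hN⟩ := exists_convexNorm_sub_le hx ha (half_pos hε)
  refine ⟨N, fun n hn => lt_of_le_of_lt ?_ (half_lt_self hε)⟩
  rw [dist_comm, dist_eq_norm, ← ENNReal.ofReal_le_ofReal_iff (half_pos hε).le, ofReal_norm,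
    enorm_eq, map_sub]
  exact hN n hn

end FiniteNorm

namespace Tsirelson

variable {𝕜 : Type*} [RCLike 𝕜] {r : Set.Ici (1 : ℝ)}

instance : CompleteSpace (Tsirelson 𝕜 r) :=
  (Submodule.isClosed_topologicalClosure _).completeSpace_coe

variable (𝕜 r) in
/-- The sequence of coordinates of an element of `T^{(r)}`. -/
noncomputable def seq : Tsirelson 𝕜 r →ₗ[𝕜] (ℕ → 𝕜) := FiniteNorm.toSeq 𝕜 r ∘ₗ Submodule.subtype _

theorem enorm_eq (x : Tsirelson 𝕜 r) : ‖x‖ₑ = convexNorm (r : ℝ) (seq 𝕜 r x) :=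
  FiniteNorm.enorm_eq (x : FiniteNorm 𝕜 r)

theorem ofReal_norm_rpow (x : Tsirelson 𝕜 r) :
    ENNReal.ofReal (‖x‖ ^ (r : ℝ)) = tsirelsonNorm fun i => ‖seq 𝕜 r x i‖ₑ ^ (r : ℝ) := by
  rw [← ENNReal.ofReal_rpow_of_nonneg (norm_nonneg _) (exponent_pos r).le, ofReal_norm, enorm_eq,
    convexNorm_rpow (exponent_pos r).ne']

theorem exists_seq_eq_apply {S : (ℕ → 𝕜) →ₗ[𝕜] (ℕ → 𝕜)} {C : ℝ} (hC : 0 ≤ C)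
    (hS : ∀ a, convexNorm (r : ℝ) (S a) ≤ ENNReal.ofReal C * convexNorm (r : ℝ) a)
    (hfin : ∀ a, (Function.support a).Finite → (Function.support (S a)).Finite)
    (x : Tsirelson 𝕜 r) : ∃ z, seq 𝕜 r z = S (seq 𝕜 r x) ∧ ‖z‖ ≤ C * ‖x‖ := by
  have hlift : ∀ x : FiniteNorm 𝕜 r,
      ∃ z, FiniteNorm.toSeq 𝕜 r z = S (FiniteNorm.toSeq 𝕜 r x) ∧ ‖z‖ ≤ C * ‖x‖ := fun x => by
    obtain ⟨z, hz⟩ := FiniteNorm.exists_toSeq_eq (ne_top_of_le_ne_top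
      (ENNReal.mul_ne_top ENNReal.ofReal_ne_top (FiniteNorm.convexNorm_ne_top x)) (hS _))
    refine ⟨z, hz, ?_⟩
    rw [← ENNReal.ofReal_le_ofReal_iff (by positivity), ENNReal.ofReal_mul hC, ofReal_norm,
      ofReal_norm, FiniteNorm.enorm_eq, FiniteNorm.enorm_eq, hz]
    exact hS _
  let G := liftOfSeq FiniteNorm.toSeq_injective S C hlift
  have hG : ∀ x, FiniteNorm.toSeq 𝕜 r (G x) = S (FiniteNorm.toSeq 𝕜 r x) :=
    seq_liftOfSeq FiniteNorm.toSeq_injective S C hlift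
  have hGfin : ∀ x ∈ finiteSupport 𝕜 r, G x ∈ finiteSupport 𝕜 r := fun x hx => by
    change (Function.support (FiniteNorm.toSeq 𝕜 r (G x))).Finite
    rw [hG]
    exact hfin _ hx
  exact ⟨⟨G x, map_mem_closure G.continuous x.2 hGfin⟩, hG x, (hlift x).choose_spec.2⟩

theorem exists_rightShift (x : Tsirelson 𝕜 r) :
    ∃ z, seq 𝕜 r z = rightShift (seq 𝕜 r x) ∧ ‖z‖ ≤ 6 ^ (r : ℝ)⁻¹ * ‖x‖ := by
  have hr := exponent_pos r
  refine exists_seq_eq_apply (S := rightShiftLinear 𝕜) (by positivity) (fun a => ?_)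
    (fun a ha => ?_) x
  · refine (convexNorm_rightShift_le hr a).trans_eq ?_
    rw [← ENNReal.ofReal_rpow_of_nonneg (by norm_num) (inv_nonneg.2 hr.le), ENNReal.ofReal_ofNat]
  · refine (ha.image (· + 1)).subset fun i hi => ?_
    cases i with
    | zero => exact absurd rfl hi
    | succ i => exact ⟨i, hi, rfl⟩

theorem exists_leftShift (x : Tsirelson 𝕜 r) :
    ∃ z, (seq 𝕜 r z = fun i => seq 𝕜 r x (i + 1)) ∧ ‖z‖ ≤ 1 * ‖x‖ := by
  refine exists_seq_eq_apply (S := LinearMap.funLeft 𝕜 𝕜 (· + 1)) zero_le_one (fun a => ?_)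
    (fun a ha => ha.preimage (add_left_injective 1).injOn) x
  rw [ENNReal.ofReal_one, one_mul]
  exact convexNorm_leftShift_le (exponent_pos r) a

theorem isSolidSequenceSpace_seq : IsSolidSequenceSpace (seq 𝕜 r) where
  norm_mono x y h := by
    rw [← enorm_le_iff_norm_le, enorm_eq, enorm_eq]
    exact convexNorm_mono (exponent_pos r) h
  norm_seq_le x i := FiniteNorm.norm_toSeq_le (x : FiniteNorm 𝕜 r) i
  exists_seq_eq_single k := by
    obtain ⟨x, hx⟩ := FiniteNorm.exists_toSeq_eq (ne_top_of_le_ne_top ENNReal.one_ne_top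
      (convexNorm_single_le (𝕜 := 𝕜) (exponent_pos r) k))
    refine ⟨⟨x, subset_closure ?_⟩, hx⟩
    change (Function.support (FiniteNorm.toSeq 𝕜 r x)).Finite
    rw [hx]
    exact (Set.finite_singleton k).subset Pi.support_single_subset
  exists_norm_sub_lt x ε hε := by
    obtain ⟨y, hy, hxy⟩ := Metric.mem_closure_iff.1 x.2 ε hε
    obtain ⟨n, hn⟩ :=
      (show (Function.support (FiniteNorm.toSeq 𝕜 r y)).Finite from hy).bddAbove
    refine ⟨⟨y, subset_closure hy⟩, n + 1, fun i hi => ?_, ?_⟩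
    · by_contra h
      exact (Nat.lt_of_succ_le hi).not_ge (hn h)
    · rwa [dist_eq_norm] at hxy

variable (𝕜 r) in
/-- The unit vector basis of `T^{(r)}`. -/
noncomputable def basis : SchauderBasis 𝕜 (Tsirelson 𝕜 r) := isSolidSequenceSpace_seq.basis

theorem isBimonotone_basis : IsBimonotone (basis 𝕜 r) :=
  isSolidSequenceSpace_seq.isBimonotone_basis

theorem nonempty_prod_equiv : Nonempty ((Tsirelson 𝕜 r × 𝕜) ≃L[𝕜] Tsirelson 𝕜 r) :=
  isSolidSequenceSpace_seq.nonempty_prod_equiv exists_rightShift exists_leftShift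

theorem isRpowSubadditive : IsRpowSubadditive (basis 𝕜 r) (r : ℝ) := by
  intro n x y hx hy
  have hr := exponent_pos r
  rw [← ENNReal.ofReal_le_ofReal_iff (by positivity),
    ENNReal.ofReal_add (by positivity) (by positivity), ofReal_norm_rpow, ofReal_norm_rpow,
    ofReal_norm_rpow]
  refine (tsirelsonNorm_mono fun i => ?_).trans (tsirelsonNorm_add _ _)
  rw [map_add, Pi.add_apply, Pi.add_apply]
  rcases isSolidSequenceSpace_seq.seq_eq_zero_or_seq_eq_zero hx hy i with h | h <;> simp [h, hr]

theorem ofReal_norm_tail_sub_tail_rpow {m n : ℕ} (h : m ≤ n) (x : Tsirelson 𝕜 r) :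
    ENNReal.ofReal (‖tail (basis 𝕜 r) m x - tail (basis 𝕜 r) n x‖ ^ (r : ℝ)) =
      tsirelsonNorm ((Finset.Ico m n : Set ℕ).indicator fun i => ‖seq 𝕜 r x i‖ₑ ^ (r : ℝ)) := by
  have htail : ∀ n i, seq 𝕜 r (tail (basis 𝕜 r) n x) i = if i < n then 0 else seq 𝕜 r x i :=
    fun n => isSolidSequenceSpace_seq.seq_tail n x
  rw [ofReal_norm_rpow]
  congr 1
  ext i
  rw [map_sub, Pi.sub_apply, htail, htail, Set.indicator_apply]
  simp only [Finset.coe_Ico, Set.mem_Ico]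
  split_ifs <;> first | omega | simp [exponent_pos r]

theorem admissible_Ico {n : ℕ → ℕ} (hn : StrictMono n) (N : ℕ) :
    Admissible fun j : Fin N => Finset.Ico (n (N + j)) (n (N + j + 1)) := by
  refine ⟨fun j i hi => ?_, fun j l hjl i hi i' hi' => ?_⟩
  · have := hn.le_apply (x := N + j)
    have := (Finset.mem_Ico.1 hi).1
    omega
  · have hle : n (N + j + 1) ≤ n (N + l) := hn.monotone (by omega)
    exact ((Finset.mem_Ico.1 hi).2.trans_le hle).trans_le (Finset.mem_Ico.1 hi').1

theorem asymptoticLower : AsymptoticLower (basis 𝕜 r) (r : ℝ) := by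
  intro n hn N x
  rw [← ENNReal.ofReal_le_ofReal_iff (by positivity), ENNReal.ofReal_mul zero_le_two,
    ENNReal.ofReal_sum_of_nonneg fun _ _ => by positivity, ofReal_norm_rpow, ENNReal.ofReal_ofNat,
    Finset.sum_range, ← ENNReal.inv_mul_le_iff two_ne_zero ENNReal.ofNat_ne_top]
  simp only [ofReal_norm_tail_sub_tail_rpow (hn.monotone (Nat.le_succ _))]
  exact half_sum_tsirelsonNorm_le (admissible_Ico hn N) _

theorem enorm_sum_rpow_of_pairwise {ι : Type*} {s : Finset ι} {t : ℝ} (ht : 0 < t) {f : ι → 𝕜}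
    (hf : Pairwise fun k l => f k = 0 ∨ f l = 0) : ‖∑ k ∈ s, f k‖ₑ ^ t = ∑ k ∈ s, ‖f k‖ₑ ^ t := by
  by_cases h : ∃ k ∈ s, f k ≠ 0
  · obtain ⟨k, hk, hfk⟩ := h
    have hzero : ∀ l, l ≠ k → f l = 0 := fun l hl => (hf hl).resolve_right hfk
    rw [Finset.sum_eq_single_of_mem k hk fun l _ hl => hzero l hl,
      Finset.sum_eq_single_of_mem k hk fun l _ hl => by simp [hzero l hl, ht]]
  · push Not at h
    rw [Finset.sum_eq_zero h, Finset.sum_eq_zero fun k hk => by simp [h k hk, ht]]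
    simp [ht]

theorem enorm_spreadWeight_rpow {t : ℝ} (ht : 0 < t) {N : ℕ} (hN : 0 < N) {k : ℕ} (hk : k ≠ 0) :
    ‖spreadWeight 𝕜 t⁻¹ N k‖ₑ ^ t = (N : ℝ≥0∞)⁻¹ := by
  have hN' : (0 : ℝ) < N := Nat.cast_pos.2 hN
  rw [spreadWeight, if_neg hk, ← ofReal_norm, RCLike.norm_ofReal, abs_of_nonneg (by positivity),
    ENNReal.ofReal_rpow_of_nonneg (by positivity) ht.le, ← Real.rpow_mul hN'.le, neg_mul,
    inv_mul_cancel₀ ht.ne', Real.rpow_neg_one, ENNReal.ofReal_inv_of_pos hN',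
    ENNReal.ofReal_natCast]

theorem enorm_seq_spread_rpow {n : ℕ → ℕ} {u : ℕ → Tsirelson 𝕜 r}
    (hu : IsBlockSeq (basis 𝕜 r) n u) {N : ℕ} (hN : 0 < N) (i : ℕ) :
    ‖seq 𝕜 r (spread 𝕜 (r : ℝ)⁻¹ N u) i‖ₑ ^ (r : ℝ) = ‖seq 𝕜 r (u 0) i‖ₑ ^ (r : ℝ) +
      (N : ℝ≥0∞)⁻¹ * ∑ k ∈ Finset.Ico 1 (N + 1), ‖seq 𝕜 r (u k) i‖ₑ ^ (r : ℝ) := by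
  have hr := exponent_pos r
  have hdisj : Pairwise fun k l => spreadWeight 𝕜 (r : ℝ)⁻¹ N k • seq 𝕜 r (u k) i = 0 ∨
      spreadWeight 𝕜 (r : ℝ)⁻¹ N l • seq 𝕜 r (u l) i = 0 := fun k l hkl => by
    by_contra! h
    exact (hu.strictMono.monotone.pairwise_disjoint_on_Ico_succ hkl).le_bot
      ⟨isSolidSequenceSpace_seq.mem_Ico_of_isBlockSeq hu (right_ne_zero_of_smul h.1),
        isSolidSequenceSpace_seq.mem_Ico_of_isBlockSeq hu (right_ne_zero_of_smul h.2)⟩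
  have hsum : seq 𝕜 r (spread 𝕜 (r : ℝ)⁻¹ N u) i =
      ∑ k ∈ Finset.Ico 0 (N + 1), spreadWeight 𝕜 (r : ℝ)⁻¹ N k • seq 𝕜 r (u k) i := by
    simp [spread_eq_sum]
  have hzero : spreadWeight 𝕜 (r : ℝ)⁻¹ N 0 = 1 := by simp [spreadWeight]
  rw [hsum, enorm_sum_rpow_of_pairwise hr hdisj, Finset.sum_eq_sum_Ico_succ_bot N.succ_pos, hzero,
    one_smul, Finset.mul_sum]
  refine congrArg _ (Finset.sum_congr rfl fun k hk => ?_)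
  rw [enorm_smul, ENNReal.mul_rpow_of_nonneg _ _ hr.le,
    enorm_spreadWeight_rpow hr hN (Nat.one_le_iff_ne_zero.1 (Finset.mem_Ico.1 hk).1)]

theorem upperSpread : UpperSpread (basis 𝕜 r) (r : ℝ)⁻¹ ((7 / 4) ^ (r : ℝ)⁻¹) := by
  intro n u hu hu₁
  have hr := exponent_pos r
  let w : ℕ → ℕ → ℝ≥0∞ := fun k i => ‖seq 𝕜 r (u k) i‖ₑ ^ (r : ℝ)
  have hw : ∀ k i, w k i ≠ 0 → n k ≤ i ∧ i < n (k + 1) := fun k i hi =>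
    isSolidSequenceSpace_seq.mem_Ico_of_isBlockSeq hu fun h => hi (by simp [w, h, hr])
  have hw₁ : ∀ k, tsirelsonNorm (w k) ≤ 1 := fun k => by
    rw [← ofReal_norm_rpow]
    exact ENNReal.ofReal_le_one.2 (Real.rpow_le_one (norm_nonneg _) (hu₁ k) hr.le)
  filter_upwards [eventually_gt_atTop 0, eventually_ge_atTop (2 * n 1)] with N hN₀ hN
  have hspread : (fun i => ‖seq 𝕜 r (spread 𝕜 (r : ℝ)⁻¹ N u) i‖ₑ ^ (r : ℝ)) = w 0 +
      fun i => ((Finset.Ico 1 (N + 1)).card : ℝ≥0∞)⁻¹ * (∑ k ∈ Finset.Ico 1 (N + 1), w k) i := by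
    ext i
    rw [enorm_seq_spread_rpow hu hN₀, Pi.add_apply, Finset.sum_apply, Nat.card_Ico,
      Nat.add_sub_cancel]
  have hconst : (7 / 4 : ℝ≥0∞) = ENNReal.ofReal (7 / 4) := by
    rw [ENNReal.ofReal_div_of_pos (by norm_num), ENNReal.ofReal_ofNat, ENNReal.ofReal_ofNat]
  rw [Real.le_rpow_inv_iff_of_pos (norm_nonneg _) (by norm_num) hr,
    ← ENNReal.ofReal_le_ofReal_iff (by norm_num), ofReal_norm_rpow, hspread, ← hconst]
  exact tsirelsonNorm_add_average_le hu.strictMono hw hw₁ ⟨1, by simpa using hN₀⟩ (by simp)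
    (by simpa using hN)

theorem upperEstimate : UpperEstimate (basis 𝕜 r) (r : ℝ)⁻¹ 1 :=
  isRpowSubadditive.upperEstimate (exponent_pos r)

theorem shrinking_basis : Shrinking (basis 𝕜 r) := by
  rcases eq_or_lt_of_le (show (1 : ℝ) ≤ r from r.2) with h | h
  · have hspread := upperSpread (𝕜 := 𝕜) (r := r)
    rw [← h, inv_one, Real.rpow_one] at hspread
    exact shrinking_of_upperSpread isBimonotone_basis (by norm_num) hspread
  · exact shrinking_of_upperEstimate isBimonotone_basis (inv_lt_one_of_one_lt₀ h) upperEstimate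

end Tsirelson

/-! ### Comparison of the summands -/

section HasExponent

variable {𝕜 : Type*} [RCLike 𝕜] {X Y : Type*} [NormedAddCommGroup X] [NormedSpace 𝕜 X]
  [NormedAddCommGroup Y] [NormedSpace 𝕜 Y]

/-- The basis `E` behaves asymptotically like the unit vector basis of `ℓ_p`, `α = 1 / p`: blocks of
`E` satisfy an upper and, unless `α = 0`, a lower `p`-estimate, and `E` is shrinking if `p > 1`. -/
structure HasExponent (E : SchauderBasis 𝕜 X) (α : ℝ) : Prop where
  isBimonotone : IsBimonotone E
  nonneg : 0 ≤ α
  exists_upperEstimate : ∃ C, UpperEstimate E α C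
  exists_lowerEstimate : 0 < α → ∃ c > 0, LowerEstimate E α c
  shrinking : α < 1 → Shrinking E

theorem HasExponent.smallOnTails {E : SchauderBasis 𝕜 X} {F : SchauderBasis 𝕜 Y} {α α' : ℝ}
    (hE : HasExponent E α) (hF : HasExponent F α') (hα' : α' ≤ 1) (h : α < α') :
    SmallOnTails E Y := by
  have hpos : 0 < α' := hE.nonneg.trans_lt h
  obtain ⟨C, hC⟩ := hE.exists_upperEstimate
  obtain ⟨c, hc₀, hc⟩ := hF.exists_lowerEstimate hpos
  exact smallOnTails_of_estimates hE.isBimonotone (hE.shrinking (h.trans_le hα')) hpos h hc₀ hC hc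

end HasExponent

section Members

variable {𝕜 : Type*} [RCLike 𝕜] (p : Set.Ici (1 : ℝ≥0∞)) (r : Set.Ici (1 : ℝ))
  (s : Set.Ioi (1 : ℝ≥0∞))

theorem Ell.exists_upperEstimate :
    ∃ C, UpperEstimate (Ell.basis 𝕜 p) (p : ℝ≥0∞).toReal⁻¹ C := by
  by_cases hp : (p : ℝ≥0∞) = ∞
  · rw [show (p : ℝ≥0∞).toReal⁻¹ = 0 by simp [hp]]
    exact ⟨1, (Ell.isMaxSubadditive hp).upperEstimate⟩
  · exact ⟨1, (Ell.isRpowSubadditive hp).upperEstimate (Ell.toReal_pos hp)⟩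

theorem Ell.hasExponent : HasExponent (Ell.basis 𝕜 p) (p : ℝ≥0∞).toReal⁻¹ where
  isBimonotone := Ell.isBimonotone_basis
  nonneg := inv_nonneg.2 ENNReal.toReal_nonneg
  exists_upperEstimate := Ell.exists_upperEstimate p
  exists_lowerEstimate h := by
    have hp : (p : ℝ≥0∞) ≠ ∞ := fun hp => by simp [hp] at h
    exact ⟨1, one_pos, (Ell.isRpowSuperadditive hp).lowerEstimate (Ell.toReal_pos hp)⟩
  shrinking h :=
    shrinking_of_upperEstimate Ell.isBimonotone_basis h (Ell.exists_upperEstimate p).choose_spec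

theorem Ell.upperSpread :
    UpperSpread (Ell.basis 𝕜 p) (p : ℝ≥0∞).toReal⁻¹ (2 ^ (p : ℝ≥0∞).toReal⁻¹) := by
  by_cases hp : (p : ℝ≥0∞) = ∞
  · rw [show (p : ℝ≥0∞).toReal⁻¹ = 0 by simp [hp], Real.rpow_zero]
    exact (Ell.isMaxSubadditive hp).upperSpread
  · exact (Ell.isRpowSubadditive hp).upperSpread (Ell.toReal_pos hp)

theorem Tsirelson.hasExponent : HasExponent (Tsirelson.basis 𝕜 r) (r : ℝ)⁻¹ where
  isBimonotone := Tsirelson.isBimonotone_basis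
  nonneg := inv_nonneg.2 (exponent_pos r).le
  exists_upperEstimate := ⟨1, Tsirelson.upperEstimate⟩
  exists_lowerEstimate _ :=
    ⟨_, by positivity, Tsirelson.asymptoticLower.lowerEstimate (exponent_pos r)⟩
  shrinking _ := Tsirelson.shrinking_basis

variable (𝕜) in
/-- The basis of `T_*^{(s)}` which is biorthogonal to the unit vector basis of `T^{(r)}`. -/
noncomputable def TsirelsonDual.basis : SchauderBasis 𝕜 (TsirelsonDual 𝕜 s) :=
  dualBasis (Tsirelson.basis 𝕜 (conjExp s)) Tsirelson.shrinking_basis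

theorem TsirelsonDual.isBimonotone_basis : IsBimonotone (TsirelsonDual.basis 𝕜 s) :=
  Tsirelson.isBimonotone_basis.dualBasis Tsirelson.shrinking_basis

theorem TsirelsonDual.upperEstimate :
    UpperEstimate (TsirelsonDual.basis 𝕜 s) (1 - (conjExp s : ℝ)⁻¹) (2 ^ (conjExp s : ℝ)⁻¹) :=
  Tsirelson.asymptoticLower.dual_upperEstimate Tsirelson.shrinking_basis (conjExp s).2

theorem TsirelsonDual.hasExponent :
    HasExponent (TsirelsonDual.basis 𝕜 s) (1 - (conjExp s : ℝ)⁻¹) where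
  isBimonotone := TsirelsonDual.isBimonotone_basis s
  nonneg := sub_nonneg.2 (inv_le_one_of_one_le₀ (conjExp s).2)
  exists_upperEstimate := ⟨_, TsirelsonDual.upperEstimate s⟩
  exists_lowerEstimate h := ⟨_, by norm_num, Tsirelson.upperEstimate.dual_lowerEstimate
    Tsirelson.isBimonotone_basis Tsirelson.shrinking_basis (sub_pos.1 h) one_pos⟩
  shrinking h := shrinking_of_upperEstimate (TsirelsonDual.isBimonotone_basis s) h
    (TsirelsonDual.upperEstimate s)

theorem TsirelsonDual.exists_lowerSpread :
    ∃ κ, (2 : ℝ) ^ (1 - (conjExp s : ℝ)⁻¹) < κ ∧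
      LowerSpread (TsirelsonDual.basis 𝕜 s) (1 - (conjExp s : ℝ)⁻¹) κ := by
  have hr : 0 < (conjExp s : ℝ)⁻¹ := inv_pos.2 (exponent_pos (conjExp s))
  have hpos : (0 : ℝ) < (7 / 4) ^ (conjExp s : ℝ)⁻¹ := by positivity
  have hlt : (2 : ℝ) ^ (1 - (conjExp s : ℝ)⁻¹) < 2 / (7 / 4) ^ (conjExp s : ℝ)⁻¹ := by
    rw [lt_div_iff₀ hpos]
    calc (2 : ℝ) ^ (1 - (conjExp s : ℝ)⁻¹) * (7 / 4) ^ (conjExp s : ℝ)⁻¹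
        < 2 ^ (1 - (conjExp s : ℝ)⁻¹) * 2 ^ (conjExp s : ℝ)⁻¹ := by
          gcongr
          norm_num
      _ = 2 := by rw [← Real.rpow_add two_pos, sub_add_cancel, Real.rpow_one]
  obtain ⟨κ, hκ, hκ'⟩ := exists_between hlt
  exact ⟨κ, hκ, Tsirelson.upperSpread.dual_lowerSpread Tsirelson.isBimonotone_basis
    Tsirelson.shrinking_basis hpos ((lt_div_iff₀ hpos).1 hκ')⟩

variable {p r s}

theorem smallOnTails_tsirelson_ell (h : (r : ℝ)⁻¹ = (p : ℝ≥0∞).toReal⁻¹) :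
    SmallOnTails (Tsirelson.basis 𝕜 r) (Ell 𝕜 p) := by
  have hr : 0 < (r : ℝ)⁻¹ := inv_pos.2 (exponent_pos r)
  have hp : (p : ℝ≥0∞) ≠ ∞ := fun hp => hr.ne' (by rw [h, hp, ENNReal.toReal_top, inv_zero])
  have hlower := (Ell.isRpowSuperadditive (𝕜 := 𝕜) hp).lowerSpread (Ell.toReal_pos hp)
  rw [← h] at hlower
  exact smallOnTails_of_spread Tsirelson.isBimonotone_basis Tsirelson.shrinking_basis hr.le
    (Real.rpow_lt_rpow (by norm_num) (by norm_num) hr) Tsirelson.upperSpread hlower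

theorem smallOnTails_ell_tsirelsonDual (h : (p : ℝ≥0∞).toReal⁻¹ = 1 - (conjExp s : ℝ)⁻¹) :
    SmallOnTails (Ell.basis 𝕜 p) (TsirelsonDual 𝕜 s) := by
  obtain ⟨κ, hκ, hlower⟩ := TsirelsonDual.exists_lowerSpread (𝕜 := 𝕜) s
  have hlt : (p : ℝ≥0∞).toReal⁻¹ < 1 :=
    h.trans_lt (sub_lt_self _ (inv_pos.2 (exponent_pos (conjExp s))))
  rw [← h] at hκ hlower
  exact smallOnTails_of_spread Ell.isBimonotone_basis ((Ell.hasExponent p).shrinking hlt)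
    (inv_nonneg.2 ENNReal.toReal_nonneg) hκ (Ell.upperSpread p) hlower

theorem smallOnTails_tsirelson_tsirelsonDual (h : (r : ℝ)⁻¹ = 1 - (conjExp s : ℝ)⁻¹) :
    SmallOnTails (Tsirelson.basis 𝕜 r) (TsirelsonDual 𝕜 s) := by
  obtain ⟨κ, hκ, hlower⟩ := TsirelsonDual.exists_lowerSpread (𝕜 := 𝕜) s
  have hr : 0 ≤ (r : ℝ)⁻¹ := inv_nonneg.2 (exponent_pos r).le
  rw [← h] at hκ hlower
  have hlt : (7 / 4 : ℝ) ^ (r : ℝ)⁻¹ < κ :=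
    (Real.rpow_le_rpow (by norm_num) (by norm_num) hr).trans_lt hκ
  exact smallOnTails_of_spread Tsirelson.isBimonotone_basis Tsirelson.shrinking_basis hr hlt
    Tsirelson.upperSpread hlower

end Members

theorem toReal_inv_injective :
    Function.Injective fun p : Set.Ici (1 : ℝ≥0∞) => (p : ℝ≥0∞).toReal⁻¹ := fun p q h => by
  have hfin (p : Set.Ici (1 : ℝ≥0∞)) : (p : ℝ≥0∞)⁻¹ ≠ ∞ :=
    ENNReal.inv_ne_top.2 (zero_lt_one.trans_le p.2).ne'
  simp only [← ENNReal.toReal_inv] at h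
  exact Subtype.ext (inv_injective ((ENNReal.toReal_eq_toReal_iff' (hfin p) (hfin q)).1 h))

theorem conjExp_injective : Function.Injective conjExp := fun s t h => by
  have hfin (s : Set.Ioi (1 : ℝ≥0∞)) : 1 + ((s : ℝ≥0∞) - 1)⁻¹ ≠ ∞ :=
    ENNReal.add_ne_top.2 ⟨ENNReal.one_ne_top, ENNReal.inv_ne_top.2 (tsub_pos_of_lt s.2).ne'⟩
  have hreal : (1 + ((s : ℝ≥0∞) - 1)⁻¹).toReal = (1 + ((t : ℝ≥0∞) - 1)⁻¹).toReal :=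
    congrArg (fun x : Set.Ici (1 : ℝ) => (x : ℝ)) h
  have hadd : 1 + ((s : ℝ≥0∞) - 1)⁻¹ = 1 + ((t : ℝ≥0∞) - 1)⁻¹ :=
    (ENNReal.toReal_eq_toReal_iff' (hfin s) (hfin t)).1 hreal
  have hsub : (s : ℝ≥0∞) - 1 = t - 1 :=
    inv_injective ((ENNReal.add_right_inj ENNReal.one_ne_top).1 hadd)
  exact Subtype.ext ((tsub_left_inj s.2.le t.2.le).1 hsub)

section Family

variable (𝕜 : Type*) [RCLike 𝕜] (A : Finset (Set.Ici (1 : ℝ≥0∞))) (B : Finset (Set.Ici (1 : ℝ)))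
  (D : Finset (Set.Ioi (1 : ℝ≥0∞)))

instance : ∀ i, CompleteSpace (Family 𝕜 A B D i)
  | .inl p => inferInstanceAs (CompleteSpace (Ell 𝕜 p))
  | .inr (.inl r) => inferInstanceAs (CompleteSpace (Tsirelson 𝕜 r))
  | .inr (.inr s) => inferInstanceAs (CompleteSpace (TsirelsonDual 𝕜 s))

/-- The canonical bases of the members of the family. -/
noncomputable def familyBasis : ∀ i, SchauderBasis 𝕜 (Family 𝕜 A B D i)
  | .inl p => Ell.basis 𝕜 p
  | .inr (.inl r) => Tsirelson.basis 𝕜 r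
  | .inr (.inr s) => TsirelsonDual.basis 𝕜 s

variable {A B D}

/-- The exponents, in the sense of `HasExponent`, of the members of the family: `1 / p`, `1 / r`
and `1 / s`, the latter as `1 - 1 / r` with `r` conjugate to `s`. -/
noncomputable def familyExponent : A ⊕ B ⊕ D → ℝ
  | .inl p => (p.1 : ℝ≥0∞).toReal⁻¹
  | .inr (.inl r) => (r.1 : ℝ)⁻¹
  | .inr (.inr s) => 1 - (conjExp s : ℝ)⁻¹

theorem familyExponent_le_one : ∀ i : A ⊕ B ⊕ D, familyExponent i ≤ 1
  | .inl p => by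
    rw [familyExponent, ← ENNReal.toReal_inv]
    exact ENNReal.toReal_le_of_le_ofReal zero_le_one
      (by rw [ENNReal.ofReal_one]; exact ENNReal.inv_le_one.2 p.1.2)
  | .inr (.inl r) => inv_le_one_of_one_le₀ r.1.2
  | .inr (.inr _) => sub_le_self _ (inv_pos.2 (exponent_pos _)).le

theorem hasExponent_familyBasis :
    ∀ i, HasExponent (familyBasis 𝕜 A B D i) (familyExponent i)
  | .inl p => Ell.hasExponent p.1
  | .inr (.inl r) => Tsirelson.hasExponent r.1
  | .inr (.inr s) => TsirelsonDual.hasExponent s.1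

theorem nonempty_family_prod_equiv :
    ∀ i, Nonempty ((Family 𝕜 A B D i × 𝕜) ≃L[𝕜] Family 𝕜 A B D i)
  | .inl p => Ell.nonempty_prod_equiv (p := p.1)
  | .inr (.inl r) => Tsirelson.nonempty_prod_equiv (r := r.1)
  | .inr (.inr s) => nonempty_dual_prod_equiv (Tsirelson.nonempty_prod_equiv (r := conjExp s))

theorem smallOnTails_of_familyExponent_eq : ∀ i j : A ⊕ B ⊕ D, i ≠ j →
    familyExponent i = familyExponent j →
    SmallOnTails (familyBasis 𝕜 A B D i) (Family 𝕜 A B D j) ∨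
      SmallOnTails (familyBasis 𝕜 A B D j) (Family 𝕜 A B D i)
  | .inl _, .inl _, hij, h => (hij (congrArg _ (Subtype.ext (toReal_inv_injective h)))).elim
  | .inl _, .inr (.inl _), _, h => .inr (smallOnTails_tsirelson_ell h.symm)
  | .inl _, .inr (.inr _), _, h => .inl (smallOnTails_ell_tsirelsonDual h)
  | .inr (.inl _), .inl _, _, h => .inl (smallOnTails_tsirelson_ell h)
  | .inr (.inl _), .inr (.inl _), hij, h =>
    (hij (congrArg _ (congrArg _ (Subtype.ext (Subtype.ext (inv_injective h)))))).elim
  | .inr (.inl _), .inr (.inr _), _, h => .inl (smallOnTails_tsirelson_tsirelsonDual h)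
  | .inr (.inr _), .inl _, _, h => .inr (smallOnTails_ell_tsirelsonDual h.symm)
  | .inr (.inr _), .inr (.inl _), _, h => .inr (smallOnTails_tsirelson_tsirelsonDual h.symm)
  | .inr (.inr _), .inr (.inr _), hij, h =>
    (hij (congrArg _ (congrArg _ (Subtype.ext (conjExp_injective
      (Subtype.ext (inv_injective (sub_right_injective h)))))))).elim

theorem smallOnTails_familyBasis (i j : A ⊕ B ⊕ D) (hij : i ≠ j) :
    SmallOnTails (familyBasis 𝕜 A B D i) (Family 𝕜 A B D j) ∨
      SmallOnTails (familyBasis 𝕜 A B D j) (Family 𝕜 A B D i) := by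
  have hi := hasExponent_familyBasis 𝕜 i
  have hj := hasExponent_familyBasis 𝕜 j
  rcases lt_trichotomy (familyExponent i) (familyExponent j) with h | h | h
  · exact .inl (hi.smallOnTails hj (familyExponent_le_one j) h)
  · exact smallOnTails_of_familyExponent_eq 𝕜 i j hij h
  · exact .inr (hj.smallOnTails hi (familyExponent_le_one i) h)

end Family

end UncBasis

theorem mainTheorem6 {𝕜 : Type u} [RCLike 𝕜]
    (A : Finset (Set.Ici (1 : ENNReal))) (B : Finset (Set.Ici (1 : ℝ)))
    (D : Finset (Set.Ioi (1 : ENNReal))) :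
    UncBasis.SplittingForUnconditionalBases.{u, 0, u, w} 𝕜 (UncBasis.Family 𝕜 A B D) := by
  exact UncBasis.splitting_of_smallOnTails (UncBasis.familyBasis 𝕜 A B D)
    (UncBasis.nonempty_family_prod_equiv 𝕜) (UncBasis.smallOnTails_familyBasis 𝕜)
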